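/- Let $d\ge 3$. Let $F$ be given by complex numbers $\alpha_{j,F}(p)$ ($p$ prime, $1\le j\le d$), and let $\lambda_F$ be the multiplicative function with $\lambda_F(p^r)=\sum_{r_1+\cdots+r_d=r}\prod_{j}\alpha_{j,F}(p)^{r_j}$. For $q\ge 2$ and $\chi$ a primitive Dirichlet character modulo $q$ put, for $\Re(s)>1$, $$L(s,F)=\sum_{n\ge1}\frac{\lambda_F(n)}{n^s}=\prod_p\prod_{j=1}^d\Big(1-\frac{\alpha_{j,F}(p)}{p^s}\Big)^{-1},\qquad L(s,F\times\chi)=\sum_{n\ge1}\frac{\lambda_F(n)\chi(n)}{n^s}=\prod_p\prod_{j=1}^d\Big(1-\frac{\alpha_{j,F}(p)\chi(p)}{p^s}\Big)^{-1}.$$ Assume throughout the following standing properties. * All these series and products converge absolutely for $\Re(s)>1$. * Let $L_\infty(s,F\times\chi)=N^{s/2}\prod_{j=1}^d\Gamma_{\mathbb R}(s+\mu_j)$ with $\Gamma_{\mathbb R}(s)=\pi^{-s/2}\Gamma(s/2)$, where the conductor $N>0$ depends only on $F$ and $q$, the $\mu_j\in\mathbb C$ depend only on $F$ and $\chi(-1)$,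 and $\Re(\mu_j)\ge-1+\theta_F$ for some fixed $\theta_F$ with $\frac1{2d}<\theta_F<\frac12$. Then $\Lambda(s,F\times\chi)=L(s,F\times\chi)L_\infty(s,F\times\chi)$ extends to an entire function of order $1$ (so that $L(s,F\times\chi)$ extends to an entire function as well). * For some $\kappa=\kappa_{F,\chi}$ with $|\kappa|=1$ one has $\Lambda(s,F\times\chi)=\kappa\,\Lambda(1-s,\tilde F\times\bar\chi)$ for all $s$, where the dual $\tilde F$ has the parameters $\overline{\alpha_{j,F}(p)}$ and $\overline{\mu_j}$ and the same $N$; in particular $\lambda_{\tilde F}=\overline{\lambda_F}$. * The analytic conductor $C(s,F\times\chi)=N\prod_{j=1}^d|s+\mu_j+3|$ satisfies $C(\tfrac12,F\times\chi)\ll_F N\ll_F q^d$ for all large $q$. Assume moreover: * (A1) $|\lambda_F(n)|\le\tau_d(n)$ for all $n\ge1$, where $\tau_d$ is the $d$-fold divisor function. * (A2) For some fixed $\varepsilon>0$, $\sum_{X\le n\le X+Y}|\lambda_F(n)|^2\ll_F Y$ for all large $X$ and all $X^{1-\varepsilon}\le Y\le X$. * (A3) $\sum_{n\le X,\ (n,\prod_{P_1\le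 p\le P_2}p)=1}|\lambda_F(n)|^2\ll_F X\frac{\log P_1}{\log P_2}$ for all $2\le P_1\le P_2\le X$. For $q\ge2$, real constants $C_F,A$ and $\delta\in(0,1)$ consider the following two conditions on the modulus $q$; $\sum^*$ denotes summation over the primitive Dirichlet characters modulo $q$, and $\mathcal N_F(\sigma,T;\chi)$ is the number of zeros of $L(s,F\times\chi)$, with multiplicity, in $\Re(s)\ge\sigma$, $|\Im(s)|\le T$. * (A5) $\sum^*_{\chi\,(\mathrm{mod}\,q)}\mathcal N_F(\sigma,T;\chi)\ll_F q^{C_F(1-\sigma)}\log^A q$ for all $1-\frac1{2024}<\sigma<1$ and $1\le T\le q$. * (A6) $L(\tfrac12,F\times\chi)\ll_F q^{d/4}/\exp(\log^\delta q)$ for all primitive $\chi$ modulo $q$. Then for every $\eta<\delta$ there is a constant $K$, depending only on $F$, $\delta$, $\eta$, $C_F$, $A$ and the implied constants in (A5) and (A6), such that for every $q\ge 2$ for which (A5) and (A6) hold with these constants $$\sideset{}{^*}\sum_{\chi\,(\mathrm{mod}\,q)}\Big|L\big(\tfrac12,F\times\chi\big)\Big|^2\le K\,\frac{q^{d/2}}{\log^\eta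 q}.$$ -/

import Mathlib

open Filter Topology

noncomputable section

/-- Raw data of a degree `d` `L`-function `F` and of its twists by primitive Dirichlet characters:
the Satake parameters `α p j` (used only at primes `p`), the conductor `N q` of `F × χ` for `χ`
primitive modulo `q`, and the archimedean parameters for even and for odd `χ`. -/
structure LDatum (d : ℕ) where
  α : ℕ → Fin d → ℂ
  N : ℕ → ℝ
  muEven : Fin d → ℂ
  muOdd : Fin d → ℂ

/-- The entire continuation of a function given on the half plane `1 < Re s`
(it is unique if it exists, see `entireContinuation_eq`). -/
def HasEntireContinuation (f : ℂ → ℂ) : Prop :=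
  ∃ g : ℂ → ℂ, Differentiable ℂ g ∧ ∀ s : ℂ, 1 < s.re → g s = f s

open Classical in
def entireContinuation (f : ℂ → ℂ) : ℂ → ℂ :=
  if h : HasEntireContinuation f then h.choose else f

theorem entireContinuation_eq {f g : ℂ → ℂ} (hg : Differentiable ℂ g)
    (hfg : ∀ s : ℂ, 1 < s.re → g s = f s) : entireContinuation f = g := by
  have h : HasEntireContinuation f := ⟨g, hg, hfg⟩
  have h1 := h.choose_spec
  unfold entireContinuation
  rw [dif_pos h]
  have hA : AnalyticOnNhd ℂ h.choose Set.univ := h1.1.differentiableOn.analyticOnNhd isOpen_univ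
  have hB : AnalyticOnNhd ℂ g Set.univ := hg.differentiableOn.analyticOnNhd isOpen_univ
  refine hA.eq_of_eventuallyEq hB (z₀ := 2) ?_
  have hopen : IsOpen {s : ℂ | 1 < s.re} := isOpen_lt continuous_const Complex.continuous_re
  filter_upwards [hopen.mem_nhds (show (2 : ℂ) ∈ {s : ℂ | 1 < s.re} by norm_num)] with s hs
  rw [h1.2 s hs, hfg s hs]

/-- The entire function `f` has order (of growth) exactly `ρ`. -/
def HasGrowthOrder (f : ℂ → ℂ) (ρ : ℝ) : Prop :=
  (∀ r : ℝ, ρ < r → f =O[cocompact ℂ] fun z => Real.exp (‖z‖ ^ r)) ∧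
  ∀ r : ℝ, r < ρ → ¬ f =O[cocompact ℂ] fun z => Real.exp (‖z‖ ^ r)

/-- The finite set of primitive Dirichlet characters modulo `q`. -/
def primitiveChars (q : ℕ) [NeZero q] : Finset (DirichletCharacter ℂ q) :=
  (Set.toFinite {χ : DirichletCharacter ℂ q | χ.IsPrimitive}).toFinset

/-- Absolute convergence, for `1 < Re s`, of the Euler product
`∏ p, ∏ j, (1 - a p j / p ^ s)⁻¹`. -/
def EulerProductConverges {d : ℕ} (a : ℕ → Fin d → ℂ) : Prop :=
  ∀ s : ℂ, 1 < s.re →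
    (∀ (p : Nat.Primes) (j : Fin d), 1 - a p j / ((p : ℕ) : ℂ) ^ s ≠ 0) ∧
    Summable fun x : Nat.Primes × Fin d =>
      ‖(1 - a x.1 x.2 / ((x.1 : ℕ) : ℂ) ^ s)⁻¹ - 1‖

namespace LDatum

variable {d : ℕ} (F : LDatum d) {q : ℕ} (χ : DirichletCharacter ℂ q)

/-- `λ_F(p ^ r) = ∑_{r₁ + ⋯ + r_d = r} ∏ j, α_j(p) ^ r_j`. -/
def localCoeff (p r : ℕ) : ℂ :=
  ∑ k ∈ Finset.piAntidiag (Finset.univ : Finset (Fin d)) r, ∏ j, F.α p j ^ k j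

/-- The multiplicative function `λ_F`. -/
def coeff (n : ℕ) : ℂ :=
  if n = 0 then 0 else n.factorization.prod F.localCoeff

/-- The dual datum: all parameters are replaced by their complex conjugates. -/
def dual : LDatum d where
  α p j := starRingEnd ℂ (F.α p j)
  N := F.N
  muEven j := starRingEnd ℂ (F.muEven j)
  muOdd j := starRingEnd ℂ (F.muOdd j)

theorem coeff_dual (n : ℕ) : F.dual.coeff n = starRingEnd ℂ (F.coeff n) := by
  unfold coeff
  split_ifs
  · simp
  · simp [Finsupp.prod, localCoeff, dual]

open Classical in
/-- The archimedean parameters of `F × χ`, which depend on `χ` only through `χ (-1)`. -/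
def mu (j : Fin d) : ℂ := if χ.Even then F.muEven j else F.muOdd j

/-- `λ_F(n) χ(n)`. -/
def twistCoeff (n : ℕ) : ℂ := F.coeff n * χ n

/-- `L(s, F × χ)`: the entire continuation of the Dirichlet series `∑ λ_F(n) χ(n) n ^ (-s)`. -/
def twistL : ℂ → ℂ := entireContinuation fun s => LSeries (F.twistCoeff χ) s

/-- `L_∞(s, F × χ) = N ^ (s / 2) ∏ j, Γ_ℝ(s + μ_j)`. -/
def archFactor (s : ℂ) : ℂ := (F.N q : ℂ) ^ (s / 2) * ∏ j, Complex.Gammaℝ (s + F.mu χ j)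

/-- `L(s, F × χ) L_∞(s, F × χ)` in the half plane of absolute convergence. -/
def completedSeries (s : ℂ) : ℂ := LSeries (F.twistCoeff χ) s * F.archFactor χ s

/-- The completed `L`-function `Λ(s, F × χ)`. -/
def completedL : ℂ → ℂ := entireContinuation (F.completedSeries χ)

/-- The analytic conductor `C(s, F × χ)`. -/
def analyticConductor (s : ℂ) : ℝ := F.N q * ∏ j, ‖s + F.mu χ j + 3‖

/-- The standing properties of `F` and its twists. In `functional_equation` the character `χ⁻¹` is
the complex conjugate of `χ`. -/
structure IsStandard : Prop where
  series_converges : ∀ s : ℂ, 1 < s.re → LSeriesSummable F.coeff s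
  euler_converges : EulerProductConverges F.α
  twist_series_converges : ∀ q : ℕ, 2 ≤ q → ∀ χ : DirichletCharacter ℂ q, χ.IsPrimitive →
    ∀ s : ℂ, 1 < s.re → LSeriesSummable (F.twistCoeff χ) s
  twist_euler_converges : ∀ q : ℕ, 2 ≤ q → ∀ χ : DirichletCharacter ℂ q, χ.IsPrimitive →
    EulerProductConverges fun p j => F.α p j * χ p
  conductor_pos : ∀ q : ℕ, 2 ≤ q → 0 < F.N q
  mu_bound : ∃ θ : ℝ, 1 / (2 * d) < θ ∧ θ < 1 / 2 ∧
    ∀ j, -1 + θ ≤ (F.muEven j).re ∧ -1 + θ ≤ (F.muOdd j).re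
  entire : ∀ q : ℕ, 2 ≤ q → ∀ χ : DirichletCharacter ℂ q, χ.IsPrimitive →
    HasEntireContinuation (F.completedSeries χ) ∧ HasGrowthOrder (F.completedL χ) 1
  functional_equation : ∀ q : ℕ, 2 ≤ q → ∀ χ : DirichletCharacter ℂ q, χ.IsPrimitive →
    ∃ κ : ℂ, ‖κ‖ = 1 ∧ ∀ s : ℂ, F.completedL χ s = κ * F.dual.completedL χ⁻¹ (1 - s)
  conductor_bound : ∃ K : ℝ, ∀ᶠ q : ℕ in atTop, ∀ χ : DirichletCharacter ℂ q, χ.IsPrimitive →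
    F.analyticConductor χ (1 / 2) ≤ K * F.N q ∧ F.N q ≤ K * (q : ℝ) ^ d

/-- The Ramanujan bound `|λ_F(n)| ≤ τ_d(n)`, where `τ_d(n)` is the number of ordered
factorizations of `n` into `d` factors. -/
def RamanujanBound : Prop :=
  ∀ n : ℕ, 1 ≤ n → ‖F.coeff n‖ ≤ ((Nat.finMulAntidiag d n).card : ℝ)

/-- `∑_{X ≤ n ≤ X + Y} |λ_F(n)|² ≪ Y` for large `X` and `X ^ (1 - ε) ≤ Y ≤ X`, with some fixed
`ε > 0`. -/
def ShortAverageBound : Prop :=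
  ∃ ε : ℝ, 0 < ε ∧ ∃ K X₀ : ℝ, ∀ X Y : ℝ, 2 ≤ X → X₀ ≤ X → X ^ (1 - ε) ≤ Y → Y ≤ X →
    ∑ n ∈ Finset.Icc ⌈X⌉₊ ⌊X + Y⌋₊, ‖F.coeff n‖ ^ 2 ≤ K * Y

open Classical in
/-- `∑ |λ_F(n)|² ≪ X log P₁ / log P₂`, the sum being over the `n ≤ X` without prime factor in
`[P₁, P₂]`. -/
def SieveBound : Prop :=
  ∃ K : ℝ, ∀ X P₁ P₂ : ℝ, 2 ≤ P₁ → P₁ ≤ P₂ → P₂ ≤ X →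
    ∑ n ∈ (Finset.Icc 1 ⌊X⌋₊).filter
        (fun n => ∀ p : ℕ, p.Prime → P₁ ≤ p → (p : ℝ) ≤ P₂ → ¬ p ∣ n), ‖F.coeff n‖ ^ 2
      ≤ K * (X * (Real.log P₁ / Real.log P₂))

/-- `𝓝_F(σ, T; χ)`: the number of zeros of `L(s, F × χ)` with `Re s ≥ σ` and `|Im s| ≤ T`, counted
with multiplicity. -/
def zeroCount (σ T : ℝ) : ℕ :=
  ∑ᶠ s ∈ {s : ℂ | σ ≤ s.re ∧ |s.im| ≤ T ∧ F.twistL χ s = 0}, analyticOrderNatAt (F.twistL χ) s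

/-- The zero density estimate at the modulus `q`, with constants `C`, `A` and implied
constant `K`. -/
def ZeroDensityBound (q : ℕ) [NeZero q] (C A K : ℝ) : Prop :=
  ∀ σ T : ℝ, 1 - 1 / 2024 < σ → σ < 1 → 1 ≤ T → T ≤ q →
    ∑ χ ∈ primitiveChars q, (F.zeroCount χ σ T : ℝ) ≤
      K * ((q : ℝ) ^ (C * (1 - σ)) * Real.log q ^ A)

/-- The subconvexity bound at the modulus `q`, with implied constant `K`. -/
def SubconvexityBound (q : ℕ) [NeZero q] (δ K : ℝ) : Prop :=
  ∀ χ ∈ primitiveChars q,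
    ‖F.twistL χ (1 / 2)‖ ≤ K * ((q : ℝ) ^ ((d : ℝ) / 4) / Real.exp (Real.log q ^ δ))

end LDatum

end

/-!
The bound follows from a mean square estimate for the approximate functional equation, in which the
large sieve is sharpened by Ramaré's identity. Write `Q = q ^ (d / 2)` and `ℒ = log q`; it may be
assumed that `0 < η < δ`.

*Reduction to a smooth sum.* Shifting the line of integration in `∫ Λ(1/2 + s) P(s) e^{s²} ds / s`,
with an even polynomial `P` that cancels the first poles of the archimedean factor, gives
`L(1/2, F × χ) ≪ |∑ λ_F(n) χ(n) n^{-1/2} V(n / √N)|` (`LDatum.exists_norm_twistL_half_le`). As the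
dual data are the complex conjugates, both sums of the functional equation have the same size. The
weight `V` depends only on the parity of `χ`, and the sum is essentially over `n ≤ Q`.

*Exceptional characters.* By the zero density estimate there are at most `q^{o(1)}` characters
whose `L`-function has a zero in `Re s > 1 - ℒ^{δ' - 1}`, `|Im s| < q`, where `η < δ' < δ`; here
`q^{o(1)}` is `exp(O(ℒ^{δ'}))` up to powers of `ℒ`. The subconvexity bound saves `exp(2 ℒ^δ)`, which
is more (`LDatum.eventually_sum_exceptionalChars_le`).

*Factorization.* Let `I` be the set of the primes `p` with `ℒ^{1 - η} ≤ log p ≤ ℒ / 100`. By Ramaré's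
identity, `λ_F(n)` is the sum over `p ∈ I`, `n = p m`, of `λ_F(p) λ_F(m) / (ω_I(m) + 1)`, unless `n`
has no prime factor in `I` or one whose square divides `n`
(`LDatum.norm_coeff_sub_bilinearCoeff_le`). By the sieve bound the integers of the first kind
have density `O(ℒ^{-η})` for the weight `|λ_F|²`, and those of the second kind have density
`O(ℒ exp(-ℒ^{1 - η}))`. The large sieve, whose loss for sums longer than `q` is only the number of
integers per residue class, therefore bounds their contribution by `O(Q ℒ^{-η})`; this uses `q < Q`,
that is, `d ≥ 3` (`LDatum.sum_norm_sq_initial_le`, `LDatum.sum_norm_sq_final_le`).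

*Bilinear sums.* Mellin inversion separates the variables (`LDatum.bilinear_integral_eq`). The sum over
`m` has mean square `O(ℒ²)` by the large sieve. For a character that is not exceptional, the sum
`∑ λ_F(p) χ(p) p^{-1 - it}` over `p ∈ I` is `O(ℒ^{-3})` for moderate `t`
(`LDatum.exists_norm_sum_primeRange_le`): the series over all primes continues to the zero-free
region, where the Borel–Carathéodory inequality bounds it by a power of `ℒ`
(`LDatum.exists_extension_of_zero_free`), and Perron's formula with a trapezoidal weight can be
shifted to the left by `ℒ^{δ' - 1} / 2`, which saves `exp(ℒ^{δ' - η} / 2)`. So the bilinear sums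
contribute `O(Q ℒ^{-4})`.
-/


noncomputable section

namespace LDatum

variable {d : ℕ} (F : LDatum d)

/-! ### Arithmetic of the coefficients -/

theorem localCoeff_zero (p : ℕ) : F.localCoeff p 0 = 1 := by
  simp [localCoeff]

theorem coeff_zero : F.coeff 0 = 0 := by simp [coeff]

theorem coeff_one : F.coeff 1 = 1 := by simp [coeff]

theorem coeff_prime_pow {p : ℕ} (hp : p.Prime) (k : ℕ) : F.coeff (p ^ k) = F.localCoeff p k := by
  have h0 : p ^ k ≠ 0 := pow_ne_zero _ hp.ne_zero
  rw [coeff, if_neg h0, hp.factorization_pow, Finsupp.prod_single_index (F.localCoeff_zero p)]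

theorem coeff_mul_of_coprime {m n : ℕ} (h : m.Coprime n) :
    F.coeff (m * n) = F.coeff m * F.coeff n := by
  rcases eq_or_ne m 0 with rfl | hm
  · simp [coeff_zero]
  rcases eq_or_ne n 0 with rfl | hn
  · simp [coeff_zero]
  rw [coeff, if_neg (mul_ne_zero hm hn), coeff, if_neg hm, coeff, if_neg hn,
    Nat.factorization_mul_of_coprime h, Finsupp.prod_add_index_of_disjoint]
  simpa using h.disjoint_primeFactors

theorem localCoeff_one (p : ℕ) : F.localCoeff p 1 = ∑ j, F.α p j := by
  classical
  unfold localCoeff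
  symm
  refine Finset.sum_bij (fun j _ => Pi.single j 1) ?_ ?_ ?_ ?_
  · intro j _
    simp
  · intro i _ j _ h
    by_contra hij
    have := congrFun h i
    simp [hij] at this
  · intro k hk
    simp only [Finset.mem_piAntidiag] at hk
    have h1 := hk.1
    obtain ⟨j, hj⟩ : ∃ j, k j ≠ 0 := by
      by_contra! h
      simp [h] at h1
    refine ⟨j, Finset.mem_univ _, ?_⟩
    rw [← Finset.add_sum_erase _ _ (Finset.mem_univ j)] at h1
    have h2 : k j = 1 := by omega
    have h3 : ∑ x ∈ Finset.univ.erase j, k x = 0 := by omega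
    rw [Finset.sum_eq_zero_iff] at h3
    ext i
    by_cases hi : i = j
    · subst hi; simp [h2]
    · simp [hi, h3 i (by simp [hi])]
  · intro j _
    rw [Finset.prod_eq_single j]
    · simp
    · intro i _ hi; simp [hi]
    · simp

theorem coeff_prime {p : ℕ} (hp : p.Prime) : F.coeff p = ∑ j, F.α p j := by
  have := F.coeff_prime_pow hp 1
  rwa [pow_one, localCoeff_one] at this

theorem card_finMulAntidiag_prime_pow_le {p : ℕ} (hp : p.Prime) (d k : ℕ) :
    (Nat.finMulAntidiag d (p ^ k)).card ≤ (k + 1) ^ d := by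
  have hsub : Nat.finMulAntidiag d (p ^ k) ⊆
      Fintype.piFinset fun _ : Fin d => (p ^ k).divisors := by
    intro f hf
    rw [Nat.mem_finMulAntidiag] at hf
    rw [Fintype.mem_piFinset]
    intro i
    rw [Nat.mem_divisors]
    exact ⟨hf.1 ▸ Finset.dvd_prod_of_mem f (Finset.mem_univ i), hf.2⟩
  refine (Finset.card_le_card hsub).trans ?_
  simp [Nat.divisors_prime_pow hp]

variable {F}

theorem RamanujanBound.norm_coeff_prime_pow_le (h : F.RamanujanBound) {p : ℕ} (hp : p.Prime)
    (k : ℕ) : ‖F.coeff (p ^ k)‖ ≤ ((k : ℝ) + 1) ^ d := by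
  refine (h _ (Nat.one_le_pow _ _ hp.pos)).trans ?_
  exact_mod_cast card_finMulAntidiag_prime_pow_le hp d k

theorem summable_succ_pow_mul_pow (k : ℕ) {r : ℝ} (h0 : 0 ≤ r) (h1 : r < 1) :
    Summable fun n : ℕ => ((n : ℝ) + 1) ^ k * r ^ n := by
  rcases h0.eq_or_lt with rfl | h0
  · refine summable_of_ne_finset_zero (s := {0}) ?_
    intro n hn
    simp at hn
    simp [hn]
  have h := (summable_nat_add_iff 1).2 (summable_pow_mul_geometric_of_norm_lt_one k (r := r)
    (by rwa [Real.norm_of_nonneg h0.le]))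
  refine (h.mul_left r⁻¹).congr fun n => ?_
  push_cast
  field_simp
  ring

theorem RamanujanBound.norm_coeff_prime_le (h : F.RamanujanBound) {p : ℕ} (hp : p.Prime) :
    ‖F.coeff p‖ ≤ d := by
  refine (h _ hp.one_lt.le).trans ?_
  rw [Nat.card_finMulAntidiag_of_squarefree hp.prime.squarefree]
  simp [ArithmeticFunction.cardDistinctFactors_apply_prime hp]

variable (F)

/-- The generating series of `localCoeff` is the inverse of `∏ j, (1 - α_j X)`. -/
theorem prod_one_sub_mul_mk_localCoeff (p : ℕ) :
    ((∏ j, (1 - Polynomial.C (F.α p j) * Polynomial.X) : Polynomial ℂ) : PowerSeries ℂ) *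
      PowerSeries.mk (F.localCoeff p) = 1 := by
  classical
  have h1 : PowerSeries.mk (F.localCoeff p) = ∏ j, PowerSeries.mk fun k => F.α p j ^ k := by
    ext n
    rw [PowerSeries.coeff_prod, PowerSeries.coeff_mk, localCoeff]
    refine Finset.sum_bij' (fun k _ => Finsupp.equivFunOnFinite.symm k) (fun k _ => ⇑k) ?_ ?_ ?_ ?_ ?_
    · intro k hk
      simpa [Finset.mem_finsuppAntidiag] using hk
    · intro k hk
      simpa [Finset.mem_finsuppAntidiag] using hk
    · intro k _; rfl
    · intro k _; ext; rfl
    · intro k _; simp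
  rw [h1]
  have h2 : ((∏ j, (1 - Polynomial.C (F.α p j) * Polynomial.X) : Polynomial ℂ) : PowerSeries ℂ) =
      ∏ j, (1 - PowerSeries.C (F.α p j) * PowerSeries.X) := by
    rw [← Polynomial.coeToPowerSeries.ringHom_apply, map_prod]
    simp
  rw [h2, ← Finset.prod_mul_distrib]
  refine Finset.prod_eq_one fun j _ => ?_
  ext n
  rw [sub_mul, one_mul, mul_assoc, map_sub, PowerSeries.coeff_C_mul, PowerSeries.coeff_mk]
  cases n with
  | zero => simp
  | succ n => simp [PowerSeries.coeff_succ_X_mul, pow_succ, mul_comm]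

variable {F}

theorem RamanujanBound.summable_localCoeff (h : F.RamanujanBound) {p : ℕ} (hp : p.Prime) {y : ℂ}
    (hy : ‖y‖ < 1) : Summable fun k => ‖F.localCoeff p k * y ^ k‖ := by
  refine Summable.of_nonneg_of_le (fun _ => norm_nonneg _) (fun k => ?_)
    (summable_succ_pow_mul_pow d (norm_nonneg y) hy)
  rw [norm_mul, norm_pow, ← F.coeff_prime_pow hp]
  gcongr
  exact h.norm_coeff_prime_pow_le hp k

theorem RamanujanBound.prod_mul_tsum_localCoeff (h : F.RamanujanBound) {p : ℕ} (hp : p.Prime)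
    {y : ℂ} (hy : ‖y‖ < 1) :
    (∏ j, (1 - F.α p j * y)) * ∑' k, F.localCoeff p k * y ^ k = 1 := by
  set A : Polynomial ℂ := ∏ j, (1 - Polynomial.C (F.α p j) * Polynomial.X) with hA
  have hAe : A.eval y = ∏ j, (1 - F.α p j * y) := by simp [hA, Polynomial.eval_prod]
  have hA0 : ∀ k ∉ Finset.range (A.natDegree + 1), A.coeff k * y ^ k = 0 := by
    intro k hk
    rw [Polynomial.coeff_eq_zero_of_natDegree_lt (by simpa using hk), zero_mul]
  have hAs : Summable fun k => ‖A.coeff k * y ^ k‖ :=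
    summable_of_ne_finset_zero (s := Finset.range (A.natDegree + 1))
      fun k hk => by rw [hA0 k hk, norm_zero]
  have hAt : ∑' k, A.coeff k * y ^ k = A.eval y := by
    rw [tsum_eq_sum hA0, Polynomial.eval_eq_sum_range]
  rw [← hAe, ← hAt, tsum_mul_tsum_eq_tsum_sum_antidiagonal_of_summable_norm hAs
    (h.summable_localCoeff hp hy), tsum_eq_single 0]
  · have := congrArg (PowerSeries.coeff 0) (F.prod_one_sub_mul_mk_localCoeff p)
    simp [PowerSeries.coeff_mul, ← hA] at this
    simpa using this
  · intro n hn
    have := congrArg (PowerSeries.coeff n) (F.prod_one_sub_mul_mk_localCoeff p)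
    rw [PowerSeries.coeff_mul, ← hA, PowerSeries.coeff_one, if_neg hn] at this
    calc _ = ∑ kl ∈ Finset.HasAntidiagonal.antidiagonal n, (A.coeff kl.1 * F.localCoeff p kl.2) * y ^ n := by
          refine Finset.sum_congr rfl fun kl hkl => ?_
          rw [← Finset.HasAntidiagonal.mem_antidiagonal.1 hkl, pow_add]; ring
      _ = 0 := by
          rw [← Finset.sum_mul]
          simp at this
          rw [this, zero_mul]

/-- The Ramanujan bound for the coefficients forces the Satake parameters into the closed unit
disc, since the generating series of `localCoeff` has no pole in the open unit disc. -/
theorem RamanujanBound.norm_α_le_one (h : F.RamanujanBound) {p : ℕ} (hp : p.Prime) (j : Fin d) :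
    ‖F.α p j‖ ≤ 1 := by
  by_contra! hj
  have h0 : F.α p j ≠ 0 := by
    intro h0; rw [h0] at hj; simp at hj; linarith
  have hy : ‖(F.α p j)⁻¹‖ < 1 := by rw [norm_inv]; exact inv_lt_one_of_one_lt₀ hj
  have := h.prod_mul_tsum_localCoeff hp hy
  rw [Finset.prod_eq_zero (Finset.mem_univ j) (by simp [h0]), zero_mul] at this
  exact zero_ne_one this

theorem RamanujanBound.tsum_localCoeff (h : F.RamanujanBound) {p : ℕ} (hp : p.Prime)
    {y : ℂ} (hy : ‖y‖ < 1) :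
    ∑' k, F.localCoeff p k * y ^ k = ∏ j, (1 - F.α p j * y)⁻¹ := by
  rw [Finset.prod_inv_distrib]
  exact eq_inv_of_mul_eq_one_right (h.prod_mul_tsum_localCoeff hp hy)

/-! ### Mean squares of the coefficients -/

/-- The sieve bound contains the mean square bound, as the case of an empty set of sifting primes. -/
theorem SieveBound.exists_sum_sq_le (h : F.SieveBound) :
    ∃ K : ℝ, 0 ≤ K ∧ ∀ N : ℕ, ∑ n ∈ Finset.Icc 1 N, ‖F.coeff n‖ ^ 2 ≤ K * N := by
  obtain ⟨K, hK⟩ := h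
  refine ⟨|K| + (‖F.coeff 1‖ ^ 2 + ‖F.coeff 2‖ ^ 2), by positivity, fun N => ?_⟩
  rcases lt_or_ge N 3 with hN | hN
  · interval_cases N
    · simp
    · simp only [Finset.Icc_self, Finset.sum_singleton, Nat.cast_one, mul_one]
      linarith [abs_nonneg K, sq_nonneg ‖F.coeff 2‖]
    · have : Finset.Icc 1 2 = {1, 2} := rfl
      rw [this, Finset.sum_pair (by norm_num)]
      push_cast
      nlinarith [abs_nonneg K, sq_nonneg ‖F.coeff 1‖, sq_nonneg ‖F.coeff 2‖]
  · classical
    -- there is no prime in `[5/2, 5/2]`, so that nothing is sifted out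
    have := hK N (5 / 2) (5 / 2) (by norm_num) le_rfl
      (by have : (3 : ℝ) ≤ N := by exact_mod_cast hN
          linarith)
    rw [Finset.filter_true_of_mem, div_self (Real.log_pos (by norm_num)).ne', Nat.floor_natCast,
      mul_one] at this
    · refine this.trans ?_
      gcongr
      nlinarith [le_abs_self K, sq_nonneg ‖F.coeff 1‖, sq_nonneg ‖F.coeff 2‖]
    · intro n _ p _ h1 h2
      exfalso
      have h3 : (p : ℝ) = 5 / 2 := le_antisymm h2 h1
      have h4 : (2 * p : ℝ) = 5 := by rw [h3]; norm_num
      have h5 : 2 * p = 5 := by exact_mod_cast h4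
      omega

/-- The multiples of `p ^ a` are sorted by the exact power of `p` that divides them; the
polynomially growing factors `λ_F(p ^ k)` are absorbed by the convergence of
`∑ (k + 1) ^ (2d) 2 ^ (-k)`. -/
theorem exists_sum_sq_dvd_le (hA1 : F.RamanujanBound) (h : F.SieveBound) :
    ∃ K : ℝ, 0 ≤ K ∧ ∀ p : ℕ, p.Prime → ∀ a : ℕ, a ≤ 2 → ∀ N : ℕ,
      ∑ n ∈ Finset.Icc 1 N with p ^ a ∣ n, ‖F.coeff n‖ ^ 2 ≤ K * (N / (p : ℝ) ^ a) := by
  obtain ⟨K, hK0, hK⟩ := h.exists_sum_sq_le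
  have hs : Summable fun n : ℕ => ((n : ℝ) + 1) ^ (2 * d) * (1 / 2 : ℝ) ^ n :=
    summable_succ_pow_mul_pow (2 * d) (by norm_num) (by norm_num)
  set S := ∑' n : ℕ, ((n : ℝ) + 1) ^ (2 * d) * (1 / 2 : ℝ) ^ n with hS
  have hS0 : 0 ≤ S := tsum_nonneg fun _ => by positivity
  refine ⟨K * (4 * S), by positivity, fun p hp a ha N => ?_⟩
  have hp2 : (2 : ℝ) ≤ p := by exact_mod_cast hp.two_le
  have hmaps : ∀ n ∈ (Finset.Icc 1 N).filter (p ^ a ∣ ·), n.factorization p ∈ Finset.Icc a N := by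
    intro n hn
    simp only [Finset.mem_filter, Finset.mem_Icc] at hn ⊢
    have hn0 : n ≠ 0 := by omega
    refine ⟨(hp.pow_dvd_iff_le_factorization hn0).1 hn.2, ?_⟩
    exact ((Nat.factorization_lt p hn0).le).trans hn.1.2
  rw [← Finset.sum_fiberwise_of_maps_to hmaps]
  have hfib : ∀ k ∈ Finset.Icc a N,
      ∑ n ∈ ((Finset.Icc 1 N).filter (p ^ a ∣ ·)).filter (fun n => n.factorization p = k),
        ‖F.coeff n‖ ^ 2 ≤ ((k : ℝ) + 1) ^ (2 * d) * (K * (N / (p : ℝ) ^ k)) := by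
    intro k hk
    have hpk : 0 < p ^ k := pow_pos hp.pos k
    set T := ((Finset.Icc 1 N).filter (p ^ a ∣ ·)).filter (fun n => n.factorization p = k) with hT
    have key : ∀ n ∈ T, p ^ k * (n / p ^ k) = n ∧
        n / p ^ k ∈ Finset.Icc 1 (N / p ^ k) ∧ (p ^ k).Coprime (n / p ^ k) := by
      intro n hn
      simp only [hT, Finset.mem_filter, Finset.mem_Icc] at hn
      have hn0 : n ≠ 0 := by omega
      have hd : p ^ k * (n / p ^ k) = n := by
        rw [← hn.2]; exact Nat.mul_div_cancel' (Nat.ordProj_dvd n p)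
      refine ⟨hd, ?_, ?_⟩
      · rw [Finset.mem_Icc]
        refine ⟨?_, Nat.div_le_div_right hn.1.1.2⟩
        rcases Nat.eq_zero_or_pos (n / p ^ k) with h0 | h0
        · rw [h0] at hd; omega
        · exact h0
      · rw [← hn.2]
        exact (Nat.coprime_ordCompl hp hn0).pow_left _
    calc _ ≤ ∑ n ∈ T, ((k : ℝ) + 1) ^ (2 * d) * ‖F.coeff (n / p ^ k)‖ ^ 2 := by
          refine Finset.sum_le_sum fun n hn => ?_
          obtain ⟨h1, h3, h4⟩ := key n hn
          conv_lhs => rw [← h1, F.coeff_mul_of_coprime h4, norm_mul, mul_pow]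
          gcongr
          rw [mul_comm 2 d, pow_mul]
          gcongr
          exact hA1.norm_coeff_prime_pow_le hp k
      _ = ∑ m ∈ T.image (· / p ^ k), ((k : ℝ) + 1) ^ (2 * d) * ‖F.coeff m‖ ^ 2 := by
          rw [Finset.sum_image]
          intro x hx y hy hxy
          rw [← (key x hx).1, ← (key y hy).1]
          exact congrArg (p ^ k * ·) hxy
      _ ≤ ∑ m ∈ Finset.Icc 1 (N / p ^ k), ((k : ℝ) + 1) ^ (2 * d) * ‖F.coeff m‖ ^ 2 := by
          refine Finset.sum_le_sum_of_subset_of_nonneg ?_ fun _ _ _ => by positivity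
          intro m hm
          obtain ⟨n, hn, rfl⟩ := Finset.mem_image.1 hm
          exact (key n hn).2.1
      _ ≤ _ := by
          rw [← Finset.mul_sum]
          gcongr
          refine (hK _).trans ?_
          gcongr
          refine Nat.cast_div_le.trans ?_
          push_cast
          exact le_rfl
  refine (Finset.sum_le_sum hfib).trans ?_
  have hterm : ∀ k ∈ Finset.Icc a N, ((k : ℝ) + 1) ^ (2 * d) * (K * (N / (p : ℝ) ^ k)) ≤
      K * (4 * (N / (p : ℝ) ^ a)) * (((k : ℝ) + 1) ^ (2 * d) * (1 / 2 : ℝ) ^ k) := by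
    intro k hk
    have hak := (Finset.mem_Icc.1 hk).1
    obtain ⟨l, rfl⟩ := Nat.exists_eq_add_of_le hak
    have h4 : (1 : ℝ) / p ^ l ≤ 4 * (1 / 2 : ℝ) ^ (a + l) := by
      have e1 : (1 : ℝ) / p ^ l ≤ (1 / 2 : ℝ) ^ l := by
        rw [one_div_pow]
        gcongr
      have e2 : (1 / 4 : ℝ) ≤ (1 / 2 : ℝ) ^ a := by
        interval_cases a <;> norm_num
      rw [pow_add]
      nlinarith [pow_pos (show (0 : ℝ) < 1 / 2 by norm_num) l]
    calc (((a + l : ℕ) : ℝ) + 1) ^ (2 * d) * (K * (N / (p : ℝ) ^ (a + l)))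
        = K * (N / (p : ℝ) ^ a) * (((a + l : ℕ) : ℝ) + 1) ^ (2 * d) * (1 / p ^ l) := by
          rw [pow_add]; field_simp
      _ ≤ K * (N / (p : ℝ) ^ a) * (((a + l : ℕ) : ℝ) + 1) ^ (2 * d) *
          (4 * (1 / 2 : ℝ) ^ (a + l)) := by gcongr
      _ = _ := by ring
  refine (Finset.sum_le_sum hterm).trans ?_
  rw [← Finset.mul_sum]
  calc _ ≤ K * (4 * (N / (p : ℝ) ^ a)) * S := by
        gcongr
        exact hs.sum_le_tsum _ fun _ _ => by positivity
    _ = _ := by ring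

end LDatum

namespace LDatum

variable {d : ℕ} (F : LDatum d)

/-! ### Ramaré's identity -/

/-- The number of `p ∈ I` that divide `n` exactly once. -/
def exactCount (I : Finset ℕ) (n : ℕ) : ℕ := (I.filter fun p => p ∣ n ∧ ¬ p ^ 2 ∣ n).card

/-- The weight `λ_F(m) / (ω(m) + 1)` of Ramaré's identity, where `ω(m)` counts the `p ∈ I`
with `p ∥ m`. -/
def ramareCoeff (I : Finset ℕ) (m : ℕ) : ℂ := F.coeff m / ((exactCount I m : ℂ) + 1)

/-- The coefficients of the bilinear sum over `n = p m` with `p ∈ I` and `a ≤ m ≤ b`. -/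
def bilinearCoeff (I : Finset ℕ) (a b n : ℕ) : ℂ :=
  ∑ p ∈ I with p ∣ n ∧ n / p ∈ Finset.Icc a b, F.coeff p * F.ramareCoeff I (n / p)

/-- A majorant for the contribution to `bilinearCoeff` of the `p` with `p ^ 2 ∣ n`. -/
def squareError (I : Finset ℕ) (n : ℕ) : ℝ := ∑ p ∈ I with p ^ 2 ∣ n, d * ‖F.coeff (n / p)‖

variable {F} {I : Finset ℕ}

theorem norm_ramareCoeff_le (m : ℕ) : ‖F.ramareCoeff I m‖ ≤ ‖F.coeff m‖ := by
  rw [ramareCoeff, norm_div]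
  refine div_le_self (norm_nonneg _) ?_
  have : ((exactCount I m : ℂ) + 1) = ((exactCount I m + 1 : ℕ) : ℂ) := by push_cast; ring
  rw [this, Complex.norm_natCast]
  exact_mod_cast Nat.le_add_left 1 _

theorem coprime_div_of_exact {p n : ℕ} (hp : p.Prime) (h1 : p ∣ n) (h2 : ¬ p ^ 2 ∣ n) :
    p.Coprime (n / p) := by
  rw [hp.coprime_iff_not_dvd]
  rintro ⟨k, hk⟩
  apply h2
  refine ⟨k, ?_⟩
  rw [sq, mul_assoc, ← hk, Nat.mul_div_cancel' h1]

/-- Every `p ∥ n` in `I` contributes the same amount to `bilinearCoeff`, and there are `exactCount I n`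
such `p`. -/
theorem coeff_mul_ramareCoeff (hI : ∀ p ∈ I, p.Prime) {p n : ℕ} (hp : p ∈ I) (h1 : p ∣ n)
    (h2 : ¬ p ^ 2 ∣ n) :
    F.coeff p * F.ramareCoeff I (n / p) = F.coeff n / (exactCount I n : ℂ) := by
  have hpp := hI p hp
  have hco := coprime_div_of_exact hpp h1 h2
  have hn : p * (n / p) = n := Nat.mul_div_cancel' h1
  have hcount : exactCount I n = exactCount I (n / p) + 1 := by
    unfold exactCount
    have hnot : p ∉ I.filter fun r => r ∣ n / p ∧ ¬ r ^ 2 ∣ n / p := by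
      rw [Finset.mem_filter]
      rintro ⟨_, h, _⟩
      exact (hpp.coprime_iff_not_dvd.1 hco) h
    rw [← Finset.card_insert_of_notMem hnot]
    congr 1
    ext r
    simp only [Finset.mem_filter, Finset.mem_insert]
    by_cases hr : r = p
    · subst hr; simp [hp, h1, h2]
    · simp only [hr, false_or]
      refine and_congr_right fun hrI => ?_
      have hrp : r.Coprime p := (Nat.coprime_primes (hI r hrI) hpp).2 hr
      rw [← hn, hrp.dvd_mul_left, (hrp.pow_left 2).dvd_mul_left, hn]
  rw [ramareCoeff, ← mul_div_assoc, ← F.coeff_mul_of_coprime hco, hn, hcount]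
  push_cast
  rfl

theorem norm_sum_exact_le (hI : ∀ p ∈ I, p.Prime) (n : ℕ) (S : Finset ℕ)
    (hS : S ⊆ I.filter fun p => p ∣ n ∧ ¬ p ^ 2 ∣ n) :
    ‖∑ p ∈ S, F.coeff p * F.ramareCoeff I (n / p)‖ ≤ ‖F.coeff n‖ := by
  have h1 : ∀ p ∈ S, F.coeff p * F.ramareCoeff I (n / p) =
      F.coeff n / (exactCount I n : ℂ) := by
    intro p hp
    have := Finset.mem_filter.1 (hS hp)
    exact coeff_mul_ramareCoeff hI this.1 this.2.1 this.2.2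
  rw [Finset.sum_congr rfl h1, Finset.sum_const, nsmul_eq_mul, norm_mul, norm_div,
    Complex.norm_natCast, Complex.norm_natCast]
  have hc : S.card ≤ exactCount I n := Finset.card_le_card hS
  -- if no `p ∈ I` divides `n` exactly once, the division by zero is harmless, as `S` is empty
  rcases Nat.eq_zero_or_pos (exactCount I n) with h0 | h0
  · rw [h0]; simp
  · have : (0 : ℝ) < exactCount I n := by exact_mod_cast h0
    rw [mul_div_assoc', div_le_iff₀ this, mul_comm]
    gcongr

theorem norm_sum_square_le (hA1 : F.RamanujanBound) (hI : ∀ p ∈ I, p.Prime) (n : ℕ)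
    (S : Finset ℕ) (hS : S ⊆ I.filter fun p => p ^ 2 ∣ n) :
    ‖∑ p ∈ S, F.coeff p * F.ramareCoeff I (n / p)‖ ≤ F.squareError I n := by
  refine (norm_sum_le _ _).trans ?_
  calc _ ≤ ∑ p ∈ S, d * ‖F.coeff (n / p)‖ := by
        refine Finset.sum_le_sum fun p hp => ?_
        rw [norm_mul]
        gcongr
        · exact hA1.norm_coeff_prime_le (hI p (Finset.mem_filter.1 (hS hp)).1)
        · exact norm_ramareCoeff_le _
    _ ≤ _ := Finset.sum_le_sum_of_subset_of_nonneg hS fun _ _ _ => by positivity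

theorem norm_bilinearCoeff_le (hA1 : F.RamanujanBound) (hI : ∀ p ∈ I, p.Prime) (a b n : ℕ) :
    ‖F.bilinearCoeff I a b n‖ ≤ ‖F.coeff n‖ + F.squareError I n := by
  unfold bilinearCoeff
  rw [← Finset.sum_filter_add_sum_filter_not _ (fun p => ¬ p ^ 2 ∣ n)]
  refine (norm_add_le _ _).trans (add_le_add ?_ ?_)
  · refine norm_sum_exact_le hI n _ fun p hp => ?_
    simp only [Finset.mem_filter] at hp ⊢
    tauto
  · refine norm_sum_square_le hA1 hI n _ fun p hp => ?_
    simp only [Finset.mem_filter] at hp ⊢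
    tauto

open Classical in
/-- Ramaré's identity, up to the `n` that have no prime factor in `I` or one that divides them
more than once. -/
theorem norm_coeff_sub_bilinearCoeff_le (hA1 : F.RamanujanBound) (hI : ∀ p ∈ I, p.Prime)
    {a b n : ℕ} (hn : ∀ p ∈ I, p ∣ n → n / p ∈ Finset.Icc a b) :
    ‖F.coeff n - F.bilinearCoeff I a b n‖ ≤
      (if ∀ p ∈ I, ¬ p ∣ n then ‖F.coeff n‖ else 0) +
      (if ∃ p ∈ I, p ^ 2 ∣ n then ‖F.coeff n‖ else 0) + F.squareError I n := by
  unfold bilinearCoeff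
  have hfil : (I.filter fun p => p ∣ n ∧ n / p ∈ Finset.Icc a b) = I.filter fun p => p ∣ n := by
    refine Finset.filter_congr fun p hp => ?_
    exact ⟨fun h => h.1, fun h => ⟨h, hn p hp h⟩⟩
  rw [hfil, ← Finset.sum_filter_add_sum_filter_not _ (fun p => ¬ p ^ 2 ∣ n), Finset.filter_filter,
    Finset.filter_filter]
  rw [← sub_sub]
  refine (norm_sub_le _ _).trans (add_le_add ?_ ?_)
  · have h1 : ∑ p ∈ I with p ∣ n ∧ ¬ p ^ 2 ∣ n, F.coeff p * F.ramareCoeff I (n / p) =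
        (exactCount I n : ℂ) * (F.coeff n / (exactCount I n : ℂ)) := by
      rw [Finset.sum_congr rfl (g := fun _ => F.coeff n / (exactCount I n : ℂ)),
        Finset.sum_const, nsmul_eq_mul, exactCount]
      intro p hp
      have := Finset.mem_filter.1 hp
      exact coeff_mul_ramareCoeff hI this.1 this.2.1 this.2.2
    rw [h1]
    by_cases h0 : exactCount I n = 0
    · rw [h0]
      simp only [Nat.cast_zero, zero_mul, sub_zero]
      by_cases h2 : ∀ p ∈ I, ¬ p ∣ n
      · rw [if_pos h2]
        have : (0 : ℝ) ≤ if ∃ p ∈ I, p ^ 2 ∣ n then ‖F.coeff n‖ else 0 := by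
          split_ifs <;> positivity
        linarith
      · rw [if_neg h2, zero_add, if_pos]
        push Not at h2
        obtain ⟨p, hp, hpn⟩ := h2
        refine ⟨p, hp, ?_⟩
        by_contra h3
        rw [exactCount, Finset.card_eq_zero] at h0
        have : p ∈ I.filter fun p => p ∣ n ∧ ¬ p ^ 2 ∣ n := Finset.mem_filter.2 ⟨hp, hpn, h3⟩
        rw [h0] at this
        simp at this
    · rw [mul_div_cancel₀ _ (by exact_mod_cast h0), sub_self, norm_zero]
      split_ifs <;> positivity
  · refine norm_sum_square_le hA1 hI n _ fun p hp => ?_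
    simp only [Finset.mem_filter] at hp ⊢
    tauto

/-- The bilinear sum, ordered by the product of its variables. -/
theorem sum_bilinear_eq (hI : ∀ p ∈ I, p.Prime) {a b R : ℕ} (ha : 1 ≤ a)
    (hR : ∀ p ∈ I, p * b ≤ R) (g : ℕ → ℂ) :
    ∑ p ∈ I, ∑ m ∈ Finset.Icc a b, F.coeff p * F.ramareCoeff I m * g (p * m) =
      ∑ n ∈ Finset.Icc 1 R, F.bilinearCoeff I a b n * g n := by
  unfold bilinearCoeff
  simp_rw [Finset.sum_mul, Finset.sum_filter]
  rw [Finset.sum_comm (s := Finset.Icc 1 R)]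
  refine Finset.sum_congr rfl fun p hp => ?_
  have hp0 := (hI p hp).pos
  rw [← Finset.sum_filter]
  symm
  refine Finset.sum_bij' (fun n _ => n / p) (fun m _ => p * m) ?_ ?_ ?_ ?_ ?_
  · intro n hn
    exact (Finset.mem_filter.1 hn).2.2
  · intro m hm
    rw [Finset.mem_filter, Nat.mul_div_cancel_left _ hp0]
    refine ⟨?_, dvd_mul_right _ _, hm⟩
    rw [Finset.mem_Icc] at hm ⊢
    exact ⟨Nat.mul_pos hp0 (by omega), (Nat.mul_le_mul_left p hm.2).trans (hR p hp)⟩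
  · intro n hn
    exact Nat.mul_div_cancel' (Finset.mem_filter.1 hn).2.1
  · intro m _
    exact Nat.mul_div_cancel_left _ hp0
  · intro n hn
    rw [Nat.mul_div_cancel' (Finset.mem_filter.1 hn).2.1]

theorem sum_inv_sq_le {P : ℝ} (hP : 1 ≤ P) (hI : ∀ p ∈ I, P ≤ p) :
    ∑ p ∈ I, ((p : ℝ) ^ 2)⁻¹ ≤ 2 / P := by
  obtain ⟨k, hk⟩ : ∃ k, ⌈P⌉₊ = k + 1 :=
    Nat.exists_eq_succ_of_ne_zero (Nat.ceil_pos.2 (by linarith)).ne'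
  have hsub : I ⊆ Finset.Ioo k (I.sup id + 1) := by
    intro p hp
    rw [Finset.mem_Ioo]
    have h1 : ⌈P⌉₊ ≤ p := Nat.ceil_le.2 (hI p hp)
    have h2 : id p ≤ I.sup id := Finset.le_sup (f := id) hp
    simp only [id] at h2
    omega
  calc _ ≤ ∑ p ∈ Finset.Ioo k (I.sup id + 1), ((p : ℝ) ^ 2)⁻¹ :=
        Finset.sum_le_sum_of_subset_of_nonneg hsub fun _ _ _ => by positivity
    _ ≤ 2 / (k + 1) := sum_Ioo_inv_sq_le k _
    _ ≤ _ := by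
        have : P ≤ (k : ℝ) + 1 := by
          have := Nat.le_ceil P
          rw [hk] at this
          exact_mod_cast this
        gcongr

variable (F) in
/-- The `n` with a square factor `p ^ 2`, `p ≥ P`, contribute little. -/
theorem exists_sum_square_bounds (hA1 : F.RamanujanBound) (hA3 : F.SieveBound) :
    ∃ K : ℝ, 0 ≤ K ∧ ∀ (I : Finset ℕ) (P : ℝ), (∀ p ∈ I, p.Prime) → 1 ≤ P →
      (∀ p ∈ I, P ≤ (p : ℝ)) → ∀ N : ℕ,
        (∑ n ∈ Finset.Icc 1 N with ∃ p ∈ I, p ^ 2 ∣ n, ‖F.coeff n‖ ^ 2 ≤ K * (N / P)) ∧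
        ∀ N' : ℕ, N ≤ N' → ∑ n ∈ Finset.Icc 1 N, F.squareError I n ^ 2 ≤
          K * (Nat.log 2 N') * (N / P) := by
  obtain ⟨K, hK0, hK⟩ := exists_sum_sq_dvd_le hA1 hA3
  refine ⟨2 * K + 2 * d ^ 2 * K, by positivity, fun I P hI hP hIP N => ⟨?_, fun N' hN' => ?_⟩⟩
  · calc _ ≤ ∑ p ∈ I, ∑ n ∈ Finset.Icc 1 N with p ^ 2 ∣ n, ‖F.coeff n‖ ^ 2 := by
          simp_rw [Finset.sum_filter]
          rw [Finset.sum_comm]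
          refine Finset.sum_le_sum fun n _ => ?_
          split_ifs with h
          · obtain ⟨p, hp, hpn⟩ := h
            refine le_trans ?_ (Finset.single_le_sum (f := fun p => if p ^ 2 ∣ n then
              ‖F.coeff n‖ ^ 2 else 0) (fun _ _ => by positivity) hp)
            rw [if_pos hpn]
          · exact Finset.sum_nonneg fun _ _ => by positivity
      _ ≤ ∑ p ∈ I, K * (N / (p : ℝ) ^ 2) :=
          Finset.sum_le_sum fun p hp => hK p (hI p hp) 2 le_rfl N
      _ = K * N * ∑ p ∈ I, ((p : ℝ) ^ 2)⁻¹ := by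
          rw [Finset.mul_sum]
          exact Finset.sum_congr rfl fun p _ => by ring
      _ ≤ K * N * (2 / P) := by gcongr; exact sum_inv_sq_le hP hIP
      _ = 2 * K * (N / P) := by ring
      _ ≤ _ := by
          gcongr
          have : 0 ≤ 2 * d ^ 2 * K := by positivity
          linarith
  · have hpt : ∀ n ∈ Finset.Icc 1 N, F.squareError I n ^ 2 ≤
        (Nat.log 2 N' : ℝ) * ∑ p ∈ I with p ^ 2 ∣ n, (d * ‖F.coeff (n / p)‖) ^ 2 := by
      intro n hn
      rw [Finset.mem_Icc] at hn
      refine sq_sum_le_card_mul_sum_sq.trans ?_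
      gcongr
      -- a number `n` has at most `log₂ n` prime factors
      have h1 : ∏ p ∈ I with p ^ 2 ∣ n, p ∣ n := by
        refine Finset.prod_primes_dvd n ?_ ?_
        · intro p hp
          exact (hI p (Finset.mem_filter.1 hp).1).prime
        · intro p hp
          exact (dvd_pow_self p two_ne_zero).trans (Finset.mem_filter.1 hp).2
      have h2 : 2 ^ (I.filter fun p => p ^ 2 ∣ n).card ≤ ∏ p ∈ I with p ^ 2 ∣ n, p := by
        refine Finset.pow_card_le_prod _ _ _ ?_
        intro p hp
        exact (hI p (Finset.mem_filter.1 hp).1).two_le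
      exact Nat.le_log_of_pow_le (by norm_num) ((h2.trans (Nat.le_of_dvd (by omega) h1)).trans
        (hn.2.trans hN'))
    refine (Finset.sum_le_sum hpt).trans ?_
    rw [← Finset.mul_sum]
    have hsw : ∑ n ∈ Finset.Icc 1 N, ∑ p ∈ I with p ^ 2 ∣ n, (d * ‖F.coeff (n / p)‖) ^ 2 ≤
        ∑ p ∈ I, d ^ 2 * (K * (N / (p : ℝ) ^ 2)) := by
      simp_rw [Finset.sum_filter]
      rw [Finset.sum_comm]
      refine Finset.sum_le_sum fun p hp => ?_
      have hp0 := (hI p hp).pos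
      rw [← Finset.sum_filter]
      calc _ = ∑ n ∈ Finset.Icc 1 N with p ^ 2 ∣ n, (d : ℝ) ^ 2 * ‖F.coeff (n / p)‖ ^ 2 :=
            Finset.sum_congr rfl fun n _ => by ring
        _ = ∑ m ∈ ((Finset.Icc 1 N).filter fun n => p ^ 2 ∣ n).image (· / p),
              (d : ℝ) ^ 2 * ‖F.coeff m‖ ^ 2 := by
            rw [Finset.sum_image]
            intro x hx y hy hxy
            have hx' := (dvd_pow_self p two_ne_zero).trans (Finset.mem_filter.1 hx).2
            have hy' := (dvd_pow_self p two_ne_zero).trans (Finset.mem_filter.1 hy).2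
            rw [← Nat.mul_div_cancel' hx', ← Nat.mul_div_cancel' hy']
            exact congrArg (p * ·) hxy
        _ ≤ ∑ m ∈ Finset.Icc 1 (N / p) with p ^ 1 ∣ m, (d : ℝ) ^ 2 * ‖F.coeff m‖ ^ 2 := by
            refine Finset.sum_le_sum_of_subset_of_nonneg ?_ fun _ _ _ => by positivity
            intro m hm
            obtain ⟨n, hn, rfl⟩ := Finset.mem_image.1 hm
            simp only [Finset.mem_filter, Finset.mem_Icc] at hn ⊢
            obtain ⟨⟨h1, h2⟩, k, rfl⟩ := hn
            have hd : p ^ 2 * k / p = p * k := by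
              rw [sq, mul_assoc, Nat.mul_div_cancel_left _ hp0]
            rw [hd]
            have hk : 0 < k := Nat.pos_of_ne_zero fun h => by subst h; omega
            refine ⟨⟨Nat.mul_pos hp0 hk, ?_⟩, ?_⟩
            · rw [← hd]; exact Nat.div_le_div_right h2
            · rw [pow_one]; exact dvd_mul_right _ _
        _ ≤ (d : ℝ) ^ 2 * (K * ((N / p : ℕ) / (p : ℝ) ^ 1)) := by
            rw [← Finset.mul_sum]
            gcongr
            exact hK p (hI p hp) 1 (by norm_num) _
        _ ≤ _ := by
            refine mul_le_mul_of_nonneg_left (mul_le_mul_of_nonneg_left ?_ hK0) (by positivity)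
            rw [pow_one, sq, ← div_div]
            exact div_le_div_of_nonneg_right Nat.cast_div_le (Nat.cast_nonneg p)
    calc _ ≤ (Nat.log 2 N' : ℝ) * ∑ p ∈ I, d ^ 2 * (K * (N / (p : ℝ) ^ 2)) := by gcongr
      _ = (Nat.log 2 N' : ℝ) * (d ^ 2 * K * N * ∑ p ∈ I, ((p : ℝ) ^ 2)⁻¹) := by
          rw [Finset.mul_sum (a := (d : ℝ) ^ 2 * K * N)]
          congr 1
          exact Finset.sum_congr rfl fun p _ => by ring
      _ ≤ (Nat.log 2 N' : ℝ) * (d ^ 2 * K * N * (2 / P)) := by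
          gcongr; exact sum_inv_sq_le hP hIP
      _ = (2 * d ^ 2 * K) * (Nat.log 2 N') * (N / P) := by ring
      _ ≤ _ := by
          gcongr
          linarith

end LDatum

/-! ### The large sieve for Dirichlet characters to one modulus -/

/-- Orthogonality of characters and the Cauchy–Schwarz inequality with weights `w`, where `W` bounds
the total weight of each residue class. -/
theorem sum_norm_sq_sum_mul_char_le {q : ℕ} [NeZero q] (S : Finset (DirichletCharacter ℂ q))
    (A : Finset ℕ) (x : ℕ → ℂ) (w : ℕ → ℝ) (hw : ∀ n ∈ A, 0 < w n) {W : ℝ}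
    (hW : ∀ r : ZMod q, ∑ n ∈ A with ((n : ℕ) : ZMod q) = r, w n ≤ W) :
    ∑ χ ∈ S, ‖∑ n ∈ A, x n * χ n‖ ^ 2 ≤ q * W * ∑ n ∈ A, ‖x n‖ ^ 2 / w n := by
  classical
  set B : ZMod q → ℂ := fun r => ∑ n ∈ A with ((n : ℕ) : ZMod q) = r, x n with hB
  have h1 : ∀ χ : DirichletCharacter ℂ q, ∑ n ∈ A, x n * χ n = ∑ r, B r * χ r := by
    intro χ
    rw [← Finset.sum_fiberwise A (fun n : ℕ => (n : ZMod q))]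
    refine Finset.sum_congr rfl fun r _ => ?_
    rw [hB, Finset.sum_mul]
    refine Finset.sum_congr rfl fun n hn => ?_
    rw [(Finset.mem_filter.1 hn).2]
  have horth : ∀ r s : ZMod q, ∑ χ : DirichletCharacter ℂ q, χ r * starRingEnd ℂ (χ s) =
      if r = s ∧ IsUnit s then (q.totient : ℂ) else 0 := by
    intro r s
    by_cases hs : IsUnit s
    · have := DirichletCharacter.sum_char_inv_mul_char_eq ℂ hs r
      simp only [hs, and_true]
      rw [if_congr (eq_comm (a := r) (b := s)) rfl rfl, ← this]
      refine Finset.sum_congr rfl fun χ _ => ?_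
      have hinv : χ s⁻¹ = starRingEnd ℂ (χ s) := by
        have h3 : χ s⁻¹ * χ s = 1 := by rw [← map_mul, ZMod.inv_mul_of_unit s hs, map_one]
        rw [starRingEnd_apply, MulChar.star_apply', MulChar.inv_apply_eq_inv']
        exact eq_inv_of_mul_eq_one_left h3
      rw [hinv, mul_comm]
    · simp only [hs, and_false, if_false]
      refine Finset.sum_eq_zero fun χ _ => ?_
      rw [χ.map_nonunit hs, map_zero, mul_zero]
  have h2 : ∑ χ : DirichletCharacter ℂ q, ‖∑ r, B r * χ r‖ ^ 2 ≤ q * ∑ r, ‖B r‖ ^ 2 := by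
    have hc : ((∑ χ : DirichletCharacter ℂ q, ‖∑ r, B r * χ r‖ ^ 2 : ℝ) : ℂ) =
        ((∑ r, if IsUnit r then (q.totient : ℝ) * ‖B r‖ ^ 2 else 0 : ℝ) : ℂ) := by
      push_cast
      calc _ = ∑ χ : DirichletCharacter ℂ q, ∑ r, ∑ s,
            (B r * starRingEnd ℂ (B s)) * (χ r * starRingEnd ℂ (χ s)) := by
            refine Finset.sum_congr rfl fun χ _ => ?_
            rw [← Complex.mul_conj', map_sum, Finset.sum_mul_sum]
            refine Finset.sum_congr rfl fun r _ => Finset.sum_congr rfl fun s _ => ?_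
            rw [map_mul]; ring
        _ = ∑ r, ∑ s, (B r * starRingEnd ℂ (B s)) *
              ∑ χ : DirichletCharacter ℂ q, (χ r * starRingEnd ℂ (χ s)) := by
            rw [Finset.sum_comm]
            refine Finset.sum_congr rfl fun r _ => ?_
            rw [Finset.sum_comm]
            exact Finset.sum_congr rfl fun s _ => by rw [Finset.mul_sum]
        _ = _ := by
            refine Finset.sum_congr rfl fun r _ => ?_
            simp_rw [horth]
            rw [Finset.sum_eq_single r]
            · by_cases hr : IsUnit r
              · simp [hr, Complex.mul_conj']; ring
              · simp [hr]
            · intro s _ hs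
              rw [if_neg (fun h => hs h.1.symm), mul_zero]
            · simp
    have hc' := Complex.ofReal_injective hc
    rw [hc', Finset.mul_sum]
    refine Finset.sum_le_sum fun r _ => ?_
    split_ifs
    · gcongr
      exact Nat.totient_le q
    · positivity
  calc ∑ χ ∈ S, ‖∑ n ∈ A, x n * χ n‖ ^ 2
      ≤ ∑ χ : DirichletCharacter ℂ q, ‖∑ n ∈ A, x n * χ n‖ ^ 2 :=
        Finset.sum_le_sum_of_subset_of_nonneg (Finset.subset_univ _) fun _ _ _ => by positivity
    _ ≤ q * ∑ r, ‖B r‖ ^ 2 := by simp_rw [h1]; exact h2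
    _ ≤ q * ∑ r, W * ∑ n ∈ A with ((n : ℕ) : ZMod q) = r, ‖x n‖ ^ 2 / w n := by
        gcongr with r
        calc ‖B r‖ ^ 2 ≤ (∑ n ∈ A with ((n : ℕ) : ZMod q) = r, ‖x n‖) ^ 2 := by
              gcongr; exact norm_sum_le _ _
          _ ≤ (∑ n ∈ A with ((n : ℕ) : ZMod q) = r, w n) *
                ∑ n ∈ A with ((n : ℕ) : ZMod q) = r, ‖x n‖ ^ 2 / w n := by
              refine Finset.sum_sq_le_sum_mul_sum_of_sq_le_mul _ ?_ ?_ ?_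
              · intro n hn; exact (hw n (Finset.mem_filter.1 hn).1).le
              · intro n hn
                have := hw n (Finset.mem_filter.1 hn).1
                positivity
              · intro n hn
                exact (mul_div_cancel₀ _ (hw n (Finset.mem_filter.1 hn).1).ne').ge
          _ ≤ _ := by
              gcongr
              · refine Finset.sum_nonneg fun n hn => ?_
                have := hw n (Finset.mem_filter.1 hn).1
                positivity
              · exact hW r
    _ = _ := by
        rw [← Finset.mul_sum, Finset.sum_fiberwise A (fun n : ℕ => (n : ZMod q)), mul_assoc]

/-- In a residue class, the total weight is at most the first weight plus the mean weight. -/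
theorem sum_residueClass_le {q : ℕ} [NeZero q] {w : ℕ → ℝ} {a b : ℕ}
    (hw0 : ∀ n, 0 ≤ w n) (hw : ∀ m n, a ≤ m → m ≤ n → w n ≤ w m) (r : ZMod q) :
    ∑ n ∈ Finset.Icc a b with ((n : ℕ) : ZMod q) = r, w n ≤
      w a + (1 / q) * ∑ n ∈ Finset.Icc a b, w n := by
  have hq : 0 < q := Nat.pos_of_ne_zero (NeZero.ne q)
  have hgap : ∀ m n : ℕ, (m : ZMod q) = r → (n : ZMod q) = r → m < n → m + q ≤ n := by
    intro m n hm hn hmn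
    have h1 : m ≡ n [MOD q] := (ZMod.natCast_eq_natCast_iff _ _ _).1 (hm.trans hn.symm)
    have h2 := Nat.le_of_dvd (by omega) ((Nat.modEq_iff_dvd' hmn.le).1 h1)
    omega
  rw [← Finset.sum_filter_add_sum_filter_not _ (fun n => n < a + q), Finset.filter_filter,
    Finset.filter_filter]
  refine add_le_add ?_ ?_
  · have hcard : ((Finset.Icc a b).filter fun n : ℕ => (n : ZMod q) = r ∧ n < a + q).card ≤ 1 := by
      rw [Finset.card_le_one]
      intro m hm n hn
      simp only [Finset.mem_filter, Finset.mem_Icc] at hm hn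
      rcases lt_trichotomy m n with h | h | h
      · have := hgap m n hm.2.1 hn.2.1 h; omega
      · exact h
      · have := hgap n m hn.2.1 hm.2.1 h; omega
    calc _ ≤ ((Finset.Icc a b).filter fun n : ℕ => (n : ZMod q) = r ∧ n < a + q).card • w a := by
          refine Finset.sum_le_card_nsmul _ _ _ fun n hn => ?_
          simp only [Finset.mem_filter, Finset.mem_Icc] at hn
          exact hw a n le_rfl hn.1.1
      _ ≤ 1 • w a := nsmul_le_nsmul_left (hw0 a) hcard
      _ = w a := one_nsmul _
  · set T := (Finset.Icc a b).filter fun n : ℕ => (n : ZMod q) = r ∧ ¬ n < a + q with hT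
    have hmem : ∀ n ∈ T, a + q ≤ n ∧ n ≤ b ∧ (n : ZMod q) = r := by
      intro n hn
      simp only [hT, Finset.mem_filter, Finset.mem_Icc] at hn
      exact ⟨by omega, hn.1.2, hn.2.1⟩
    calc ∑ n ∈ T, w n ≤ ∑ n ∈ T, (1 / q : ℝ) * ∑ k ∈ Finset.Ioc (n - q) n, w k := by
          refine Finset.sum_le_sum fun n hn => ?_
          obtain ⟨h1, h2, h3⟩ := hmem n hn
          have h4 : (Finset.Ioc (n - q) n).card • w n ≤ ∑ k ∈ Finset.Ioc (n - q) n, w k := by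
            refine Finset.card_nsmul_le_sum _ _ _ fun k hk => ?_
            rw [Finset.mem_Ioc] at hk
            exact hw k n (by omega) hk.2
          rw [Nat.card_Ioc, show n - (n - q) = q by omega, nsmul_eq_mul] at h4
          have hq' : (0 : ℝ) < q := by exact_mod_cast hq
          rw [one_div, ← div_eq_inv_mul, le_div_iff₀ hq', mul_comm]
          exact h4
      _ = (1 / q : ℝ) * ∑ k ∈ T.biUnion fun n => Finset.Ioc (n - q) n, w k := by
          rw [← Finset.mul_sum, Finset.sum_biUnion]
          intro m hm n hn hmn
          obtain ⟨h1, h2, h3⟩ := hmem m hm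
          obtain ⟨h1', h2', h3'⟩ := hmem n hn
          rw [Function.onFun, Finset.disjoint_left]
          intro k hk hk'
          rw [Finset.mem_Ioc] at hk hk'
          rcases lt_or_gt_of_ne hmn with h | h
          · have := hgap m n h3 h3' h; omega
          · have := hgap n m h3' h3 h; omega
      _ ≤ _ := by
          gcongr
          · exact fun _ _ _ => hw0 _
          · intro k hk
            obtain ⟨n, hn, hk⟩ := Finset.mem_biUnion.1 hk
            obtain ⟨h1, h2, h3⟩ := hmem n hn
            rw [Finset.mem_Ioc] at hk
            rw [Finset.mem_Icc]
            omega

/-- Partial summation against a decreasing weight. -/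
theorem sum_mul_le_of_sum_le {a u : ℕ → ℝ} {B : ℝ} {N : ℕ}
    (hu0 : ∀ n, 0 ≤ u n) (hu : ∀ n, 1 ≤ n → u (n + 1) ≤ u n)
    (ha : ∀ n ≤ N, ∑ k ∈ Finset.Icc 1 n, a k ≤ B * n) :
    ∑ k ∈ Finset.Icc 1 N, a k * u k ≤ B * ∑ k ∈ Finset.Icc 1 N, u k := by
  suffices h : ∀ n ≤ N, ∑ k ∈ Finset.Icc 1 n, a k * u k +
      (B * n - ∑ k ∈ Finset.Icc 1 n, a k) * u n ≤ B * ∑ k ∈ Finset.Icc 1 n, u k by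
    have h1 := h N le_rfl
    have h2 := mul_nonneg (sub_nonneg.2 (ha N le_rfl)) (hu0 N)
    linarith
  intro n
  induction n with
  | zero => simp
  | succ n ih =>
    intro hn
    have h1 := ih (by omega)
    rw [Finset.sum_Icc_succ_top (by omega), Finset.sum_Icc_succ_top (by omega),
      Finset.sum_Icc_succ_top (by omega)]
    have h2 := ha n (by omega)
    push_cast
    rcases Nat.eq_zero_or_pos n with rfl | hpos
    · simp at h1 ⊢; linarith
    · have h3 := mul_le_mul_of_nonneg_left (hu n hpos) (sub_nonneg.2 h2)
      nlinarith

/-! ### Weights -/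

theorem sum_Icc_rpow_le {p : ℝ} (hp0 : 0 < p) (hp1 : p ≤ 1) (N : ℕ) :
    ∑ n ∈ Finset.Icc 1 N, (n : ℝ) ^ (p - 1) ≤ (N : ℝ) ^ p / p := by
  induction N with
  | zero => simp [Real.zero_rpow hp0.ne']
  | succ N ih =>
    rw [Finset.sum_Icc_succ_top (by omega)]
    have hN : (0 : ℝ) < ((N + 1 : ℕ) : ℝ) := by positivity
    have hb : (1 + -(1 / ((N + 1 : ℕ) : ℝ))) ^ p ≤ 1 + p * -(1 / ((N + 1 : ℕ) : ℝ)) := by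
      refine rpow_one_add_le_one_add_mul_self ?_ hp0.le hp1
      rw [neg_le_neg_iff, div_le_one hN]
      push_cast
      linarith [(Nat.cast_nonneg N : (0 : ℝ) ≤ N)]
    have h1 : (N : ℝ) = ((N + 1 : ℕ) : ℝ) * (1 + -(1 / ((N + 1 : ℕ) : ℝ))) := by
      field_simp
      push_cast
      ring
    have h2 : (N : ℝ) ^ p ≤ ((N + 1 : ℕ) : ℝ) ^ p - p * ((N + 1 : ℕ) : ℝ) ^ (p - 1) := by
      conv_lhs => rw [h1]
      rw [Real.mul_rpow hN.le, Real.rpow_sub_one hN.ne']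
      · calc _ ≤ ((N + 1 : ℕ) : ℝ) ^ p * (1 + p * -(1 / ((N + 1 : ℕ) : ℝ))) := by gcongr
          _ = _ := by field_simp; ring
      · by_contra! h
        have := mul_neg_of_pos_of_neg hN h
        rw [← h1] at this
        linarith [(Nat.cast_nonneg N : (0 : ℝ) ≤ N)]
    have h3 : (N : ℝ) ^ p / p + ((N + 1 : ℕ) : ℝ) ^ (p - 1) ≤ ((N + 1 : ℕ) : ℝ) ^ p / p := by
      rw [div_add' _ _ _ hp0.ne']
      gcongr
      linarith
    linarith

theorem sum_Icc_inv_le (N : ℕ) : ∑ n ∈ Finset.Icc 1 N, (n : ℝ)⁻¹ ≤ 1 + Real.log N := by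
  have := harmonic_le_one_add_log N
  rw [harmonic_eq_sum_Icc] at this
  push_cast at this
  exact this

/-- The weight `n ^ (-1/2) min((Q/n) ^ (1/20), (Q/n) ^ 2)`, which dominates the smooth weight of
the approximate functional equation. -/
def afeWeight (Q : ℝ) (n : ℕ) : ℝ :=
  (n : ℝ) ^ (-(1 / 2) : ℝ) * min ((Q / n) ^ (1 / 20 : ℝ)) ((Q / n) ^ (2 : ℝ))

section afeWeight

variable {Q : ℝ} (hQ : 0 < Q)
include hQ

theorem afeWeight_nonneg (n : ℕ) : 0 ≤ afeWeight Q n := by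
  unfold afeWeight; positivity

theorem afeWeight_pos {n : ℕ} (hn : 1 ≤ n) : 0 < afeWeight Q n := by
  have : (0 : ℝ) < n := by exact_mod_cast hn
  unfold afeWeight; positivity

theorem afeWeight_anti {m n : ℕ} (hm : 1 ≤ m) (hmn : m ≤ n) : afeWeight Q n ≤ afeWeight Q m := by
  have h1 : (0 : ℝ) < m := by exact_mod_cast hm
  have h2 : (m : ℝ) ≤ n := by exact_mod_cast hmn
  have h3 : (0 : ℝ) < n := h1.trans_le h2
  unfold afeWeight
  have h4 : (n : ℝ) ^ (-(1 / 2) : ℝ) ≤ (m : ℝ) ^ (-(1 / 2) : ℝ) :=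
    Real.rpow_le_rpow_of_nonpos h1 h2 (by norm_num)
  gcongr

theorem afeWeight_le_left {n : ℕ} (hn : 1 ≤ n) :
    afeWeight Q n ≤ Q ^ (1 / 20 : ℝ) * (n : ℝ) ^ ((9 / 20 : ℝ) - 1) := by
  have h3 : (0 : ℝ) < n := by exact_mod_cast hn
  unfold afeWeight
  calc _ ≤ (n : ℝ) ^ (-(1 / 2) : ℝ) * (Q / n) ^ (1 / 20 : ℝ) := by
        gcongr; exact min_le_left _ _
    _ = _ := by
        rw [Real.div_rpow hQ.le h3.le, show ((9 / 20 : ℝ) - 1) = -(1 / 2) - 1 / 20 by norm_num,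
          Real.rpow_sub h3]
        ring

theorem afeWeight_le_right {n : ℕ} (hn : 1 ≤ n) :
    afeWeight Q n ≤ Q ^ 2 * (n : ℝ) ^ (-(1 / 2) : ℝ) * ((n : ℝ) ^ 2)⁻¹ := by
  have h3 : (0 : ℝ) < n := by exact_mod_cast hn
  unfold afeWeight
  calc _ ≤ (n : ℝ) ^ (-(1 / 2) : ℝ) * (Q / n) ^ (2 : ℝ) := by
        gcongr; exact min_le_right _ _
    _ = _ := by
        rw [Real.rpow_two]
        field_simp

theorem sum_afeWeight_le_rpow (N : ℕ) :
    ∑ n ∈ Finset.Icc 1 N, afeWeight Q n ≤ 3 * (Q ^ (1 / 20 : ℝ) * (N : ℝ) ^ (9 / 20 : ℝ)) := by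
  calc _ ≤ ∑ n ∈ Finset.Icc 1 N, Q ^ (1 / 20 : ℝ) * (n : ℝ) ^ ((9 / 20 : ℝ) - 1) :=
        Finset.sum_le_sum fun n hn => afeWeight_le_left hQ (Finset.mem_Icc.1 hn).1
    _ ≤ Q ^ (1 / 20 : ℝ) * ((N : ℝ) ^ (9 / 20 : ℝ) / (9 / 20)) := by
        rw [← Finset.mul_sum]
        gcongr
        exact sum_Icc_rpow_le (by norm_num) (by norm_num) N
    _ ≤ _ := by
        have : 0 ≤ Q ^ (1 / 20 : ℝ) * (N : ℝ) ^ (9 / 20 : ℝ) := by positivity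
        linarith

theorem sum_afeWeight_le (N : ℕ) : ∑ n ∈ Finset.Icc 1 N, afeWeight Q n ≤ 5 * Q ^ (1 / 2 : ℝ) := by
  have hsub : Finset.Icc 1 N ⊆ Finset.Icc 1 ⌊Q⌋₊ ∪ Finset.Ioo ⌊Q⌋₊ (N + 1) := by
    intro n hn
    simp only [Finset.mem_union, Finset.mem_Icc, Finset.mem_Ioo] at hn ⊢
    omega
  refine (Finset.sum_le_sum_of_subset_of_nonneg hsub fun n _ _ => afeWeight_nonneg hQ n).trans ?_
  rw [Finset.sum_union]
  · have h1 : ∑ n ∈ Finset.Icc 1 ⌊Q⌋₊, afeWeight Q n ≤ 3 * Q ^ (1 / 2 : ℝ) := by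
      refine (sum_afeWeight_le_rpow hQ _).trans ?_
      calc _ ≤ 3 * (Q ^ (1 / 20 : ℝ) * Q ^ (9 / 20 : ℝ)) := by
            gcongr; exact Nat.floor_le hQ.le
        _ = _ := by rw [← Real.rpow_add hQ]; norm_num
    have h2 : ∑ n ∈ Finset.Ioo ⌊Q⌋₊ (N + 1), afeWeight Q n ≤ 2 * Q ^ (1 / 2 : ℝ) := by
      calc _ ≤ ∑ n ∈ Finset.Ioo ⌊Q⌋₊ (N + 1), Q ^ (3 / 2 : ℝ) * ((n : ℝ) ^ 2)⁻¹ := by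
            refine Finset.sum_le_sum fun n hn => ?_
            rw [Finset.mem_Ioo] at hn
            have hn1 : 1 ≤ n := by omega
            refine (afeWeight_le_right hQ hn1).trans ?_
            gcongr
            have hlt : Q < n := (Nat.floor_lt hQ.le).1 hn.1
            calc Q ^ 2 * (n : ℝ) ^ (-(1 / 2) : ℝ) ≤ Q ^ (2 : ℝ) * Q ^ (-(1 / 2) : ℝ) := by
                  rw [Real.rpow_two]
                  gcongr ?_ * ?_
                  exact Real.rpow_le_rpow_of_nonpos hQ hlt.le (by norm_num)
              _ = _ := by rw [← Real.rpow_add hQ]; norm_num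
        _ ≤ Q ^ (3 / 2 : ℝ) * (2 / (⌊Q⌋₊ + 1)) := by
            rw [← Finset.mul_sum]
            gcongr
            exact sum_Ioo_inv_sq_le _ _
        _ ≤ Q ^ (3 / 2 : ℝ) * (2 / Q) := by
            gcongr
            exact (Nat.lt_floor_add_one Q).le
        _ = _ := by
            rw [show (3 / 2 : ℝ) = 1 / 2 + 1 by norm_num, Real.rpow_add_one hQ.ne']
            field_simp
    linarith
  · rw [Finset.disjoint_left]
    intro n h1 h2
    rw [Finset.mem_Icc] at h1
    rw [Finset.mem_Ioo] at h2
    omega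

theorem afeWeight_le_of_sq_le {n : ℕ} (hn : 1 ≤ n) (h : Q ^ 2 ≤ n) :
    afeWeight Q n ≤ (n : ℝ) ^ (-(3 / 2) : ℝ) := by
  have h3 : (0 : ℝ) < n := by exact_mod_cast hn
  refine (afeWeight_le_right hQ hn).trans ?_
  calc Q ^ 2 * (n : ℝ) ^ (-(1 / 2) : ℝ) * ((n : ℝ) ^ 2)⁻¹
      ≤ n * (n : ℝ) ^ (-(1 / 2) : ℝ) * ((n : ℝ) ^ 2)⁻¹ := by gcongr
    _ = _ := by
        rw [show (-(3 / 2) : ℝ) = -(1 / 2) - 1 by norm_num, Real.rpow_sub_one h3.ne']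
        field_simp

end afeWeight

theorem sum_Icc_rpow_neg_three_halves_le (N : ℕ) :
    ∑ n ∈ Finset.Icc 1 N, (n : ℝ) ^ (-(3 / 2) : ℝ) ≤ ∑' n : ℕ, (n : ℝ) ^ (-(3 / 2) : ℝ) :=
  (Real.summable_nat_rpow.2 (by norm_num)).sum_le_tsum _ fun _ _ => by positivity

/-! ### Vertical lines -/

theorem integrable_of_norm_le_exp {f : ℝ → ℂ} {C : ℝ} (hf : Continuous f)
    (hC : ∀ v : ℝ, 1 ≤ |v| → ‖f v‖ ≤ C * Real.exp (-(1 / 4) * v ^ 2)) :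
    MeasureTheory.Integrable f := by
  obtain ⟨B, hB⟩ := (isCompact_Icc (a := (-1 : ℝ)) (b := 1)).exists_bound_of_continuousOn
    hf.continuousOn
  have hg : MeasureTheory.Integrable fun v : ℝ =>
      (|C| + |B| * Real.exp (1 / 4)) * Real.exp (-(1 / 4) * v ^ 2) :=
    (integrable_exp_neg_mul_sq (by norm_num)).const_mul _
  refine hg.mono' hf.aestronglyMeasurable (MeasureTheory.ae_of_all _ fun v => ?_)
  have he := Real.exp_pos (-(1 / 4) * v ^ 2)
  rcases le_or_gt 1 |v| with h | h
  · refine (hC v h).trans ?_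
    gcongr
    have := Real.exp_pos (1 / 4)
    nlinarith [le_abs_self C, abs_nonneg B]
  · have h1 : ‖f v‖ ≤ B := hB v (by rw [Set.mem_Icc]; exact abs_le.1 h.le)
    have h2 : 1 ≤ Real.exp (1 / 4) * Real.exp (-(1 / 4) * v ^ 2) := by
      rw [← Real.exp_add]
      apply Real.one_le_exp
      have : v ^ 2 ≤ 1 := by rw [← sq_abs]; nlinarith [abs_nonneg v]
      linarith
    calc ‖f v‖ ≤ |B| * 1 := by rw [mul_one]; exact h1.trans (le_abs_self B)
      _ ≤ |B| * (Real.exp (1 / 4) * Real.exp (-(1 / 4) * v ^ 2)) := by gcongr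
      _ ≤ _ := by nlinarith [abs_nonneg C, mul_nonneg (abs_nonneg C) he.le]

/-- The integral over a vertical line of a holomorphic function with rapid decay does not
depend on the line. -/
theorem integral_vertical_eq {f : ℂ → ℂ} {a b C : ℝ} (hab : a ≤ b)
    (hf : DifferentiableOn ℂ f (Complex.re ⁻¹' Set.Icc a b))
    (hC : ∀ σ ∈ Set.Icc a b, ∀ v : ℝ, 1 ≤ |v| →
      ‖f (σ + v * Complex.I)‖ ≤ C * Real.exp (-(1 / 4) * v ^ 2)) :
    ∫ v : ℝ, f (a + v * Complex.I) = ∫ v : ℝ, f (b + v * Complex.I) := by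
  have hline : ∀ σ ∈ Set.Icc a b, MeasureTheory.Integrable fun v : ℝ => f (σ + v * Complex.I) := by
    intro σ hσ
    refine integrable_of_norm_le_exp (C := C) ?_ (hC σ hσ)
    refine hf.continuousOn.comp_continuous (by fun_prop) fun v => ?_
    simpa using hσ
  have hrect : ∀ T : ℝ, (((∫ x : ℝ in a..b, f (x + ((-T : ℝ) : ℂ) * Complex.I)) -
      ∫ x : ℝ in a..b, f (x + (T : ℂ) * Complex.I)) +
      Complex.I • ∫ y : ℝ in (-T)..T, f (b + y * Complex.I)) -
      Complex.I • ∫ y : ℝ in (-T)..T, f (a + y * Complex.I) = 0 := by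
    intro T
    have := Complex.integral_boundary_rect_eq_zero_of_differentiableOn f (⟨a, -T⟩ : ℂ) ⟨b, T⟩ ?_
    · simpa using this
    · refine hf.mono fun z hz => ?_
      rw [Complex.mem_reProdIm, Set.uIcc_of_le hab] at hz
      exact hz.1
  have hhor : ∀ s : ℝ → ℝ, (∀ T, |s T| = |T|) →
      Tendsto (fun T : ℝ => ∫ x : ℝ in a..b, f (x + (s T : ℂ) * Complex.I)) atTop (𝓝 0) := by
    intro s hs
    have hlim : Tendsto (fun T : ℝ => C * Real.exp (-(1 / 4) * T ^ 2) * |b - a|) atTop (𝓝 0) := by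
      have h1 : Tendsto (fun T : ℝ => -(1 / 4) * T ^ 2) atTop atBot :=
        (tendsto_pow_atTop two_ne_zero).const_mul_atTop_of_neg (by norm_num)
      have h2 := ((Real.tendsto_exp_atBot.comp h1).const_mul C).mul_const |b - a|
      simpa using h2
    refine squeeze_zero_norm' ?_ hlim
    filter_upwards [eventually_ge_atTop 1] with T hT
    refine intervalIntegral.norm_integral_le_of_norm_le_const fun x hx => ?_
    rw [Set.uIoc_of_le hab] at hx
    have h1 := hC x ⟨hx.1.le, hx.2⟩ (s T) (by rw [hs]; exact hT.trans (le_abs_self T))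
    rwa [← sq_abs (s T), hs, sq_abs] at h1
  have h1 := hhor (fun T => -T) (fun T => abs_neg T)
  have h2 := hhor (fun T => T) (fun T => rfl)
  have h3 := MeasureTheory.intervalIntegral_tendsto_integral (hline b ⟨hab, le_rfl⟩)
    tendsto_neg_atTop_atBot tendsto_id
  have h4 := MeasureTheory.intervalIntegral_tendsto_integral (hline a ⟨le_rfl, hab⟩)
    tendsto_neg_atTop_atBot tendsto_id
  have h5 := ((h1.sub h2).add (h3.const_smul Complex.I)).sub (h4.const_smul Complex.I)
  have h6 := tendsto_nhds_unique (h5.congr fun T => hrect T) tendsto_const_nhds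
  rw [sub_zero, zero_add, sub_eq_zero] at h6
  exact ((smul_right_injective ℂ Complex.I_ne_zero) h6).symm

/-- `(2πi)⁻¹ ∫ e^{s²} ds / s = 1/2` over a line to the right of the origin. -/
theorem integral_exp_sq_div {c : ℝ} (hc : 0 < c) :
    ∫ v : ℝ, Complex.exp ((c + v * Complex.I) ^ 2) / (c + v * Complex.I) = Real.pi := by
  have hne : ∀ v : ℝ, (c + v * Complex.I : ℂ) ≠ 0 := by
    intro v h
    have := congrArg Complex.re h
    simp at this
    exact hc.ne' this
  set g : ℝ → ℝ → ℂ := fun v x =>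
    Complex.exp ((c + v * Complex.I) ^ 2) * Complex.exp (-(c + v * Complex.I) * x) with hg
  have hin : ∀ v : ℝ, ∫ x in Set.Ioi (0 : ℝ), g v x =
      Complex.exp ((c + v * Complex.I) ^ 2) / (c + v * Complex.I) := by
    intro v
    simp only [hg]
    rw [MeasureTheory.integral_const_mul, integral_exp_mul_complex_Ioi (by simpa using hc)]
    rw [Complex.ofReal_zero, mul_zero, Complex.exp_zero, neg_div_neg_eq, mul_one_div]
  simp_rw [← hin]
  have hint : MeasureTheory.Integrable (Function.uncurry g)
      (MeasureTheory.volume.prod (MeasureTheory.volume.restrict (Set.Ioi 0))) := by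
    have h1 : MeasureTheory.Integrable (fun v : ℝ => Real.exp (c ^ 2) * Real.exp (-1 * v ^ 2)) :=
      (integrable_exp_neg_mul_sq one_pos).const_mul _
    have h2 : MeasureTheory.Integrable (fun x : ℝ => Real.exp (-c * x))
        (MeasureTheory.volume.restrict (Set.Ioi 0)) :=
      exp_neg_integrableOn_Ioi 0 hc
    refine (h1.mul_prod h2).mono' ?_ (MeasureTheory.ae_of_all _ fun z => ?_)
    · refine Continuous.aestronglyMeasurable ?_
      simp only [hg, Function.uncurry_def]
      fun_prop
    · simp only [hg, Function.uncurry, norm_mul, Complex.norm_exp]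
      rw [← Real.exp_add, ← Real.exp_add, ← Real.exp_add]
      apply le_of_eq
      congr 1
      simp [sq, sub_eq_add_neg]
  rw [MeasureTheory.integral_integral_swap hint]
  have hout : ∀ x : ℝ, ∫ v : ℝ, g v x =
      ((Real.sqrt Real.pi * Real.exp (-(1 / 4) * x ^ 2) : ℝ) : ℂ) := by
    intro x
    have h1 : ∀ v : ℝ, g v x = Complex.exp ((-1) * (v : ℂ) ^ 2 +
        ((2 * c - x) * Complex.I) * v + (c ^ 2 - x * c)) := by
      intro v
      simp only [hg]
      rw [← Complex.exp_add]
      congr 1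
      ring_nf
      rw [Complex.I_sq]
      ring
    simp_rw [h1]
    rw [integral_cexp_quadratic (by simp)]
    push_cast
    rw [Real.sqrt_eq_rpow, Complex.ofReal_cpow Real.pi_pos.le]
    congr 1
    · norm_num
    · congr 1
      rw [mul_pow, Complex.I_sq]
      ring
  simp_rw [hout]
  rw [integral_complex_ofReal, MeasureTheory.integral_const_mul, integral_gaussian_Ioi]
  norm_cast
  rw [show Real.pi / (1 / 4) = Real.pi * 2 ^ 2 by ring, Real.sqrt_mul Real.pi_pos.le,
    Real.sqrt_sq (by norm_num)]
  nlinarith [Real.mul_self_sqrt Real.pi_pos.le]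

theorem add_mul_I_ne_zero {c : ℝ} (hc : c ≠ 0) (v : ℝ) : (c + v * Complex.I : ℂ) ≠ 0 := by
  intro h
  have := congrArg Complex.re h
  simp at this
  exact hc this

theorem norm_add_mul_I_sq (c v : ℝ) : ‖(c + v * Complex.I : ℂ)‖ ^ 2 = c ^ 2 + v ^ 2 := by
  rw [← Complex.normSq_eq_norm_sq, Complex.normSq_add_mul_I]

theorem integrable_inv_sq_add_sq {c : ℝ} (hc : c ≠ 0) :
    MeasureTheory.Integrable fun v : ℝ => (c ^ 2 + v ^ 2)⁻¹ := by
  have h := (integrable_inv_one_add_sq.comp_div hc).const_mul (c ^ 2)⁻¹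
  refine h.congr (MeasureTheory.ae_of_all _ fun v => ?_)
  have h1 : 0 < c ^ 2 := by positivity
  have h2 : 0 < c ^ 2 + v ^ 2 := by positivity
  have h3 : 0 < 1 + (v / c) ^ 2 := by positivity
  field_simp

/-- Perron's formula with the kernel `1 / w ^ 2`. -/
theorem integral_exp_div_sq {c : ℝ} (hc : 0 < c) (y : ℝ) :
    ∫ v : ℝ, Complex.exp (y * (c + v * Complex.I)) / (c + v * Complex.I) ^ 2 =
      ((2 * Real.pi * max y 0 : ℝ) : ℂ) := by
  set f₀ : ℝ → ℂ := (Set.Ioc (0 : ℝ) 1).indicator fun _ => 1 with hf₀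
  -- differentiating the Mellin transform `1 / s` of `f₀` brings in a factor `log x`
  have hder : ∀ s : ℂ, 0 < s.re → MellinConvergent (fun t => Real.log t • f₀ t) s ∧
      mellin (fun t => Real.log t • f₀ t) s = -1 / s ^ 2 := by
    intro s hs
    have h1 := mellin_hasDerivAt_of_isBigO_rpow (E := ℂ) (a := s.re + 1) (b := 0) (f := f₀) (s := s)
      ?_ ?_ (by linarith) ?_ hs
    · refine ⟨h1.1, ?_⟩
      have h2 : HasDerivAt (mellin f₀) (-1 / s ^ 2) s := by
        have hs0 : s ≠ 0 := by rintro rfl; simp at hs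
        have h3 : HasDerivAt (fun z : ℂ => 1 / z) (-1 / s ^ 2) s := by
          simpa [neg_div] using hasDerivAt_inv hs0
        refine h3.congr_of_eventuallyEq ?_
        filter_upwards [(isOpen_lt continuous_const Complex.continuous_re).mem_nhds hs] with z hz
        exact (hasMellin_one_Ioc hz).2
      exact h1.2.unique h2
    · refine MeasureTheory.Integrable.locallyIntegrable ?_ |>.locallyIntegrableOn _
      exact (MeasureTheory.integrable_indicator_iff measurableSet_Ioc).2
        (MeasureTheory.integrableOn_const (by simp))
    · refine Asymptotics.IsBigO.of_bound 1 ?_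
      filter_upwards [eventually_gt_atTop 1] with x hx
      rw [hf₀, Set.indicator_of_notMem (fun h => absurd h.2 (not_le.2 hx)), norm_zero]
      positivity
    · refine Asymptotics.IsBigO.of_bound 1 (Eventually.of_forall fun x => ?_)
      rw [neg_zero, Real.rpow_zero, norm_one, mul_one, hf₀]
      exact (norm_indicator_le_norm_self _ _).trans (by simp)
  have hx : 0 < Real.exp (-y) := Real.exp_pos _
  have hval : ∀ x : ℝ, 0 < x → Real.log x • f₀ x = ((min (Real.log x) 0 : ℝ) : ℂ) := by
    intro x hx
    by_cases h : x ≤ 1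
    · rw [hf₀, Set.indicator_of_mem (Set.mem_Ioc.2 ⟨hx, h⟩), min_eq_left (Real.log_nonpos hx.le h)]
      simp
    · push Not at h
      rw [hf₀, Set.indicator_of_notMem (fun h' => absurd h'.2 (not_le.2 h)),
        min_eq_right (Real.log_nonneg h.le)]
      simp
  have hinv := mellinInv_mellin_eq c (fun t => Real.log t • f₀ t) hx
    (hder c (by simpa using hc)).1 ?_ ?_
  · simp only [hval _ hx, mellinInv] at hinv
    have h3 : ∀ v : ℝ, ((Real.exp (-y) : ℝ) : ℂ) ^ (-(c + v * Complex.I)) •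
        mellin (fun t => Real.log t • f₀ t) (c + v * Complex.I) =
          -(Complex.exp (y * (c + v * Complex.I)) / (c + v * Complex.I) ^ 2) := by
      intro v
      rw [(hder _ (by simpa using hc)).2, smul_eq_mul,
        Complex.cpow_def_of_ne_zero (by exact_mod_cast hx.ne'), ← Complex.ofReal_log hx.le,
        Real.log_exp, neg_div, mul_neg, mul_one_div]
      congr 3
      push_cast
      ring
    simp_rw [h3] at hinv
    rw [MeasureTheory.integral_neg, Real.log_exp] at hinv
    have h4 : min (-y) 0 = -max y 0 := by simpa using min_neg_neg y 0
    rw [h4] at hinv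
    have hpi : (2 * Real.pi : ℂ) ≠ 0 := by
      exact_mod_cast (by positivity : (2 * Real.pi : ℝ) ≠ 0)
    rw [smul_neg] at hinv
    push_cast at hinv ⊢
    have h5 := neg_injective hinv
    rw [← h5, Complex.real_smul]
    push_cast
    rw [← mul_assoc, mul_one_div_cancel hpi, one_mul]
  · refine (integrable_inv_sq_add_sq hc.ne').mono' ?_ (MeasureTheory.ae_of_all _ fun v => ?_)
    · have h3 : (fun v : ℝ => mellin (fun t => Real.log t • f₀ t) (c + v * Complex.I)) =
          fun v : ℝ => -1 / (c + v * Complex.I) ^ 2 := by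
        ext v
        exact (hder _ (by simpa using hc)).2
      rw [h3]
      refine Continuous.aestronglyMeasurable ?_
      refine continuous_const.div (by fun_prop) fun v => pow_ne_zero _ (add_mul_I_ne_zero hc.ne' v)
    · rw [(hder _ (by simpa using hc)).2, norm_div, norm_pow, norm_add_mul_I_sq]
      simp
  · have hc2 : ContinuousAt (fun x : ℝ => ((min (Real.log x) 0 : ℝ) : ℂ)) (Real.exp (-y)) := by
      have := Real.continuousAt_log hx.ne'
      fun_prop
    refine hc2.congr ?_
    filter_upwards [lt_mem_nhds hx] with x hx
    exact (hval x hx).symm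

/-! ### Holomorphic logarithms -/

/-- A nonvanishing holomorphic function on a convex open set has a holomorphic logarithm: the
continuous logarithm given by covering theory differs from a principal branch by a constant near each
point. -/
theorem exists_differentiableOn_log {f : ℂ → ℂ} {U : Set ℂ} (hU : IsOpen U) (hconv : Convex ℝ U)
    (hne : U.Nonempty) (hf : DifferentiableOn ℂ f U) (h0 : ∀ z ∈ U, f z ≠ 0) :
    ∃ g : ℂ → ℂ, DifferentiableOn ℂ g U ∧ ∀ z ∈ U, Complex.exp (g z) = f z := by
  have : ContractibleSpace U := hconv.contractibleSpace hne
  have hsc : IsSimplyConnected U := (inferInstance : SimplyConnectedSpace U)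
  obtain ⟨g, hg, hgf⟩ := Complex.exists_continuousOn_eqOn_exp_comp hsc hU hf.continuousOn
    (by rintro ⟨z, hz, hz0⟩; exact h0 z hz hz0)
  have hgf' : ∀ z ∈ U, Complex.exp (g z) = f z := hgf
  refine ⟨g, fun z hz => ?_, hgf'⟩
  have hUz : U ∈ 𝓝 z := hU.mem_nhds hz
  have hcont : ContinuousAt (fun w => (g w - g z).im) z := by
    have := hg.continuousAt hUz
    fun_prop
  -- close to `z`, the branch `g` is given by the principal branch of the logarithm
  have hev : ∀ᶠ w in 𝓝 z, g w = Complex.log (f w / f z) + g z := by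
    have hI : Set.Ioo (-Real.pi) Real.pi ∈ 𝓝 ((g z - g z).im) := by
      rw [sub_self, Complex.zero_im]
      exact Ioo_mem_nhds (neg_lt_zero.2 Real.pi_pos) Real.pi_pos
    filter_upwards [hUz, hcont hI] with w hw hwI
    rw [← hgf' w hw, ← hgf' z hz, ← Complex.exp_sub, Complex.log_exp hwI.1 hwI.2.le]
    ring
  have hfz : DifferentiableAt ℂ f z := hf.differentiableAt hUz
  have hslit : f z / f z ∈ Complex.slitPlane := by
    rw [div_self (h0 z hz)]; exact Complex.one_mem_slitPlane
  have hd : DifferentiableAt ℂ (fun w => Complex.log (f w / f z) + g z) z :=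
    ((hfz.div_const _).clog hslit).add_const _
  exact (hd.congr_of_eventuallyEq hev).differentiableWithinAt

/-! ### Bounds for the Gamma function -/

theorem differentiableAt_Gamma_of_pos {x : ℝ} (hx : 0 < x) : DifferentiableAt ℝ Real.Gamma x :=
  Real.differentiableAt_Gamma fun m => by
    have := (Nat.cast_nonneg m : (0 : ℝ) ≤ m)
    linarith

theorem Complex.norm_Gamma_le_Gamma_re {s : ℂ} (hs : 0 < s.re) :
    ‖Complex.Gamma s‖ ≤ Real.Gamma s.re := by
  rw [Complex.Gamma_eq_integral hs, Complex.GammaIntegral, Real.Gamma_eq_integral hs]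
  refine MeasureTheory.norm_integral_le_of_norm_le (Real.GammaIntegral_convergent hs) ?_
  filter_upwards [MeasureTheory.ae_restrict_mem measurableSet_Ioi] with x hx
  rw [norm_mul, Complex.norm_cpow_eq_rpow_re_of_pos hx]
  simp [Complex.norm_exp]

theorem Complex.norm_sin_le (z : ℂ) : ‖Complex.sin z‖ ≤ Real.exp |z.im| := by
  rw [Complex.sin, norm_div, norm_mul, Complex.norm_I, mul_one]
  have h1 : ‖Complex.exp (-z * Complex.I) - Complex.exp (z * Complex.I)‖ ≤
      Real.exp |z.im| + Real.exp |z.im| := by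
    refine (norm_sub_le _ _).trans (add_le_add ?_ ?_)
    · rw [Complex.norm_exp]
      gcongr
      simpa using le_abs_self z.im
    · rw [Complex.norm_exp]
      gcongr
      simpa using neg_le_abs z.im
  rw [Complex.norm_ofNat]
  linarith

theorem Complex.norm_Gamma_le_norm_Gamma_add {z : ℂ} (hz : 1 ≤ |z.im|) (k : ℕ) :
    ‖Complex.Gamma z‖ ≤ ‖Complex.Gamma (z + k)‖ := by
  induction k with
  | zero => simp
  | succ k ih =>
    have hne : z + k ≠ 0 := by
      intro h
      have := congrArg Complex.im h
      simp at this
      rw [this] at hz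
      norm_num at hz
    push_cast
    rw [← add_assoc, Complex.Gamma_add_one _ hne, norm_mul]
    have h1 : 1 ≤ ‖z + k‖ := by
      refine hz.trans ?_
      have := Complex.abs_im_le_norm (z + k)
      simpa using this
    nlinarith [norm_nonneg (Complex.Gamma (z + k))]

/-- By the reflection formula, `1 / Γ` has at most exponential growth in a vertical strip. -/
theorem Complex.exists_norm_Gamma_inv_le (a b : ℝ) :
    ∃ C : ℝ, ∀ s : ℂ, a ≤ s.re → s.re ≤ b →
      ‖(Complex.Gamma s)⁻¹‖ ≤ C * Real.exp (Real.pi * |s.im|) := by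
  obtain ⟨C₁, hC₁⟩ := (isCompact_Icc (a := a) (b := b)).reProdIm
    (isCompact_Icc (a := (-1 : ℝ)) (b := 1)) |>.exists_bound_of_continuousOn
      Complex.differentiable_one_div_Gamma.continuous.continuousOn
  set k := ⌈b⌉₊ with hk
  have hkb : b ≤ k := Nat.le_ceil b
  obtain ⟨C₂, hC₂⟩ := (isCompact_Icc (a := 1 - b + k) (b := 1 - a + k)).exists_bound_of_continuousOn
    (f := Real.Gamma) (fun x hx => (differentiableAt_Gamma_of_pos
      (by linarith [hx.1])).continuousAt.continuousWithinAt)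
  refine ⟨|C₁| + |C₂|, fun s hsa hsb => ?_⟩
  have he : 1 ≤ Real.exp (Real.pi * |s.im|) := Real.one_le_exp (by positivity)
  rcases le_or_gt 1 |s.im| with h | h
  · have hsin : Complex.sin (Real.pi * s) ≠ 0 := by
      rw [Complex.sin_ne_zero_iff]
      intro n hn
      have h1 := congrArg Complex.im hn
      simp [Real.pi_ne_zero] at h1
      rw [h1] at h
      norm_num at h
    have hpi : (Real.pi : ℂ) ≠ 0 := by exact_mod_cast Real.pi_ne_zero
    have hmul := Complex.Gamma_mul_Gamma_one_sub s
    have hinv : (Complex.Gamma s)⁻¹ =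
        Complex.Gamma (1 - s) * Complex.sin (Real.pi * s) / Real.pi := by
      refine inv_eq_of_mul_eq_one_right ?_
      rw [← mul_div_assoc, ← mul_assoc, hmul]
      field_simp
    have hG : ‖Complex.Gamma (1 - s)‖ ≤ |C₂| := by
      refine (Complex.norm_Gamma_le_norm_Gamma_add (by simpa using h) k).trans ?_
      have hre : (1 - s + k : ℂ).re = 1 - s.re + k := by simp
      refine (Complex.norm_Gamma_le_Gamma_re (by rw [hre]; linarith)).trans ?_
      rw [hre]
      refine (le_abs_self _).trans ((hC₂ _ ⟨?_, ?_⟩).trans (le_abs_self _)) <;> linarith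
    rw [hinv, norm_div, norm_mul, Complex.norm_real, Real.norm_of_nonneg Real.pi_pos.le]
    have hs2 : ‖Complex.sin (Real.pi * s)‖ ≤ Real.exp (Real.pi * |s.im|) := by
      refine (Complex.norm_sin_le _).trans ?_
      rw [Complex.im_ofReal_mul, abs_mul, abs_of_pos Real.pi_pos]
    refine (div_le_self (by positivity) (by linarith [Real.pi_gt_three])).trans ?_
    gcongr
    linarith [abs_nonneg C₁]
  · have h1 : ‖(Complex.Gamma s)⁻¹‖ ≤ |C₁| := by
      refine (hC₁ s ?_).trans (le_abs_self _)
      rw [Complex.mem_reProdIm]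
      exact ⟨⟨hsa, hsb⟩, abs_le.1 h.le⟩
    nlinarith [abs_nonneg C₁, abs_nonneg C₂]

theorem Complex.norm_pi_cpow_neg_half (s : ℂ) :
    ‖(Real.pi : ℂ) ^ (-s / 2)‖ = Real.pi ^ (-s.re / 2) := by
  rw [Complex.norm_cpow_eq_rpow_re_of_pos Real.pi_pos]
  simp

theorem Complex.exists_norm_Gammaℝ_le {a b : ℝ} (ha : 0 < a) :
    ∃ C : ℝ, ∀ s : ℂ, a ≤ s.re → s.re ≤ b → ‖Complex.Gammaℝ s‖ ≤ C := by
  obtain ⟨C, hC⟩ := (isCompact_Icc (a := a) (b := b)).exists_bound_of_continuousOn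
    (f := fun x => Real.pi ^ (-x / 2) * Real.Gamma (x / 2)) (by
      intro x hx
      have h1 : ContinuousAt Real.Gamma (x / 2) :=
        (differentiableAt_Gamma_of_pos (by linarith [hx.1])).continuousAt
      have h2 : ContinuousAt (fun x => Real.Gamma (x / 2)) x :=
        h1.comp (f := fun x : ℝ => x / 2) (by fun_prop)
      have h3 : ContinuousAt (fun x : ℝ => Real.pi ^ (-x / 2)) x :=
        ContinuousAt.rpow continuousAt_const (by fun_prop) (Or.inl Real.pi_ne_zero)
      exact (h3.mul h2).continuousWithinAt)
  refine ⟨C, fun s h1 h2 => ?_⟩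
  rw [Complex.Gammaℝ_def, norm_mul, Complex.norm_pi_cpow_neg_half]
  have hre : (s / 2).re = s.re / 2 := by simp
  have h3 := Complex.norm_Gamma_le_Gamma_re (s := s / 2) (by rw [hre]; linarith)
  rw [hre] at h3
  calc _ ≤ Real.pi ^ (-s.re / 2) * Real.Gamma (s.re / 2) := by gcongr
    _ ≤ _ := (le_abs_self _).trans (hC s.re ⟨h1, h2⟩)

theorem Complex.exists_norm_Gammaℝ_inv_le (a b : ℝ) :
    ∃ C : ℝ, 0 ≤ C ∧ ∀ s : ℂ, a ≤ s.re → s.re ≤ b →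
      ‖(Complex.Gammaℝ s)⁻¹‖ ≤ C * Real.exp (Real.pi * |s.im|) := by
  obtain ⟨C, hC⟩ := Complex.exists_norm_Gamma_inv_le (a / 2) (b / 2)
  refine ⟨Real.pi ^ (b / 2) * |C|, by positivity, fun s h1 h2 => ?_⟩
  have hre : (s / 2).re = s.re / 2 := by simp
  have him : (s / 2).im = s.im / 2 := by simp
  have h3 := hC (s / 2) (by rw [hre]; linarith) (by rw [hre]; linarith)
  rw [him] at h3
  rw [Complex.Gammaℝ_def, mul_inv, norm_mul, norm_inv, Complex.norm_pi_cpow_neg_half,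
    ← Real.rpow_neg Real.pi_pos.le, mul_assoc]
  gcongr ?_ * ?_
  · exact Real.rpow_le_rpow_of_exponent_le (by linarith [Real.pi_gt_three]) (by linarith)
  · refine h3.trans ?_
    have h4 : |s.im / 2| ≤ |s.im| := by
      rw [abs_div, abs_two]; linarith [abs_nonneg s.im]
    exact mul_le_mul (le_abs_self C) (by gcongr) (Real.exp_pos _).le (abs_nonneg C)

/-! ### Continuation of the twisted `L`-functions -/

theorem entireContinuation_apply (f : ℂ → ℂ) {s : ℂ} (hs : 1 < s.re) :
    entireContinuation f s = f s := by
  unfold entireContinuation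
  split_ifs with h
  · exact h.choose_spec.2 s hs
  · rfl

theorem HasEntireContinuation.differentiable {f : ℂ → ℂ} (h : HasEntireContinuation f) :
    Differentiable ℂ (entireContinuation f) := by
  unfold entireContinuation
  rw [dif_pos h]
  exact h.choose_spec.1

namespace LDatum

variable {d : ℕ} {F : LDatum d} {q : ℕ} {χ : DirichletCharacter ℂ q}

theorem mu_eq_or (F : LDatum d) (χ : DirichletCharacter ℂ q) :
    F.mu χ = F.muEven ∨ F.mu χ = F.muOdd := by
  by_cases h : χ.Even
  · left; ext j; simp [mu, h]
  · right; ext j; simp [mu, h]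

theorem IsStandard.neg_one_lt_muEven (hF : F.IsStandard) (j : Fin d) : -1 < (F.muEven j).re := by
  obtain ⟨θ, h1, _, h3⟩ := hF.mu_bound
  have : (0 : ℝ) ≤ 1 / (2 * d) := by positivity
  linarith [(h3 j).1]

theorem IsStandard.neg_one_lt_muOdd (hF : F.IsStandard) (j : Fin d) : -1 < (F.muOdd j).re := by
  obtain ⟨θ, h1, _, h3⟩ := hF.mu_bound
  have : (0 : ℝ) ≤ 1 / (2 * d) := by positivity
  linarith [(h3 j).2]

theorem IsStandard.neg_one_lt_mu (hF : F.IsStandard) (χ : DirichletCharacter ℂ q) (j : Fin d) :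
    -1 < (F.mu χ j).re := by
  rcases F.mu_eq_or χ with h | h
  · rw [h]; exact hF.neg_one_lt_muEven j
  · rw [h]; exact hF.neg_one_lt_muOdd j

variable (F χ) in
/-- The reciprocal of `archFactor`, as an entire function. -/
def archFactorInv (s : ℂ) : ℂ := (F.N q : ℂ) ^ (-(s / 2)) * ∏ j, (Complex.Gammaℝ (s + F.mu χ j))⁻¹

theorem differentiable_archFactorInv (hN : 0 < F.N q) : Differentiable ℂ (F.archFactorInv χ) := by
  have h0 : (F.N q : ℂ) ≠ 0 := by exact_mod_cast hN.ne'
  have h1 : Differentiable ℂ fun s : ℂ => (F.N q : ℂ) ^ (-(s / 2)) := fun s =>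
    DifferentiableAt.const_cpow (by fun_prop) (Or.inl h0)
  have h2 : Differentiable ℂ fun s : ℂ => ∏ j, (Complex.Gammaℝ (s + F.mu χ j))⁻¹ := by
    refine Differentiable.fun_finsetProd fun j _ => ?_
    exact Complex.differentiable_Gammaℝ_inv.comp (differentiable_id.add_const _)
  exact h1.mul h2

theorem archFactor_mul_archFactorInv (hF : F.IsStandard) (hN : 0 < F.N q) {s : ℂ} (hs : 1 ≤ s.re) :
    F.archFactor χ s * F.archFactorInv χ s = 1 := by
  have h0 : (F.N q : ℂ) ≠ 0 := by exact_mod_cast hN.ne'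
  unfold archFactor archFactorInv
  rw [Complex.cpow_neg, mul_mul_mul_comm,
    mul_inv_cancel₀ ((Complex.cpow_ne_zero_iff_of_exponent_ne_zero (by
      intro h
      have := congrArg Complex.re h
      simp at this
      linarith)).2 h0), one_mul, ← Finset.prod_mul_distrib]
  refine Finset.prod_eq_one fun j _ => mul_inv_cancel₀ ?_
  refine Complex.Gammaℝ_ne_zero_of_re_pos ?_
  rw [Complex.add_re]
  linarith [hF.neg_one_lt_mu χ j]

theorem twistL_eq (hF : F.IsStandard) (hq : 2 ≤ q) (hχ : χ.IsPrimitive) (s : ℂ) :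
    F.twistL χ s = F.completedL χ s * F.archFactorInv χ s := by
  have hN := hF.conductor_pos q hq
  unfold twistL
  rw [entireContinuation_eq (g := fun s => F.completedL χ s * F.archFactorInv χ s)]
  · exact ((hF.entire q hq χ hχ).1.differentiable).mul (differentiable_archFactorInv hN)
  · intro s hs
    rw [completedL, entireContinuation_apply _ hs, completedSeries, mul_assoc,
      archFactor_mul_archFactorInv hF hN hs.le, mul_one]

theorem differentiable_completedL (hF : F.IsStandard) (hq : 2 ≤ q) (hχ : χ.IsPrimitive) :
    Differentiable ℂ (F.completedL χ) :=
  (hF.entire q hq χ hχ).1.differentiable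

theorem differentiable_twistL (hF : F.IsStandard) (hq : 2 ≤ q) (hχ : χ.IsPrimitive) :
    Differentiable ℂ (F.twistL χ) := by
  rw [show F.twistL χ = fun s => F.completedL χ s * F.archFactorInv χ s from
    funext (twistL_eq hF hq hχ)]
  exact (differentiable_completedL hF hq hχ).mul
    (differentiable_archFactorInv (hF.conductor_pos q hq))

theorem twistL_eq_LSeries {s : ℂ} (hs : 1 < s.re) : F.twistL χ s = LSeries (F.twistCoeff χ) s :=
  entireContinuation_apply _ hs

theorem norm_twistCoeff_le (n : ℕ) : ‖F.twistCoeff χ n‖ ≤ ‖F.coeff n‖ := by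
  rw [twistCoeff, norm_mul]
  exact mul_le_of_le_one_right (norm_nonneg _) (DirichletCharacter.norm_le_one χ _)

theorem norm_LSeries_twistCoeff_le (hF : F.IsStandard) {σ : ℝ} (hσ : 1 < σ) {s : ℂ}
    (hs : σ ≤ s.re) :
    ‖LSeries (F.twistCoeff χ) s‖ ≤ ∑' n, ‖LSeries.term F.coeff σ n‖ := by
  have hsum : Summable fun n => ‖LSeries.term F.coeff σ n‖ :=
    (hF.series_converges σ (by simpa using hσ)).norm
  have hle : ∀ n, ‖LSeries.term (F.twistCoeff χ) s n‖ ≤ ‖LSeries.term F.coeff σ n‖ := fun n =>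
    (LSeries.norm_term_le s (norm_twistCoeff_le n)).trans
      (LSeries.norm_term_le_of_re_le_re F.coeff (by simpa using hs) n)
  exact tsum_of_norm_bounded hsum.hasSum hle

/-! ### The dual datum -/

theorem Gammaℝ_conj (s : ℂ) :
    Complex.Gammaℝ (starRingEnd ℂ s) = starRingEnd ℂ (Complex.Gammaℝ s) := by
  rw [Complex.Gammaℝ_def, Complex.Gammaℝ_def, map_mul, ← Complex.Gamma_conj, map_div₀,
    Complex.conj_ofNat]
  congr 1
  have : -(starRingEnd ℂ) s / 2 = starRingEnd ℂ (-s / 2) := by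
    rw [map_div₀, map_neg, Complex.conj_ofNat]
  rw [this, Complex.cpow_conj _ _ (by
    rw [Complex.arg_ofReal_of_nonneg Real.pi_pos.le]; exact Real.pi_pos.ne), Complex.conj_ofReal]

theorem dual_mu_inv (F : LDatum d) (χ : DirichletCharacter ℂ q) (j : Fin d) :
    F.dual.mu χ⁻¹ j = starRingEnd ℂ (F.mu χ j) := by
  have h : χ⁻¹.Even ↔ χ.Even := by
    unfold DirichletCharacter.Even
    rw [MulChar.inv_apply_eq_inv', inv_eq_one]
  by_cases hχ : χ.Even
  · simp [mu, dual, hχ, h.2 hχ]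
  · simp [mu, dual, hχ, mt h.1 hχ]

theorem twistCoeff_dual (n : ℕ) :
    F.dual.twistCoeff χ⁻¹ n = starRingEnd ℂ (F.twistCoeff χ n) := by
  rw [twistCoeff, twistCoeff, coeff_dual, map_mul, starRingEnd_apply (χ _), MulChar.star_apply']

theorem LSeries_twistCoeff_dual (s : ℂ) :
    LSeries (F.dual.twistCoeff χ⁻¹) s =
      starRingEnd ℂ (LSeries (F.twistCoeff χ) (starRingEnd ℂ s)) := by
  unfold LSeries
  rw [Complex.conj_tsum]
  refine tsum_congr fun n => ?_
  rcases eq_or_ne n 0 with rfl | hn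
  · simp
  rw [LSeries.term_of_ne_zero hn, LSeries.term_of_ne_zero hn, twistCoeff_dual, map_div₀,
    Complex.cpow_conj _ _ (by
      rw [Complex.natCast_arg]; exact Real.pi_pos.ne), Complex.conj_natCast, Complex.conj_conj]

theorem completedSeries_dual (hN : 0 < F.N q) (s : ℂ) :
    F.dual.completedSeries χ⁻¹ s =
      starRingEnd ℂ (F.completedSeries χ (starRingEnd ℂ s)) := by
  unfold completedSeries archFactor
  rw [LSeries_twistCoeff_dual, map_mul, map_mul, map_prod]
  congr 2
  · have : starRingEnd ℂ s / 2 = starRingEnd ℂ (s / 2) := by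
      rw [map_div₀, Complex.conj_ofNat]
    rw [this, Complex.cpow_conj _ _ (by
      rw [Complex.arg_ofReal_of_nonneg hN.le]; exact Real.pi_pos.ne), Complex.conj_ofReal,
      Complex.conj_conj]
    rfl
  · refine Finset.prod_congr rfl fun j _ => ?_
    rw [dual_mu_inv, ← Gammaℝ_conj, map_add, Complex.conj_conj]

/-- The functional equation, with the dual `L`-function written as a complex conjugate. -/
theorem exists_completedL_eq_conj (hF : F.IsStandard) (hq : 2 ≤ q) (hχ : χ.IsPrimitive) :
    ∃ κ : ℂ, ‖κ‖ = 1 ∧ ∀ s : ℂ, s.re < 0 →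
      F.completedL χ s = κ * starRingEnd ℂ (F.completedSeries χ (1 - starRingEnd ℂ s)) := by
  obtain ⟨κ, h1, h2⟩ := hF.functional_equation q hq χ hχ
  refine ⟨κ, h1, fun s hs => ?_⟩
  rw [h2 s, completedL, entireContinuation_apply _ (by
    rw [Complex.sub_re, Complex.one_re]; linarith),
    completedSeries_dual (hF.conductor_pos q hq)]
  simp

/-! ### Bounds in vertical strips -/

theorem exists_norm_prod_Gammaℝ_le (μ : Fin d → ℂ) {a b : ℝ} (h : ∀ j, 0 < a + (μ j).re) :
    ∃ C : ℝ, 0 ≤ C ∧ ∀ s : ℂ, a ≤ s.re → s.re ≤ b → ‖∏ j, Complex.Gammaℝ (s + μ j)‖ ≤ C := by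
  choose C hC using fun j => Complex.exists_norm_Gammaℝ_le (a := a + (μ j).re)
    (b := b + (μ j).re) (h j)
  refine ⟨∏ j, |C j|, by positivity, fun s h1 h2 => ?_⟩
  rw [norm_prod]
  refine Finset.prod_le_prod (fun _ _ => norm_nonneg _) fun j _ => ?_
  refine (hC j _ ?_ ?_).trans (le_abs_self _) <;> rw [Complex.add_re] <;> linarith

theorem exists_norm_prod_Gammaℝ_inv_le (μ : Fin d → ℂ) (a b : ℝ) :
    ∃ C B : ℝ, 0 ≤ C ∧ 0 ≤ B ∧ ∀ s : ℂ, a ≤ s.re → s.re ≤ b →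
      ‖∏ j, (Complex.Gammaℝ (s + μ j))⁻¹‖ ≤ C * Real.exp (B * |s.im|) := by
  choose C hC0 hC using fun j => Complex.exists_norm_Gammaℝ_inv_le (a + (μ j).re) (b + (μ j).re)
  refine ⟨∏ j, (C j * Real.exp (Real.pi * |(μ j).im|)), d * Real.pi,
    Finset.prod_nonneg fun j _ => mul_nonneg (hC0 j) (Real.exp_pos _).le, by positivity,
    fun s h1 h2 => ?_⟩
  rw [norm_prod]
  calc _ ≤ ∏ j, (C j * Real.exp (Real.pi * |(μ j).im|)) * Real.exp (Real.pi * |s.im|) := by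
        refine Finset.prod_le_prod (fun _ _ => norm_nonneg _) fun j _ => ?_
        refine (hC j _ (by rw [Complex.add_re]; linarith) (by rw [Complex.add_re]; linarith)).trans
          ?_
        rw [mul_assoc, ← Real.exp_add, ← mul_add]
        refine mul_le_mul_of_nonneg_left ?_ (hC0 j)
        rw [Complex.add_im, add_comm |(μ j).im|]
        gcongr
        exact abs_add_le _ _
    _ = _ := by
        rw [Finset.prod_mul_distrib, Finset.prod_const, Finset.card_univ, Fintype.card_fin,
          ← Real.exp_nat_mul, mul_assoc (d : ℝ)]

/-- Phragmén–Lindelöf in the strip `-2 ≤ Re s ≤ 3`: the series is bounded on the right edge, and the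
functional equation carries the bound to the left edge. -/
theorem exists_norm_completedL_le (hF : F.IsStandard) :
    ∃ C : ℝ, 0 ≤ C ∧ ∀ q : ℕ, 2 ≤ q → ∀ χ : DirichletCharacter ℂ q, χ.IsPrimitive →
      ∀ s : ℂ, -2 ≤ s.re → s.re ≤ 3 → ‖F.completedL χ s‖ ≤ C * F.N q ^ (3 / 2 : ℝ) := by
  obtain ⟨C₁, hC₁0, hC₁⟩ := exists_norm_prod_Gammaℝ_le F.muEven (a := 3) (b := 3)
    (fun j => by linarith [hF.neg_one_lt_muEven j])
  obtain ⟨C₂, hC₂0, hC₂⟩ := exists_norm_prod_Gammaℝ_le F.muOdd (a := 3) (b := 3)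
    (fun j => by linarith [hF.neg_one_lt_muOdd j])
  set Z : ℝ := ∑' n, ‖LSeries.term F.coeff ((3 : ℝ) : ℂ) n‖ with hZ
  have hZ0 : 0 ≤ Z := tsum_nonneg fun _ => norm_nonneg _
  refine ⟨Z * (C₁ + C₂), by positivity, fun q hq χ hχ => ?_⟩
  have hN := hF.conductor_pos q hq
  have hseries : ∀ s : ℂ, s.re = 3 →
      ‖F.completedSeries χ s‖ ≤ Z * (C₁ + C₂) * F.N q ^ (3 / 2 : ℝ) := by
    intro s hs
    have hG : ‖∏ j, Complex.Gammaℝ (s + F.mu χ j)‖ ≤ C₁ + C₂ := by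
      rcases F.mu_eq_or χ with h | h
      · rw [h]; linarith [hC₁ s hs.ge hs.le]
      · rw [h]; linarith [hC₂ s hs.ge hs.le]
    have hL := norm_LSeries_twistCoeff_le (χ := χ) hF (σ := 3) (by norm_num) (s := s) hs.ge
    rw [completedSeries, archFactor, norm_mul, norm_mul, Complex.norm_cpow_eq_rpow_re_of_pos hN]
    have hre : (s / 2).re = 3 / 2 := by simp [hs]
    rw [hre]
    calc _ ≤ Z * (F.N q ^ (3 / 2 : ℝ) * (C₁ + C₂)) := by gcongr
      _ = _ := by ring
  have hd := differentiable_completedL hF hq hχ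
  obtain ⟨κ, hκ, hfe⟩ := exists_completedL_eq_conj hF hq hχ
  intro s h1 h2
  refine PhragmenLindelof.vertical_strip (a := -2) (b := 3) hd.diffContOnCl ?_ ?_ ?_ h1 h2
  · refine ⟨1 / 2, ?_, 34, ?_⟩
    · rw [lt_div_iff₀ (by norm_num)]
      linarith [Real.pi_gt_three]
    · have hO := (hF.entire q hq χ hχ).2.1 (3 / 2) (by norm_num)
      have hle : comap (_root_.abs ∘ Complex.im) atTop ⊓ 𝓟 (Complex.re ⁻¹' Set.Ioo (-2) 3) ≤
          cocompact ℂ := by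
        rw [← Metric.cobounded_eq_cocompact, ← comap_norm_atTop]
        refine inf_le_left.trans ?_
        rw [← tendsto_iff_comap]
        refine tendsto_atTop_mono (f := fun z : ℂ => |z.im|) (fun z => Complex.abs_im_le_norm z) ?_
        exact tendsto_comap
      refine (hO.mono hle).trans ?_
      refine Asymptotics.IsBigO.of_bound 1 ?_
      have hev : ∀ᶠ z : ℂ in comap (_root_.abs ∘ Complex.im) atTop ⊓
          𝓟 (Complex.re ⁻¹' Set.Ioo (-2) 3), z ∈ Complex.re ⁻¹' Set.Ioo (-2 : ℝ) 3 :=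
        mem_inf_of_right (mem_principal_self _)
      filter_upwards [hev] with z hz
      rw [one_mul, Real.norm_of_nonneg (Real.exp_pos _).le, Real.norm_of_nonneg (Real.exp_pos _).le]
      apply Real.exp_le_exp.2
      have hx := abs_nonneg z.im
      have hz3 : |z.re| ≤ 3 := abs_le.2 ⟨by linarith [hz.1], hz.2.le⟩
      have hn : ‖z‖ ≤ 3 + |z.im| := (Complex.norm_le_abs_re_add_abs_im z).trans (by linarith)
      have he : 1 + 1 / 2 * |z.im| + (1 / 2 * |z.im|) ^ 2 / 2 ≤ Real.exp (1 / 2 * |z.im|) :=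
        Real.quadratic_le_exp_of_nonneg (by positivity)
      calc ‖z‖ ^ (3 / 2 : ℝ) ≤ (3 + |z.im|) ^ (3 / 2 : ℝ) := by gcongr
        _ ≤ (3 + |z.im|) ^ (2 : ℝ) :=
            Real.rpow_le_rpow_of_exponent_le (by linarith) (by norm_num)
        _ = (3 + |z.im|) ^ 2 := Real.rpow_two _
        _ ≤ 34 * Real.exp (1 / 2 * |z.im|) := by nlinarith
  · intro z hz
    rw [hfe z (by linarith), norm_mul, hκ, one_mul, Complex.norm_conj]
    refine hseries _ ?_
    simp [hz]; norm_num
  · intro z hz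
    rw [completedL, entireContinuation_apply _ (by linarith)]
    exact hseries z hz

/-- Dividing the bound for the completed `L`-function by the archimedean factor costs only an
exponential in `|Im s|`, which is harmless under a logarithm. -/
theorem exists_norm_twistL_le (hF : F.IsStandard) :
    ∃ C B : ℝ, 0 ≤ C ∧ 0 ≤ B ∧ ∀ q : ℕ, 2 ≤ q → ∀ χ : DirichletCharacter ℂ q, χ.IsPrimitive →
      ∀ s : ℂ, 0 ≤ s.re → s.re ≤ 3 →
        ‖F.twistL χ s‖ ≤ C * (1 + F.N q) ^ (3 / 2 : ℝ) * Real.exp (B * |s.im|) := by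
  obtain ⟨C₁, B₁, hC₁0, hB₁0, hC₁⟩ := exists_norm_prod_Gammaℝ_inv_le F.muEven 0 3
  obtain ⟨C₂, B₂, hC₂0, hB₂0, hC₂⟩ := exists_norm_prod_Gammaℝ_inv_le F.muOdd 0 3
  obtain ⟨C, hC0, hC⟩ := exists_norm_completedL_le hF
  refine ⟨C * (C₁ + C₂), B₁ + B₂, by positivity, by positivity, fun q hq χ hχ s h1 h2 => ?_⟩
  have hN := hF.conductor_pos q hq
  have hG : ‖∏ j, (Complex.Gammaℝ (s + F.mu χ j))⁻¹‖ ≤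
      (C₁ + C₂) * Real.exp ((B₁ + B₂) * |s.im|) := by
    rcases F.mu_eq_or χ with h | h
    · rw [h]
      refine (hC₁ s h1 h2).trans ?_
      gcongr <;> linarith
    · rw [h]
      refine (hC₂ s h1 h2).trans ?_
      gcongr <;> linarith
  rw [twistL_eq hF hq hχ, archFactorInv, norm_mul, norm_mul,
    Complex.norm_cpow_eq_rpow_re_of_pos hN]
  have hre : (-(s / 2)).re = -(s.re / 2) := by simp
  rw [hre]
  have hpow : F.N q ^ (3 / 2 : ℝ) * F.N q ^ (-(s.re / 2)) ≤ (1 + F.N q) ^ (3 / 2 : ℝ) := by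
    rw [← Real.rpow_add hN]
    calc _ ≤ (1 + F.N q) ^ (3 / 2 + -(s.re / 2)) := by
          refine Real.rpow_le_rpow hN.le (by linarith) (by linarith)
      _ ≤ _ := Real.rpow_le_rpow_of_exponent_le (by linarith) (by linarith)
  calc _ ≤ (C * F.N q ^ (3 / 2 : ℝ)) * (F.N q ^ (-(s.re / 2)) *
        ((C₁ + C₂) * Real.exp ((B₁ + B₂) * |s.im|))) := by
        gcongr
        exact hC q hq χ hχ s (by linarith) h2
    _ = C * (C₁ + C₂) * (F.N q ^ (3 / 2 : ℝ) * F.N q ^ (-(s.re / 2))) *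
        Real.exp ((B₁ + B₂) * |s.im|) := by ring
    _ ≤ _ := by gcongr

end LDatum

/-! ### The smooth weight of the approximate functional equation -/

section AFEKernel

variable {d : ℕ}

/-- An even polynomial with real coefficients that cancels the poles of `∏ j, Γ_ℝ(1/2 + s + μ_j)` in
the half plane `-3/2 ≤ Re s` when `-1 < Re μ_j`. -/
def afePoly (μ : Fin d → ℂ) (s : ℂ) : ℂ :=
  ∏ j, ((1 / 2 + s + μ j) * ((1 / 2 + s + starRingEnd ℂ (μ j)) *
    ((1 / 2 - s + μ j) * (1 / 2 - s + starRingEnd ℂ (μ j)))))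

/-- The kernel `∏ j, Γ_ℝ(1/2 + s + μ_j) P(s) e^{s²} / s` with `P = afePoly μ`; the recurrence of the
Gamma function has been used to remove the singularities in `0 < Re s`. -/
def afeKernel (μ : Fin d → ℂ) (s : ℂ) : ℂ :=
  (∏ j, (2 * Real.pi * Complex.Gammaℝ (s + (5 / 2 + μ j)) * ((1 / 2 + s + starRingEnd ℂ (μ j)) *
    ((1 / 2 - s + μ j) * (1 / 2 - s + starRingEnd ℂ (μ j)))))) * (Complex.exp (s ^ 2) / s)

/-- The weight function of the approximate functional equation, an inverse Mellin transform. -/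
def afeV (μ : Fin d → ℂ) (y : ℝ) : ℂ :=
  ∫ v : ℝ, afeKernel μ (((2 : ℝ) : ℂ) + v * Complex.I) * (y : ℂ) ^ (-(((2 : ℝ) : ℂ) + v * Complex.I))

variable (μ : Fin d → ℂ)

theorem norm_half_add_le {b σ v : ℝ} (hb : 0 ≤ b) (hσ : |σ| ≤ b) (z s : ℂ)
    (hs : s = σ + v * Complex.I ∨ s = -(σ + v * Complex.I)) :
    ‖1 / 2 + s + z‖ ≤ (1 + b + ‖z‖) * Real.exp |v| := by
  have h1 : ‖s‖ ≤ b + |v| := by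
    have h2 : ‖(σ + v * Complex.I : ℂ)‖ ≤ b + |v| := by
      refine (norm_add_le _ _).trans ?_
      rw [norm_mul, Complex.norm_I, mul_one, Complex.norm_real, Complex.norm_real]
      simpa using hσ
    rcases hs with rfl | rfl
    · exact h2
    · rwa [norm_neg]
  have h3 : ‖1 / 2 + s + z‖ ≤ 1 / 2 + (b + |v|) + ‖z‖ := by
    refine (norm_add₃_le).trans ?_
    gcongr
    simp
  have h4 : |v| + 1 ≤ Real.exp |v| := Real.add_one_le_exp _
  nlinarith [norm_nonneg z, abs_nonneg v]

theorem prod_le_mul_exp {f : Fin d → ℂ} {A : Fin d → ℝ} {k x : ℝ}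
    (h : ∀ j, ‖f j‖ ≤ A j * Real.exp (k * x)) :
    ‖∏ j, f j‖ ≤ (∏ j, A j) * Real.exp (d * k * x) := by
  rw [norm_prod]
  calc _ ≤ ∏ j, A j * Real.exp (k * x) :=
        Finset.prod_le_prod (fun _ _ => norm_nonneg _) fun j _ => h j
    _ = _ := by
        rw [Finset.prod_mul_distrib, Finset.prod_const, Finset.card_univ, Fintype.card_fin,
          ← Real.exp_nat_mul, mul_assoc (d : ℝ)]

theorem norm_exp_sq (σ v : ℝ) :
    ‖Complex.exp ((σ + v * Complex.I) ^ 2)‖ = Real.exp (σ ^ 2 - v ^ 2) := by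
  rw [Complex.norm_exp]
  congr 1
  simp [sq]

theorem exp_mul_exp_sq_le {b σ k : ℝ} (hσ : |σ| ≤ b) (v : ℝ) :
    Real.exp (k * |v|) * Real.exp (σ ^ 2 - v ^ 2) ≤
      Real.exp (k ^ 2 + b ^ 2) * Real.exp (-(1 / 2) * v ^ 2) := by
  rw [← Real.exp_add, ← Real.exp_add]
  apply Real.exp_le_exp.2
  have h1 : σ ^ 2 ≤ b ^ 2 := by rw [← sq_abs σ]; gcongr
  nlinarith [sq_nonneg (|v| - k), sq_abs v, sq_nonneg k]

theorem exists_norm_afePoly_le (b : ℝ) (hb : 0 ≤ b) :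
    ∃ C : ℝ, 0 ≤ C ∧ ∀ σ v : ℝ, |σ| ≤ b →
      ‖afePoly μ (σ + v * Complex.I) * Complex.exp ((σ + v * Complex.I) ^ 2)‖ ≤
        C * Real.exp (-(1 / 2) * v ^ 2) := by
  set A : Fin d → ℝ := fun j => (1 + b + ‖μ j‖) ^ 4 with hA
  have hA0 : 0 ≤ ∏ j, A j := Finset.prod_nonneg fun j _ => by positivity
  refine ⟨(∏ j, A j) * Real.exp ((d * 4 : ℝ) ^ 2 + b ^ 2), by positivity, fun σ v hσ => ?_⟩
  have h1 : ‖afePoly μ (σ + v * Complex.I)‖ ≤ (∏ j, A j) * Real.exp (d * 4 * |v|) := by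
    refine prod_le_mul_exp fun j => ?_
    have e1 := norm_half_add_le hb hσ (μ j) (σ + v * Complex.I) (Or.inl rfl)
    have e2 := norm_half_add_le hb hσ (starRingEnd ℂ (μ j)) (σ + v * Complex.I) (Or.inl rfl)
    have e3 := norm_half_add_le hb hσ (μ j) (-(σ + v * Complex.I)) (Or.inr rfl)
    have e4 := norm_half_add_le hb hσ (starRingEnd ℂ (μ j)) (-(σ + v * Complex.I)) (Or.inr rfl)
    rw [Complex.norm_conj] at e2 e4
    rw [← sub_eq_add_neg] at e3 e4
    rw [norm_mul, norm_mul, norm_mul]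
    calc _ ≤ ((1 + b + ‖μ j‖) * Real.exp |v|) * (((1 + b + ‖μ j‖) * Real.exp |v|) *
          (((1 + b + ‖μ j‖) * Real.exp |v|) * ((1 + b + ‖μ j‖) * Real.exp |v|))) := by gcongr
      _ = (1 + b + ‖μ j‖) ^ 4 * Real.exp |v| ^ 4 := by ring
      _ = _ := by rw [← Real.exp_nat_mul]; push_cast; rfl
  rw [norm_mul, norm_exp_sq]
  calc _ ≤ (∏ j, A j) * Real.exp (d * 4 * |v|) * Real.exp (σ ^ 2 - v ^ 2) := by gcongr
    _ = (∏ j, A j) * (Real.exp (d * 4 * |v|) * Real.exp (σ ^ 2 - v ^ 2)) := by ring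
    _ ≤ (∏ j, A j) * (Real.exp ((d * 4 : ℝ) ^ 2 + b ^ 2) * Real.exp (-(1 / 2) * v ^ 2)) :=
        mul_le_mul_of_nonneg_left (exp_mul_exp_sq_le hσ v) hA0
    _ = _ := by ring

variable {μ}

theorem exists_norm_afeKernel_le (hμ : ∀ j, -1 < (μ j).re) {a b : ℝ} (ha : 0 < a) (hab : a ≤ b) :
    ∃ C : ℝ, 0 ≤ C ∧ ∀ σ v : ℝ, a ≤ σ → σ ≤ b →
      ‖afeKernel μ (σ + v * Complex.I)‖ ≤ C * Real.exp (-(1 / 2) * v ^ 2) := by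
  have hb : 0 ≤ b := ha.le.trans hab
  choose Cg hCg using fun j => Complex.exists_norm_Gammaℝ_le (a := a + (5 / 2 + (μ j).re))
    (b := b + (5 / 2 + (μ j).re)) (by linarith [hμ j])
  set A : Fin d → ℝ := fun j => 2 * Real.pi * |Cg j| * (1 + b + ‖μ j‖) ^ 3 with hA
  have hA0 : 0 ≤ ∏ j, A j := Finset.prod_nonneg fun j _ => by
    have := Real.pi_pos
    positivity
  refine ⟨(∏ j, A j) * Real.exp ((d * 3 : ℝ) ^ 2 + b ^ 2) / a, by positivity,
    fun σ v h1 h2 => ?_⟩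
  have hσ : |σ| ≤ b := by rw [abs_of_pos (ha.trans_le h1)]; exact h2
  have hP : ‖∏ j, (2 * Real.pi * Complex.Gammaℝ ((σ + v * Complex.I) + (5 / 2 + μ j)) *
      ((1 / 2 + (σ + v * Complex.I) + starRingEnd ℂ (μ j)) *
      ((1 / 2 - (σ + v * Complex.I) + μ j) *
        (1 / 2 - (σ + v * Complex.I) + starRingEnd ℂ (μ j)))))‖ ≤
      (∏ j, A j) * Real.exp (d * 3 * |v|) := by
    refine prod_le_mul_exp fun j => ?_
    have e2 := norm_half_add_le hb hσ (starRingEnd ℂ (μ j)) (σ + v * Complex.I) (Or.inl rfl)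
    have e3 := norm_half_add_le hb hσ (μ j) (-(σ + v * Complex.I)) (Or.inr rfl)
    have e4 := norm_half_add_le hb hσ (starRingEnd ℂ (μ j)) (-(σ + v * Complex.I)) (Or.inr rfl)
    rw [Complex.norm_conj] at e2 e4
    rw [← sub_eq_add_neg] at e3 e4
    have hre : ((σ + v * Complex.I) + (5 / 2 + μ j) : ℂ).re = σ + (5 / 2 + (μ j).re) := by
      simp
    have e5 := (hCg j ((σ + v * Complex.I) + (5 / 2 + μ j)) (by rw [hre]; linarith)
      (by rw [hre]; linarith)).trans (le_abs_self _)
    rw [norm_mul, norm_mul, norm_mul, norm_mul, norm_mul, Complex.norm_real,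
      Real.norm_of_nonneg Real.pi_pos.le, Complex.norm_ofNat]
    calc _ ≤ 2 * Real.pi * |Cg j| * (((1 + b + ‖μ j‖) * Real.exp |v|) *
          (((1 + b + ‖μ j‖) * Real.exp |v|) * ((1 + b + ‖μ j‖) * Real.exp |v|))) := by
          have := Real.pi_pos
          gcongr
      _ = 2 * Real.pi * |Cg j| * (1 + b + ‖μ j‖) ^ 3 * Real.exp |v| ^ 3 := by ring
      _ = _ := by rw [← Real.exp_nat_mul]; push_cast; rfl
  have hs : a ≤ ‖(σ + v * Complex.I : ℂ)‖ := by
    refine h1.trans ?_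
    have := Complex.re_le_norm (σ + v * Complex.I : ℂ)
    simpa using this
  unfold afeKernel
  rw [norm_mul, norm_div, norm_exp_sq, ← mul_div_assoc]
  calc _ ≤ (∏ j, A j) * Real.exp (d * 3 * |v|) * Real.exp (σ ^ 2 - v ^ 2) / a := by gcongr
    _ ≤ (∏ j, A j) * (Real.exp ((d * 3 : ℝ) ^ 2 + b ^ 2) * Real.exp (-(1 / 2) * v ^ 2)) / a := by
        rw [mul_assoc]
        exact div_le_div_of_nonneg_right
          (mul_le_mul_of_nonneg_left (exp_mul_exp_sq_le hσ v) hA0) ha.le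
    _ = _ := by ring

theorem differentiableAt_Gammaℝ {s : ℂ} (hs : 0 < s.re) : DifferentiableAt ℂ Complex.Gammaℝ s := by
  have h1 := (Complex.differentiable_Gammaℝ_inv s).inv
    (inv_ne_zero (Complex.Gammaℝ_ne_zero_of_re_pos hs))
  have h2 : (fun s => (Complex.Gammaℝ s)⁻¹)⁻¹ = Complex.Gammaℝ := by ext; simp
  rwa [h2] at h1

theorem differentiableAt_afeKernel (hμ : ∀ j, -1 < (μ j).re) {s : ℂ} (hs : 0 < s.re) :
    DifferentiableAt ℂ (afeKernel μ) s := by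
  have hs0 : s ≠ 0 := by rintro rfl; simp at hs
  unfold afeKernel
  refine DifferentiableAt.mul ?_ (DifferentiableAt.div (by fun_prop) (by fun_prop) hs0)
  refine DifferentiableAt.fun_finsetProd fun j _ => ?_
  have h1 : DifferentiableAt ℂ (fun s : ℂ => Complex.Gammaℝ (s + (5 / 2 + μ j))) s := by
    refine DifferentiableAt.comp (f := fun s => s + (5 / 2 + μ j)) s
      (differentiableAt_Gammaℝ ?_) (by fun_prop)
    have : (s + (5 / 2 + μ j)).re = s.re + (5 / 2 + (μ j).re) := by simp
    rw [this]
    linarith [hμ j]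
  fun_prop

theorem continuous_afeKernel_line (hμ : ∀ j, -1 < (μ j).re) {c : ℝ} (hc : 0 < c) :
    Continuous fun v : ℝ => afeKernel μ (c + v * Complex.I) := by
  refine continuous_iff_continuousAt.2 fun v => ?_
  have h1 := (differentiableAt_afeKernel hμ (s := c + v * Complex.I) (by simpa using hc)).continuousAt
  exact h1.comp (f := fun v : ℝ => (c + v * Complex.I : ℂ)) (by fun_prop)

theorem integrable_afeKernel_line (hμ : ∀ j, -1 < (μ j).re) {c : ℝ} (hc : 0 < c) :
    MeasureTheory.Integrable fun v : ℝ => afeKernel μ (c + v * Complex.I) := by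
  obtain ⟨C, hC0, hC⟩ := exists_norm_afeKernel_le hμ hc le_rfl
  refine ((integrable_exp_neg_mul_sq (b := 1 / 2) (by norm_num)).const_mul C).mono'
    (continuous_afeKernel_line hμ hc).aestronglyMeasurable (MeasureTheory.ae_of_all _ fun v => ?_)
  exact hC c v le_rfl le_rfl

theorem norm_cpow_neg_line {y : ℝ} (hy : 0 < y) (c v : ℝ) :
    ‖(y : ℂ) ^ (-(c + v * Complex.I))‖ = y ^ (-c) := by
  rw [Complex.norm_cpow_eq_rpow_re_of_pos hy]
  simp

/-- The line of integration that defines `afeV` may be moved within `0 < Re s`. -/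
theorem afeV_eq (hμ : ∀ j, -1 < (μ j).re) {c : ℝ} (hc : 0 < c) {y : ℝ} (hy : 0 < y) :
    afeV μ y = ∫ v : ℝ, afeKernel μ (c + v * Complex.I) * (y : ℂ) ^ (-(c + v * Complex.I)) := by
  have hy0 : (y : ℂ) ≠ 0 := by exact_mod_cast hy.ne'
  have main : ∀ a b : ℝ, 0 < a → a ≤ b →
      ∫ v : ℝ, afeKernel μ (a + v * Complex.I) * (y : ℂ) ^ (-(a + v * Complex.I)) =
      ∫ v : ℝ, afeKernel μ (b + v * Complex.I) * (y : ℂ) ^ (-(b + v * Complex.I)) := by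
    intro a b ha hab
    obtain ⟨C, hC0, hC⟩ := exists_norm_afeKernel_le hμ ha hab
    refine integral_vertical_eq (f := fun s => afeKernel μ s * (y : ℂ) ^ (-s))
      (C := C * (y ^ (-a) + y ^ (-b))) hab ?_ ?_
    · intro s hs
      refine DifferentiableAt.differentiableWithinAt ?_
      refine (differentiableAt_afeKernel hμ (ha.trans_le hs.1)).mul ?_
      exact DifferentiableAt.const_cpow (by fun_prop) (Or.inl hy0)
    · intro σ hσ v _
      have h1 := hC σ v hσ.1 hσ.2
      have h2 : y ^ (-σ) ≤ y ^ (-a) + y ^ (-b) := by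
        have p1 : 0 ≤ y ^ (-a) := by positivity
        have p2 : 0 ≤ y ^ (-b) := by positivity
        rcases le_total 1 y with h | h
        · have := Real.rpow_le_rpow_of_exponent_le h (neg_le_neg hσ.1)
          linarith
        · have := Real.rpow_le_rpow_of_exponent_ge hy h (neg_le_neg hσ.2)
          linarith
      rw [norm_mul, norm_cpow_neg_line hy]
      calc _ ≤ (C * Real.exp (-(1 / 2) * v ^ 2)) * (y ^ (-a) + y ^ (-b)) := by gcongr
        _ ≤ (C * Real.exp (-(1 / 4) * v ^ 2)) * (y ^ (-a) + y ^ (-b)) := by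
            gcongr
            nlinarith [sq_nonneg v]
        _ = _ := by ring
  unfold afeV
  rcases le_total c 2 with h | h
  · exact (main c 2 hc h).symm
  · exact main 2 c two_pos h

theorem exists_norm_afeV_le (hμ : ∀ j, -1 < (μ j).re) {c : ℝ} (hc : 0 < c) :
    ∃ C : ℝ, 0 ≤ C ∧ ∀ y : ℝ, 0 < y → ‖afeV μ y‖ ≤ C * y ^ (-c) := by
  refine ⟨∫ v : ℝ, ‖afeKernel μ (c + v * Complex.I)‖,
    MeasureTheory.integral_nonneg fun _ => norm_nonneg _, fun y hy => ?_⟩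
  rw [afeV_eq hμ hc hy, ← MeasureTheory.integral_mul_const]
  refine MeasureTheory.norm_integral_le_of_norm_le
    ((integrable_afeKernel_line hμ hc).norm.mul_const _) (MeasureTheory.ae_of_all _ fun v => ?_)
  rw [norm_mul, norm_cpow_neg_line hy]

end AFEKernel

namespace LDatum

variable {d : ℕ} {F : LDatum d} {q : ℕ} {χ : DirichletCharacter ℂ q}

/-- Together with the functional equation, this symmetry turns the integral over `Re s = -2` into the
complex conjugate of the one over `Re s = 2`. -/
theorem conj_afePoly (μ : Fin d → ℂ) (s : ℂ) :
    starRingEnd ℂ (afePoly μ (-starRingEnd ℂ s)) = afePoly μ s := by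
  unfold afePoly
  rw [map_prod]
  refine Finset.prod_congr rfl fun j _ => ?_
  simp only [map_mul, map_add, map_sub, map_neg, Complex.conj_conj, map_div₀, map_one,
    Complex.conj_ofNat]
  ring

/-- Shifting the line of integration in `∫ Λ(1/2 + s) P(s) e^{s²} ds / s` and applying the
functional equation. -/
theorem norm_completedL_half_le (hF : F.IsStandard) (hq : 2 ≤ q) (hχ : χ.IsPrimitive) :
    Real.pi * ‖F.completedL χ (1 / 2) * afePoly (F.mu χ) 0‖ ≤
      ‖∫ v : ℝ, F.completedSeries χ (1 / 2 + (((2 : ℝ) : ℂ) + v * Complex.I)) *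
        (afePoly (F.mu χ) (((2 : ℝ) : ℂ) + v * Complex.I) *
          Complex.exp ((((2 : ℝ) : ℂ) + v * Complex.I) ^ 2)) /
            (((2 : ℝ) : ℂ) + v * Complex.I)‖ := by
  have hN := hF.conductor_pos q hq
  obtain ⟨C₁, hC₁0, hC₁⟩ := exists_norm_completedL_le hF
  obtain ⟨C₂, hC₂0, hC₂⟩ := exists_norm_afePoly_le (F.mu χ) 2 (by norm_num)
  obtain ⟨κ, hκ, hfe⟩ := exists_completedL_eq_conj hF hq hχ
  set f : ℂ → ℂ := fun s => F.completedL χ (1 / 2 + s) *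
    (afePoly (F.mu χ) s * Complex.exp (s ^ 2)) with hf
  have hf0 : f 0 = F.completedL χ (1 / 2) * afePoly (F.mu χ) 0 := by simp [hf]
  have hfd : Differentiable ℂ f := by
    have h1 : Differentiable ℂ fun s : ℂ => F.completedL χ (1 / 2 + s) :=
      (differentiable_completedL hF hq hχ).comp (by fun_prop)
    have h2 : Differentiable ℂ (afePoly (F.mu χ)) := by
      unfold afePoly
      exact Differentiable.fun_finsetProd fun j _ => by fun_prop
    exact h1.mul (h2.mul (by fun_prop))
  set C : ℝ := C₁ * F.N q ^ (3 / 2 : ℝ) * C₂ with hCdef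
  have hC0 : 0 ≤ C := by positivity
  have hfb : ∀ σ v : ℝ, |σ| ≤ 2 → ‖f (σ + v * Complex.I)‖ ≤ C * Real.exp (-(1 / 2) * v ^ 2) := by
    intro σ v hσ
    have h1 := hC₁ q hq χ hχ (1 / 2 + (σ + v * Complex.I))
      (by simp; linarith [(abs_le.1 hσ).1]) (by simp; linarith [(abs_le.1 hσ).2])
    have h2 := hC₂ σ v hσ
    simp only [hf]
    rw [norm_mul, hCdef, mul_assoc _ C₂]
    gcongr
  -- subtracting a multiple of `e^{s²}` removes the pole at the origin
  set g : ℂ → ℂ := fun s => f s - f 0 * Complex.exp (s ^ 2) with hg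
  have hg0 : g 0 = 0 := by simp [hg]
  have hgd : Differentiable ℂ g := hfd.sub (by fun_prop)
  have hDd : DifferentiableOn ℂ (dslope g 0) Set.univ :=
    (Complex.differentiableOn_dslope univ_mem).2 hgd.differentiableOn
  have hDv : ∀ s : ℂ, s ≠ 0 → dslope g 0 s = f s / s - f 0 * (Complex.exp (s ^ 2) / s) := by
    intro s hs
    rw [dslope_of_ne _ hs, slope_def_field, hg0]
    simp only [hg]
    field_simp
    ring
  have hexp : ∀ σ v : ℝ, |σ| ≤ 2 → ‖Complex.exp ((σ + v * Complex.I) ^ 2)‖ ≤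
      Real.exp 4 * Real.exp (-(1 / 2) * v ^ 2) := by
    intro σ v hσ
    rw [norm_exp_sq, ← Real.exp_add]
    apply Real.exp_le_exp.2
    have h1 : σ ^ 2 ≤ 2 ^ 2 := by rw [← sq_abs σ]; gcongr
    nlinarith [sq_nonneg v]
  have hshift := integral_vertical_eq (f := dslope g 0) (a := -2) (b := 2)
    (C := C + ‖f 0‖ * Real.exp 4) (by norm_num) (hDd.mono (Set.subset_univ _)) (by
      intro σ hσ v hv
      have hσ' : |σ| ≤ 2 := abs_le.2 hσ
      have hne : (σ + v * Complex.I : ℂ) ≠ 0 := by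
        intro h
        have := congrArg Complex.im h
        simp at this
        rw [this] at hv
        norm_num at hv
      have hn1 : 1 ≤ ‖(σ + v * Complex.I : ℂ)‖ := by
        refine hv.trans ?_
        have := Complex.abs_im_le_norm (σ + v * Complex.I : ℂ)
        simpa using this
      rw [dslope_of_ne _ hne, slope_def_field, hg0, sub_zero, sub_zero, norm_div]
      refine (div_le_self (norm_nonneg _) hn1).trans ?_
      simp only [hg]
      refine (norm_sub_le _ _).trans ?_
      calc _ ≤ C * Real.exp (-(1 / 2) * v ^ 2) +
            ‖f 0‖ * (Real.exp 4 * Real.exp (-(1 / 2) * v ^ 2)) := by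
            refine add_le_add (hfb σ v hσ') ?_
            rw [norm_mul]
            exact mul_le_mul_of_nonneg_left (hexp σ v hσ') (norm_nonneg _)
        _ = (C + ‖f 0‖ * Real.exp 4) * Real.exp (-(1 / 2) * v ^ 2) := by ring
        _ ≤ _ := by
            gcongr
            nlinarith [sq_nonneg v])
  have hgauss : MeasureTheory.Integrable fun v : ℝ => Real.exp (-(1 / 2) * v ^ 2) :=
    integrable_exp_neg_mul_sq (by norm_num)
  have hline : ∀ c : ℝ, |c| = 2 → ∀ (h : ℂ → ℂ) (B : ℝ), Continuous h →
      (∀ v : ℝ, ‖h (c + v * Complex.I)‖ ≤ B * Real.exp (-(1 / 2) * v ^ 2)) →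
      MeasureTheory.Integrable fun v : ℝ => h (c + v * Complex.I) / (c + v * Complex.I) := by
    intro c hc h B hh hB
    have hc0 : c ≠ 0 := by rintro rfl; simp at hc
    refine (hgauss.const_mul B).mono' (Continuous.aestronglyMeasurable ?_)
      (MeasureTheory.ae_of_all _ fun v => ?_)
    · refine Continuous.div (by fun_prop) (by fun_prop) fun v => add_mul_I_ne_zero hc0 v
    · rw [norm_div]
      refine (div_le_self (norm_nonneg _) ?_).trans (hB v)
      have := Complex.abs_re_le_norm (c + v * Complex.I : ℂ)
      simp only [Complex.add_re, Complex.ofReal_re, Complex.mul_re, Complex.I_re, mul_zero,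
        Complex.ofReal_im, Complex.I_im, mul_one, sub_self, add_zero] at this
      linarith
  have hsplit : ∀ c : ℝ, |c| = 2 → ∫ v : ℝ, dslope g 0 (c + v * Complex.I) =
      (∫ v : ℝ, f (c + v * Complex.I) / (c + v * Complex.I)) -
      f 0 * ∫ v : ℝ, Complex.exp ((c + v * Complex.I) ^ 2) / (c + v * Complex.I) := by
    intro c hc
    have hc0 : c ≠ 0 := by rintro rfl; simp at hc
    rw [← MeasureTheory.integral_const_mul, ← MeasureTheory.integral_sub]
    · refine MeasureTheory.integral_congr_ae (MeasureTheory.ae_of_all _ fun v => ?_)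
      exact hDv _ (add_mul_I_ne_zero hc0 v)
    · exact hline c hc f C hfd.continuous fun v => hfb c v hc.le
    · refine (hline c hc (fun s => Complex.exp (s ^ 2)) (Real.exp 4) (by fun_prop) ?_).const_mul _
      exact fun v => hexp c v hc.le
  have hneg : ∫ v : ℝ, Complex.exp ((((-2 : ℝ) : ℂ) + v * Complex.I) ^ 2) /
      (((-2 : ℝ) : ℂ) + v * Complex.I) = -Real.pi := by
    rw [← integral_exp_sq_div (c := 2) two_pos, ← MeasureTheory.integral_neg,
      ← MeasureTheory.integral_neg_eq_self]
    refine MeasureTheory.integral_congr_ae (MeasureTheory.ae_of_all _ fun v => ?_)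
    have h1 : (((-2 : ℝ) : ℂ) + ((-v : ℝ) : ℂ) * Complex.I) =
        -(((2 : ℝ) : ℂ) + v * Complex.I) := by
      push_cast; ring
    simp only
    rw [h1, neg_sq, div_neg]
  set J : ℂ := ∫ v : ℝ, f (((2 : ℝ) : ℂ) + v * Complex.I) / (((2 : ℝ) : ℂ) + v * Complex.I) with hJ
  have hleft : ∫ v : ℝ, f (((-2 : ℝ) : ℂ) + v * Complex.I) / (((-2 : ℝ) : ℂ) + v * Complex.I) =
      -(κ * starRingEnd ℂ J) := by
    rw [hJ, ← integral_conj, ← MeasureTheory.integral_const_mul, ← MeasureTheory.integral_neg]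
    refine MeasureTheory.integral_congr_ae (MeasureTheory.ae_of_all _ fun v => ?_)
    have h1 : (((-2 : ℝ) : ℂ) + v * Complex.I) =
        -starRingEnd ℂ (((2 : ℝ) : ℂ) + v * Complex.I) := by
      simp only [map_add, map_mul, Complex.conj_ofReal, Complex.conj_I]
      push_cast
      ring
    have h2 : F.completedL χ (1 / 2 + (((-2 : ℝ) : ℂ) + v * Complex.I)) =
        κ * starRingEnd ℂ (F.completedL χ (1 / 2 + (((2 : ℝ) : ℂ) + v * Complex.I))) := by
      have h3 : 1 - starRingEnd ℂ (1 / 2 + (((-2 : ℝ) : ℂ) + v * Complex.I)) =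
          1 / 2 + (((2 : ℝ) : ℂ) + v * Complex.I) := by
        simp only [map_add, map_div₀, map_one, Complex.conj_ofNat, map_mul, Complex.conj_ofReal,
          Complex.conj_I]
        push_cast
        ring
      rw [hfe _ (by simp; norm_num), h3]
      congr 2
      rw [completedL, entireContinuation_apply]
      simp; norm_num
    have h4 : afePoly (F.mu χ) (((-2 : ℝ) : ℂ) + v * Complex.I) =
        starRingEnd ℂ (afePoly (F.mu χ) (((2 : ℝ) : ℂ) + v * Complex.I)) := by
      rw [h1, ← conj_afePoly, map_neg, Complex.conj_conj, neg_neg]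
    have h5 : Complex.exp ((((-2 : ℝ) : ℂ) + v * Complex.I) ^ 2) =
        starRingEnd ℂ (Complex.exp ((((2 : ℝ) : ℂ) + v * Complex.I) ^ 2)) := by
      rw [h1, neg_sq, ← Complex.exp_conj, map_pow]
    simp only [hf]
    rw [h2, h4, h5, h1, map_div₀, map_mul, map_mul, div_neg]
    congr 1
    ring
  -- the pole at the origin contributes `π` on either side, and the left line the conjugate of the right
  rw [hsplit (-2) (by norm_num), hsplit 2 (by norm_num), hneg, integral_exp_sq_div two_pos, hleft]
    at hshift
  have hfin : 2 * (Real.pi * f 0) = J + κ * starRingEnd ℂ J := by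
    linear_combination hshift
  have hnorm : 2 * (Real.pi * ‖f 0‖) ≤ 2 * ‖J‖ := by
    have h1 := congrArg norm hfin
    rw [norm_mul, norm_mul, Complex.norm_ofNat, Complex.norm_real,
      Real.norm_of_nonneg Real.pi_pos.le] at h1
    rw [h1]
    refine (norm_add_le _ _).trans ?_
    rw [norm_mul, hκ, Complex.norm_conj]
    linarith
  rw [← hf0]
  refine (le_of_mul_le_mul_left hnorm two_pos).trans (le_of_eq ?_)
  rw [hJ]
  congr 2
  ext v
  simp only [hf]
  rw [completedL, entireContinuation_apply]
  simp; norm_num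

end LDatum

/-! ### The approximate functional equation -/

namespace LDatum

variable {d : ℕ} {F : LDatum d} {q : ℕ} {χ : DirichletCharacter ℂ q}

variable (F χ) in
/-- The terms of the approximate functional equation for `L(1/2, F × χ)`. -/
def afeTerm (n : ℕ) : ℂ :=
  F.twistCoeff χ n * (((n : ℝ) ^ (-(1 / 2) : ℝ) : ℝ) : ℂ) * afeV (F.mu χ) (n / √(F.N q))

/-- One of the factors of `afePoly` is used to shift the argument of `Γ_ℝ` by `2`. -/
theorem archFactor_mul_afePoly (hF : F.IsStandard) {s : ℂ} (hs : 1 / 2 ≤ s.re) :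
    F.archFactor χ (1 / 2 + s) * (afePoly (F.mu χ) s * Complex.exp (s ^ 2)) / s =
      (F.N q : ℂ) ^ ((1 / 2 + s) / 2) * afeKernel (F.mu χ) s := by
  unfold archFactor afePoly afeKernel
  have h1 : ∀ j, 2 * Real.pi * Complex.Gammaℝ (s + (5 / 2 + F.mu χ j)) =
      Complex.Gammaℝ (1 / 2 + s + F.mu χ j) * (1 / 2 + s + F.mu χ j) := by
    intro j
    have hre : (1 / 2 + s + F.mu χ j).re = 1 / 2 + s.re + (F.mu χ j).re := by simp
    have hne : 1 / 2 + s + F.mu χ j ≠ 0 := by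
      intro h
      rw [h] at hre
      simp only [Complex.zero_re] at hre
      have := hF.neg_one_lt_mu χ j
      linarith
    rw [show s + (5 / 2 + F.mu χ j) = 1 / 2 + s + F.mu χ j + 2 by ring,
      Complex.Gammaℝ_add_two hne]
    have := Real.pi_ne_zero
    have : (Real.pi : ℂ) ≠ 0 := by exact_mod_cast this
    field_simp
  simp only [h1, Finset.prod_mul_distrib]
  ring

theorem term_mul_cpow (hN : 0 < F.N q) (n : ℕ) (s : ℂ) :
    LSeries.term (F.twistCoeff χ) (1 / 2 + s) n * (F.N q : ℂ) ^ ((1 / 2 + s) / 2) =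
      (F.N q : ℂ) ^ (1 / 4 : ℂ) * (F.twistCoeff χ n * (((n : ℝ) ^ (-(1 / 2) : ℝ) : ℝ) : ℂ) *
        ((n / √(F.N q) : ℝ) : ℂ) ^ (-s)) := by
  rcases Nat.eq_zero_or_pos n with rfl | hn
  · simp [twistCoeff, coeff_zero]
  have hn' : (0 : ℝ) < n := by exact_mod_cast hn
  have hNc : (F.N q : ℂ) ≠ 0 := by exact_mod_cast hN.ne'
  have hnc : (n : ℂ) ≠ 0 := by exact_mod_cast hn.ne'
  have h1 : ((n / √(F.N q) : ℝ) : ℂ) ^ (-s) = (n : ℂ) ^ (-s) * (F.N q : ℂ) ^ (s / 2) := by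
    rw [div_eq_mul_inv, Complex.ofReal_mul, Complex.mul_cpow_ofReal_nonneg hn'.le (by positivity),
      Complex.ofReal_inv, Complex.inv_cpow, ← Complex.cpow_neg, neg_neg, Complex.ofReal_natCast]
    · congr 1
      have h0 : ((√(F.N q) : ℝ) : ℂ) ≠ 0 := by exact_mod_cast (Real.sqrt_pos.2 hN).ne'
      rw [← add_halves s, Complex.cpow_add _ _ h0, ← Complex.mul_cpow_ofReal_nonneg
        (Real.sqrt_nonneg _) (Real.sqrt_nonneg _), ← Complex.ofReal_mul,
        Real.mul_self_sqrt hN.le, add_halves]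
    · rw [Complex.arg_ofReal_of_nonneg (Real.sqrt_nonneg _)]
      exact Real.pi_pos.ne
  rw [LSeries.term_of_ne_zero hn.ne', h1, Complex.ofReal_cpow hn'.le, Complex.ofReal_natCast,
    div_eq_mul_inv, ← Complex.cpow_neg, show -(1 / 2 + s) = (((-(1 / 2) : ℝ)) : ℂ) + -s by
      push_cast; ring, Complex.cpow_add _ _ hnc,
    show (1 / 2 + s) / 2 = (1 / 4 : ℂ) + s / 2 by ring, Complex.cpow_add _ _ hNc]
  ring

/-- Term by term integration of the Dirichlet series against the kernel. -/
theorem summable_and_integral_eq (hF : F.IsStandard) (hq : 2 ≤ q) (hχ : χ.IsPrimitive) :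
    Summable (F.afeTerm χ) ∧
    ∫ v : ℝ, F.completedSeries χ (1 / 2 + (((2 : ℝ) : ℂ) + v * Complex.I)) *
        (afePoly (F.mu χ) (((2 : ℝ) : ℂ) + v * Complex.I) *
          Complex.exp ((((2 : ℝ) : ℂ) + v * Complex.I) ^ 2)) /
            (((2 : ℝ) : ℂ) + v * Complex.I) =
      (F.N q : ℂ) ^ (1 / 4 : ℂ) * ∑' n, F.afeTerm χ n := by
  have hN := hF.conductor_pos q hq
  have hμ := hF.neg_one_lt_mu χ
  obtain ⟨x, hx⟩ : ∃ x : ℕ → ℂ, x = fun n => F.twistCoeff χ n *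
    (((n : ℝ) ^ (-(1 / 2) : ℝ) : ℝ) : ℂ) := ⟨_, rfl⟩
  set G : ℕ → ℝ → ℂ := fun n v => x n * (afeKernel (F.mu χ) (((2 : ℝ) : ℂ) + v * Complex.I) *
    ((n / √(F.N q) : ℝ) : ℂ) ^ (-(((2 : ℝ) : ℂ) + v * Complex.I))) with hG
  have hx0 : x 0 = 0 := by simp [hx, twistCoeff, coeff_zero]
  have hker := integrable_afeKernel_line hμ (c := 2) two_pos
  have hyp : ∀ n : ℕ, 0 < n → 0 < (n / √(F.N q) : ℝ) := fun n hn => by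
    have : (0 : ℝ) < n := by exact_mod_cast hn
    positivity
  have hGn : ∀ n v, ‖G n v‖ = ‖x n‖ * (n / √(F.N q) : ℝ) ^ (-2 : ℝ) *
      ‖afeKernel (F.mu χ) (((2 : ℝ) : ℂ) + v * Complex.I)‖ := by
    intro n v
    rcases Nat.eq_zero_or_pos n with rfl | hn
    · simp [hG, hx0]
    · simp only [hG]
      rw [norm_mul, norm_mul, norm_cpow_neg_line (hyp n hn)]
      ring
  have hGi : ∀ n, MeasureTheory.Integrable (G n) := by
    intro n
    rcases Nat.eq_zero_or_pos n with rfl | hn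
    · have : G 0 = fun _ => 0 := by ext v; simp [hG, hx0]
      rw [this]
      exact MeasureTheory.integrable_zero _ _ _
    · refine (hker.norm.const_mul (‖x n‖ * (n / √(F.N q) : ℝ) ^ (-2 : ℝ))).mono'
        (Continuous.aestronglyMeasurable ?_) (MeasureTheory.ae_of_all _ fun v => (hGn n v).le)
      refine continuous_const.mul ((continuous_afeKernel_line hμ two_pos).mul ?_)
      refine Continuous.const_cpow (by fun_prop) (Or.inl ?_)
      exact_mod_cast (hyp n hn).ne'
  have hsum : Summable fun n => ∫ v, ‖G n v‖ := by
    have h1 := (hF.twist_series_converges q hq χ hχ (5 / 2) (by norm_num)).norm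
    have h2 : ∀ n, ∫ v, ‖G n v‖ = ‖LSeries.term (F.twistCoeff χ) (5 / 2) n‖ *
        ((√(F.N q)) ^ (2 : ℝ) * ∫ v : ℝ, ‖afeKernel (F.mu χ) (((2 : ℝ) : ℂ) + v * Complex.I)‖) := by
      intro n
      simp only [hGn]
      rw [MeasureTheory.integral_const_mul, ← mul_assoc]
      congr 1
      rcases Nat.eq_zero_or_pos n with rfl | hn
      · simp [hx0]
      have hn' : (0 : ℝ) < n := by exact_mod_cast hn
      rw [LSeries.norm_term_eq, if_neg hn.ne', hx, norm_mul, Complex.norm_real,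
        Real.norm_of_nonneg (by positivity), Real.div_rpow hn'.le (Real.sqrt_nonneg _),
        Real.rpow_neg (Real.sqrt_nonneg _), Real.rpow_neg hn'.le, Real.rpow_neg hn'.le,
        show ((5 / 2 : ℂ)).re = 1 / 2 + 2 by norm_num, Real.rpow_add hn']
      field_simp
    simp only [h2]
    exact h1.mul_right _
  have key := MeasureTheory.hasSum_integral_of_summable_integral_norm hGi hsum
  have hint : ∀ n, ∫ v, G n v = F.afeTerm χ n := by
    intro n
    simp only [hG]
    rw [MeasureTheory.integral_const_mul, hx]
    rfl
  simp only [hint] at key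
  refine ⟨key.summable, ?_⟩
  rw [key.tsum_eq, ← MeasureTheory.integral_const_mul]
  congr 1
  ext v
  set s : ℂ := ((2 : ℝ) : ℂ) + v * Complex.I with hs
  have hsre : s.re = 2 := by simp [hs]
  rw [completedSeries, mul_assoc, mul_div_assoc, archFactor_mul_afePoly hF (by rw [hsre]; norm_num),
    ← mul_assoc, LSeries, ← tsum_mul_right, ← tsum_mul_right, ← tsum_mul_left]
  congr 1
  ext n
  rw [term_mul_cpow hN]
  simp only [hG, hx]
  ring

/-- The approximate functional equation, in the form of an upper bound. The sum from the dual side is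
the complex conjugate of the original one up to a factor of absolute value `1`. -/
theorem exists_norm_twistL_half_le (hF : F.IsStandard) :
    ∃ C : ℝ, 0 ≤ C ∧ ∀ q : ℕ, 2 ≤ q → ∀ χ : DirichletCharacter ℂ q, χ.IsPrimitive →
      ‖F.twistL χ (1 / 2)‖ ≤ C * ‖∑' n, F.afeTerm χ n‖ := by
  set c : (Fin d → ℂ) → ℝ := fun μ =>
    Real.pi⁻¹ * ‖∏ j, (Complex.Gammaℝ (1 / 2 + μ j))⁻¹‖ / ‖afePoly μ 0‖ with hc
  have hc0 : ∀ μ, 0 ≤ c μ := fun μ => by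
    have := Real.pi_pos
    simp only [hc]; positivity
  refine ⟨c F.muEven + c F.muOdd, add_nonneg (hc0 _) (hc0 _), fun q hq χ hχ => ?_⟩
  have hN := hF.conductor_pos q hq
  suffices h : ‖F.twistL χ (1 / 2)‖ ≤ c (F.mu χ) * ‖∑' n, F.afeTerm χ n‖ by
    refine h.trans (mul_le_mul_of_nonneg_right ?_ (norm_nonneg _))
    rcases mu_eq_or F χ with h1 | h1 <;> rw [h1] <;> linarith [hc0 F.muEven, hc0 F.muOdd]
  rw [twistL_eq hF hq hχ, archFactorInv]
  by_cases hP : afePoly (F.mu χ) 0 = 0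
  · -- some `μ_j` equals `-1/2`, and the gamma factor has a pole at the central point
    have h1 : ∃ j, F.mu χ j = -(1 / 2) := by
      rw [afePoly, Finset.prod_eq_zero_iff] at hP
      obtain ⟨j, -, hj⟩ := hP
      refine ⟨j, ?_⟩
      have h2 : 1 / 2 + F.mu χ j = 0 ∨ 1 / 2 + starRingEnd ℂ (F.mu χ j) = 0 := by
        simp only [add_zero, sub_zero, mul_eq_zero] at hj
        tauto
      rcases h2 with h2 | h2
      · linear_combination h2
      · have h3 := congrArg (starRingEnd ℂ) h2
        simp only [map_add, map_div₀, map_one, Complex.conj_ofNat, Complex.conj_conj,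
          map_zero] at h3
        linear_combination h3
    obtain ⟨j, hj⟩ := h1
    have h2 : ∏ j, (Complex.Gammaℝ (1 / 2 + F.mu χ j))⁻¹ = 0 := by
      refine Finset.prod_eq_zero (Finset.mem_univ j) ?_
      rw [hj, add_neg_cancel]
      simp [Complex.Gammaℝ_def, Complex.Gamma_zero]
    rw [h2, mul_zero, mul_zero, norm_zero]
    exact mul_nonneg (hc0 _) (norm_nonneg _)
  · have h1 := norm_completedL_half_le hF hq hχ
    rw [(summable_and_integral_eq hF hq hχ).2, norm_mul, norm_mul,
      Complex.norm_cpow_eq_rpow_re_of_pos hN] at h1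
    have hPp : 0 < ‖afePoly (F.mu χ) 0‖ := norm_pos_iff.2 hP
    have hpi := Real.pi_pos
    rw [norm_mul, norm_mul, Complex.norm_cpow_eq_rpow_re_of_pos hN]
    have e1 : (-((1 / 2 : ℂ) / 2)).re = -(1 / 4) := by norm_num
    have e2 : ((1 / 4 : ℂ)).re = 1 / 4 := by norm_num
    rw [e2] at h1
    rw [e1, Real.rpow_neg hN.le]
    have hNp : 0 < F.N q ^ (1 / 4 : ℝ) := by positivity
    set X := ‖F.completedL χ (1 / 2)‖
    set Y := ‖∏ j, (Complex.Gammaℝ (1 / 2 + F.mu χ j))⁻¹‖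
    set Z := ‖∑' n, F.afeTerm χ n‖
    have h2 : X ≤ F.N q ^ (1 / 4 : ℝ) * Z / (Real.pi * ‖afePoly (F.mu χ) 0‖) := by
      rw [le_div_iff₀ (by positivity)]
      linarith
    calc X * ((F.N q ^ (1 / 4 : ℝ))⁻¹ * Y) ≤
        (F.N q ^ (1 / 4 : ℝ) * Z / (Real.pi * ‖afePoly (F.mu χ) 0‖)) *
          ((F.N q ^ (1 / 4 : ℝ))⁻¹ * Y) := by gcongr
      _ = _ := by
        change _ = Real.pi⁻¹ * Y / ‖afePoly (F.mu χ) 0‖ * Z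
        field_simp

end LDatum

/-! ### The logarithm of the Euler product -/

/-- Comparison with `ζ(σ) ≤ 1 + 1 / (σ - 1)`. -/
theorem norm_LSeries_le_of_bounded {a : ℕ → ℂ} {D : ℝ} (ha : ∀ n, ‖a n‖ ≤ D) {s : ℂ}
    (hs : 1 < s.re) : ‖LSeries a s‖ ≤ D * (1 + 1 / (s.re - 1)) := by
  have hD : 0 ≤ D := (norm_nonneg _).trans (ha 0)
  set σ := s.re with hσ
  have h1 : Summable fun n : ℕ => 1 / ((n : ℝ) + 1) ^ σ := by
    have := (summable_nat_add_iff 1).2 (Real.summable_one_div_nat_rpow.2 hs)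
    simpa using this
  have h2 := ZetaAsymptotics.zeta_limit_aux1 hs
  have h3 : 0 ≤ ZetaAsymptotics.termTSum σ := tsum_nonneg fun n =>
    ZetaAsymptotics.term_nonneg _ _
  have h4 : ∑' n : ℕ, 1 / ((n : ℝ) + 1) ^ σ ≤ 1 + 1 / (σ - 1) := by
    have : 0 ≤ σ * ZetaAsymptotics.termTSum σ := by positivity
    linarith
  have h5 : ∀ n, ‖LSeries.term a s n‖ ≤ if n = 0 then 0 else D * (1 / (n : ℝ) ^ σ) := by
    intro n
    rw [LSeries.norm_term_eq]
    split_ifs with h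
    · exact le_rfl
    · rw [div_eq_mul_one_div]
      exact mul_le_mul_of_nonneg_right (ha n) (by positivity)
  have h6 : HasSum (fun n : ℕ => if n = 0 then 0 else D * (1 / (n : ℝ) ^ σ))
      (D * ∑' n : ℕ, 1 / ((n : ℝ) + 1) ^ σ) := by
    refine (hasSum_nat_add_iff' 1).1 ?_
    simpa using h1.hasSum.mul_left D
  rw [LSeries]
  refine (tsum_of_norm_bounded h6 h5).trans ?_
  exact mul_le_mul_of_nonneg_left h4 hD

namespace LDatum

variable {d : ℕ} {F : LDatum d} {q : ℕ} {χ : DirichletCharacter ℂ q}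

variable (F χ) in
/-- The coefficients `λ_F(p) χ(p)` at the primes. -/
def primeCoeff (n : ℕ) : ℂ := if n.Prime then F.twistCoeff χ n else 0

theorem RamanujanBound.norm_primeCoeff_le (h : F.RamanujanBound) (n : ℕ) :
    ‖F.primeCoeff χ n‖ ≤ d := by
  unfold primeCoeff
  split_ifs with hn
  · exact (norm_twistCoeff_le n).trans (h.norm_coeff_prime_le hn)
  · simp

variable (F χ) in
/-- The contribution of the higher prime powers to the logarithm of the Euler factor at `p`. -/
def localError (s : ℂ) (p : ℕ) : ℂ :=
  ∑ j, (-Complex.log (1 - F.α p j * (χ p * (p : ℂ) ^ (-s))) - F.α p j * (χ p * (p : ℂ) ^ (-s)))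

variable (F χ) in
/-- The contribution of the higher prime powers to the logarithm of the Euler product. -/
def eulerError (s : ℂ) : ℂ := ∑' p : Nat.Primes, F.localError χ s p

theorem norm_char_mul_cpow_le (p : ℕ) (hp : 0 < p) (s : ℂ) :
    ‖χ p * (p : ℂ) ^ (-s)‖ ≤ (p : ℝ) ^ (-s.re) := by
  rw [norm_mul, Complex.norm_natCast_cpow_of_pos hp, Complex.neg_re]
  exact mul_le_of_le_one_left (by positivity) (DirichletCharacter.norm_le_one χ _)

theorem two_rpow_neg_three_quarters_le : (2 : ℝ) ^ (-(3 / 4) : ℝ) ≤ 3 / 5 := by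
  rw [Real.rpow_neg (by norm_num), ← one_div, div_le_iff₀ (by positivity)]
  have h1 : ((5 / 3 : ℝ)) ≤ (2 : ℝ) ^ (3 / 4 : ℝ) := by
    have h2 : (5 / 3 : ℝ) = ((5 / 3 : ℝ) ^ (4 : ℕ)) ^ (1 / 4 : ℝ) := by
      rw [← Real.rpow_natCast, ← Real.rpow_mul (by norm_num)]; norm_num
    have h3 : (2 : ℝ) ^ (3 / 4 : ℝ) = ((2 : ℝ) ^ (3 : ℕ)) ^ (1 / 4 : ℝ) := by
      rw [← Real.rpow_natCast, ← Real.rpow_mul (by norm_num)]; norm_num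
    rw [h2, h3]
    exact Real.rpow_le_rpow (by norm_num) (by norm_num) (by norm_num)
  linarith

theorem RamanujanBound.norm_α_mul_le (h : F.RamanujanBound) {p : ℕ} (hp : p.Prime) (j : Fin d)
    {s : ℂ} (hs : 3 / 4 ≤ s.re) :
    ‖F.α p j * (χ p * (p : ℂ) ^ (-s))‖ ≤ (p : ℝ) ^ (-(3 / 4) : ℝ) := by
  have hp1 : (1 : ℝ) ≤ p := by exact_mod_cast hp.one_lt.le
  rw [norm_mul]
  calc _ ≤ 1 * (p : ℝ) ^ (-s.re) :=
        mul_le_mul (h.norm_α_le_one hp j) (norm_char_mul_cpow_le p hp.pos s) (norm_nonneg _)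
          zero_le_one
    _ ≤ _ := by
        rw [one_mul]
        exact Real.rpow_le_rpow_of_exponent_le hp1 (by linarith)

theorem rpow_neg_three_quarters_prime_le {p : ℕ} (hp : p.Prime) :
    (p : ℝ) ^ (-(3 / 4) : ℝ) ≤ 3 / 5 := by
  refine le_trans ?_ two_rpow_neg_three_quarters_le
  exact Real.rpow_le_rpow_of_nonpos two_pos (by exact_mod_cast hp.two_le) (by norm_num)

theorem RamanujanBound.norm_localError_le (h : F.RamanujanBound) {p : ℕ} (hp : p.Prime) {s : ℂ}
    (hs : 3 / 4 ≤ s.re) : ‖F.localError χ s p‖ ≤ d * (2 * (p : ℝ) ^ (-(3 / 2) : ℝ)) := by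
  have hp0 : (0 : ℝ) < p := by exact_mod_cast hp.pos
  unfold localError
  refine (norm_sum_le _ _).trans ?_
  have h1 : ∀ j ∈ (Finset.univ : Finset (Fin d)),
      ‖-Complex.log (1 - F.α p j * (χ p * (p : ℂ) ^ (-s))) - F.α p j * (χ p * (p : ℂ) ^ (-s))‖ ≤
        2 * (p : ℝ) ^ (-(3 / 2) : ℝ) := by
    intro j _
    have h2 := h.norm_α_mul_le hp j hs (χ := χ)
    set z := F.α p j * (χ p * (p : ℂ) ^ (-s))
    have h3 := h2.trans (rpow_neg_three_quarters_prime_le hp)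
    have h4 := Complex.norm_log_one_add_sub_self_le (z := -z) (by rw [norm_neg]; linarith)
    rw [norm_neg] at h4
    have h5 : -Complex.log (1 - z) - z = -(Complex.log (1 + -z) - -z) := by
      rw [← sub_eq_add_neg]; ring
    rw [h5, norm_neg]
    refine h4.trans ?_
    have h6 : (1 - ‖z‖)⁻¹ ≤ 4 := by
      rw [inv_le_comm₀ (by linarith) (by norm_num)]
      linarith
    have h7 : ‖z‖ ^ 2 ≤ (p : ℝ) ^ (-(3 / 2) : ℝ) := by
      calc ‖z‖ ^ 2 ≤ ((p : ℝ) ^ (-(3 / 4) : ℝ)) ^ 2 := by gcongr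
        _ = _ := by rw [← Real.rpow_natCast, ← Real.rpow_mul hp0.le]; norm_num
    calc ‖z‖ ^ 2 * (1 - ‖z‖)⁻¹ / 2 ≤ (p : ℝ) ^ (-(3 / 2) : ℝ) * 4 / 2 := by
          gcongr
          rw [inv_nonneg]; linarith
      _ = _ := by ring
  refine (Finset.sum_le_sum h1).trans ?_
  simp

theorem summable_primes_rpow : Summable fun p : Nat.Primes => ((p : ℕ) : ℝ) ^ (-(3 / 2) : ℝ) :=
  (Real.summable_nat_rpow.2 (by norm_num)).comp_injective Subtype.val_injective

theorem RamanujanBound.norm_eulerError_le (h : F.RamanujanBound) {s : ℂ} (hs : 3 / 4 ≤ s.re) :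
    ‖F.eulerError χ s‖ ≤ ∑' p : Nat.Primes, d * (2 * ((p : ℕ) : ℝ) ^ (-(3 / 2) : ℝ)) :=
  tsum_of_norm_bounded ((summable_primes_rpow.mul_left 2).mul_left (d : ℝ)).hasSum
    fun p => h.norm_localError_le p.2 hs

theorem RamanujanBound.differentiableOn_eulerError (h : F.RamanujanBound) :
    DifferentiableOn ℂ (F.eulerError χ) {s | 3 / 4 < s.re} := by
  have hopen : IsOpen {s : ℂ | 3 / 4 < s.re} := isOpen_lt continuous_const Complex.continuous_re
  refine Complex.differentiableOn_tsum_of_summable_norm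
    ((summable_primes_rpow.mul_left 2).mul_left (d : ℝ)) (fun p => ?_) hopen
    fun p s hs => h.norm_localError_le p.2 (le_of_lt hs)
  have hp0 : ((p : ℕ) : ℂ) ≠ 0 := by exact_mod_cast p.2.ne_zero
  unfold localError
  refine DifferentiableOn.fun_sum fun j _ => ?_
  intro s hs
  have h1 : DifferentiableAt ℂ (fun s : ℂ => F.α p j * (χ (p : ℕ) * ((p : ℕ) : ℂ) ^ (-s))) s :=
    ((DifferentiableAt.const_cpow (by fun_prop) (Or.inl hp0)).const_mul _).const_mul _
  refine DifferentiableAt.differentiableWithinAt (((DifferentiableAt.clog (by fun_prop) ?_).neg).sub h1)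
  rw [sub_eq_add_neg]
  refine Complex.mem_slitPlane_of_norm_lt_one ?_
  rw [norm_neg]
  refine ((h.norm_α_mul_le p.2 j (le_of_lt hs)).trans (rpow_neg_three_quarters_prime_le p.2)).trans_lt ?_
  norm_num

/-- The Euler product, in logarithmic form. -/
theorem RamanujanBound.exp_eq_LSeries (h : F.RamanujanBound) {s : ℂ} (hs : 1 < s.re)
    (hsum : LSeriesSummable (F.twistCoeff χ) s) :
    Complex.exp (LSeries (F.primeCoeff χ) s + F.eulerError χ s) =
      LSeries (F.twistCoeff χ) s := by
  set f : ℕ → ℂ := LSeries.term (F.twistCoeff χ) s with hf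
  have hfe : ∀ n, n ≠ 0 → f n = F.coeff n * (χ n * (n : ℂ) ^ (-s)) := by
    intro n hn
    rw [hf, LSeries.term_of_ne_zero hn, twistCoeff, div_eq_mul_inv, ← Complex.cpow_neg, mul_assoc]
  have hf1 : f 1 = 1 := by rw [hfe 1 one_ne_zero]; simp [coeff_one]
  have hmul : ∀ {m n : ℕ}, m.Coprime n → f (m * n) = f m * f n := by
    intro m n hmn
    rcases Nat.eq_zero_or_pos m with rfl | hm
    · simp [hf]
    rcases Nat.eq_zero_or_pos n with rfl | hn
    · simp [hf]
    rw [hfe _ (mul_pos hm hn).ne', hfe _ hm.ne', hfe _ hn.ne', F.coeff_mul_of_coprime hmn,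
      Nat.cast_mul, map_mul, Nat.cast_mul, Complex.natCast_mul_natCast_cpow]
    ring
  have hprod := EulerProduct.eulerProduct_hasProd hf1 hmul hsum.norm (by simp [hf])
  have hlocal : ∀ p : Nat.Primes, Complex.exp (F.coeff p * (χ (p : ℕ) * ((p : ℕ) : ℂ) ^ (-s)) +
      F.localError χ s p) = ∑' e, f (p ^ e) := by
    intro p
    have hp := p.2
    set y := χ (p : ℕ) * ((p : ℕ) : ℂ) ^ (-s) with hy
    have hp0 : (0 : ℝ) < (p : ℕ) := by exact_mod_cast hp.pos
    have hy1 : ‖y‖ < 1 := by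
      refine (norm_char_mul_cpow_le _ hp.pos s).trans_lt ?_
      exact Real.rpow_lt_one_of_one_lt_of_neg (by exact_mod_cast hp.one_lt) (by linarith)
    have h1 : ∀ e, f (p ^ e) = F.localCoeff p e * y ^ e := by
      intro e
      rw [hfe _ (pow_pos hp.pos e).ne', F.coeff_prime_pow hp, hy, mul_pow, Nat.cast_pow, map_pow,
        Nat.cast_pow, ← Complex.cpow_nat_mul, ← Complex.natCast_cpow_natCast_mul]
    simp only [h1]
    rw [h.tsum_localCoeff hp hy1, F.coeff_prime hp, localError, Finset.sum_mul,
      ← Finset.sum_add_distrib, Complex.exp_sum]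
    refine Finset.prod_congr rfl fun j _ => ?_
    rw [add_sub_cancel, Complex.exp_neg, Complex.exp_log]
    intro h0
    have h2 : ‖F.α p j * y‖ < 1 := by
      rw [norm_mul]
      exact (mul_le_of_le_one_left (norm_nonneg _) (h.norm_α_le_one hp j)).trans_lt hy1
    rw [← sub_eq_zero.1 h0, norm_one] at h2
    exact lt_irrefl _ h2
  have hs1 : HasSum (fun p : Nat.Primes => F.coeff p * (χ (p : ℕ) * ((p : ℕ) : ℂ) ^ (-s)))
      (LSeries (F.primeCoeff χ) s) := by
    have h1 := (LSeriesSummable_of_bounded_of_one_lt_re (f := F.primeCoeff χ)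
      (fun n _ => h.norm_primeCoeff_le n) hs).hasSum
    have h2 := (hasSum_subtype_iff_of_support_subset (s := {p | Nat.Prime p}) (f :=
      LSeries.term (F.primeCoeff χ) s) (fun n hn => by
        by_contra hc
        refine hn ?_
        rw [LSeries.term]
        split_ifs
        · rfl
        · rw [primeCoeff, if_neg (show ¬ n.Prime from hc), zero_div])).2 h1
    have h3 : (fun p : Nat.Primes => F.coeff p * (χ (p : ℕ) * ((p : ℕ) : ℂ) ^ (-s))) =
        LSeries.term (F.primeCoeff χ) s ∘ (Subtype.val : {p | Nat.Prime p} → ℕ) := by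
      funext p
      change _ = LSeries.term (F.primeCoeff χ) s (p : ℕ)
      rw [LSeries.term_of_ne_zero p.2.ne_zero, primeCoeff, if_pos p.2,
        twistCoeff, Complex.cpow_neg]
      ring
    exact h3 ▸ h2
  have hs2 : HasSum (fun p : Nat.Primes => F.localError χ s p) (F.eulerError χ s) :=
    (Summable.of_norm_bounded ((summable_primes_rpow.mul_left 2).mul_left (d : ℝ))
      fun p => h.norm_localError_le p.2 (by linarith)).hasSum
  have hexp := (hs1.add hs2).cexp
  refine hexp.unique ?_
  have h4 : (Complex.exp ∘ fun p : Nat.Primes => F.coeff p * (χ (p : ℕ) *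
      ((p : ℕ) : ℂ) ^ (-s)) + F.localError χ s p) = fun p : Nat.Primes => ∑' e, f (p ^ e) :=
    funext hlocal
  rw [h4]
  exact hprod

end LDatum

/-! ### Continuation of the sum over primes -/

namespace LDatum

variable {d : ℕ} {F : LDatum d} {q : ℕ} {χ : DirichletCharacter ℂ q}

theorem exists_norm_twistL_le_exp (hF : F.IsStandard) :
    ∃ C : ℝ, 0 ≤ C ∧ ∀ᶠ q : ℕ in atTop, ∀ χ : DirichletCharacter ℂ q, χ.IsPrimitive →
      ∀ s : ℂ, 0 ≤ s.re → s.re ≤ 3 →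
        ‖F.twistL χ s‖ ≤ Real.exp (C * (Real.log q + |s.im|)) := by
  obtain ⟨C, B, hC0, hB0, hC⟩ := exists_norm_twistL_le hF
  obtain ⟨K, hK⟩ := hF.conductor_bound
  set K' : ℝ := |K| with hK'
  set D : ℝ := Real.log (C + 1) + 3 / 2 * (Real.log (1 + K') + d) + B with hD
  have hK0 : 0 ≤ K' := abs_nonneg K
  have hl1 : 0 ≤ Real.log (C + 1) := Real.log_nonneg (by linarith)
  have hl2 : 0 ≤ Real.log (1 + K') := Real.log_nonneg (by linarith)
  refine ⟨D, by positivity, ?_⟩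
  filter_upwards [hK, eventually_ge_atTop 3] with q hq hq3 χ hχ s h0 h3
  have hqr : (3 : ℝ) ≤ q := by exact_mod_cast hq3
  have hlog : 1 ≤ Real.log q := by
    rw [Real.le_log_iff_exp_le (by linarith)]
    linarith [Real.exp_one_lt_d9]
  have hN := hF.conductor_pos q (by omega)
  have hNq : 1 + F.N q ≤ (1 + K') * (q : ℝ) ^ d := by
    have h1 := (hq χ hχ).2
    have h2 : K * (q : ℝ) ^ d ≤ K' * (q : ℝ) ^ d := by gcongr; exact le_abs_self K
    have h4 : (1 : ℝ) ≤ (q : ℝ) ^ d := one_le_pow₀ (by linarith)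
    linarith
  refine (hC q (by omega) χ hχ s h0 h3).trans ?_
  have hqd : (0 : ℝ) < (1 + K') * (q : ℝ) ^ d := by positivity
  calc C * (1 + F.N q) ^ (3 / 2 : ℝ) * Real.exp (B * |s.im|)
      ≤ (C + 1) * ((1 + K') * (q : ℝ) ^ d) ^ (3 / 2 : ℝ) * Real.exp (B * |s.im|) := by
        gcongr
        linarith
    _ = Real.exp (Real.log (C + 1) + 3 / 2 * (Real.log (1 + K') + d * Real.log q) +
          B * |s.im|) := by
        rw [Real.exp_add, Real.exp_add, Real.exp_log (by linarith), Real.rpow_def_of_pos hqd,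
          Real.log_mul (by positivity) (by positivity), Real.log_pow]
        ring_nf
    _ ≤ _ := by
        apply Real.exp_le_exp.2
        rw [hD]
        have e1 := mul_le_mul_of_nonneg_left hlog hl1
        have e2 := mul_le_mul_of_nonneg_left hlog hl2
        have e3 : 0 ≤ B * Real.log q := by positivity
        have e4 : 0 ≤ (Real.log (C + 1) + 3 / 2 * (Real.log (1 + K') + d)) * |s.im| := by positivity
        linarith

/-- If `exp ∘ h = 1` on an open connected set, then `h` is constant there. -/
theorem eq_const_of_exp_eq_one {U : Set ℂ} (hU : IsOpen U) (hc : IsPreconnected U) {h : ℂ → ℂ}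
    (hd : DifferentiableOn ℂ h U) (h1 : ∀ z ∈ U, Complex.exp (h z) = 1) :
    ∃ c, ∀ z ∈ U, h z = c := by
  refine hU.exists_is_const_of_deriv_eq_zero hc hd fun z hz => ?_
  have hdz : DifferentiableAt ℂ h z := hd.differentiableAt (hU.mem_nhds hz)
  have h2 := hdz.hasDerivAt.cexp
  have h3 : (fun w => Complex.exp (h w)) =ᶠ[𝓝 z] fun _ => 1 := by
    filter_upwards [hU.mem_nhds hz] with w hw using h1 w hw
  have h4 := h2.unique ((hasDerivAt_const z (1 : ℂ)).congr_of_eventuallyEq h3)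
  rw [h1 z hz, one_mul] at h4
  simpa using h4

/-- If `L(s, F × χ)` has no zeros in `1 - Δ < Re s`, `|Im s| < q`, then the series
`∑ λ_F(p) χ(p) p^{-s}` extends holomorphically to this region, and its extension is small. The bound
is the Borel–Carathéodory inequality for the logarithm of `L(s, F × χ)`. -/
theorem exists_extension_of_zero_free (hF : F.IsStandard) (hA : F.RamanujanBound) :
    ∃ C : ℝ, 0 ≤ C ∧ ∀ᶠ q : ℕ in atTop, ∀ χ : DirichletCharacter ℂ q, χ.IsPrimitive →
      ∀ Δ : ℝ, 0 < Δ → Δ ≤ 1 / 8 →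
      (∀ s : ℂ, 1 - Δ < s.re → |s.im| < q → F.twistL χ s ≠ 0) →
      ∃ g : ℂ → ℂ, DifferentiableOn ℂ g {s | 1 - Δ < s.re ∧ |s.im| < q} ∧
        (∀ s : ℂ, 1 < s.re → |s.im| < q → g s = LSeries (F.primeCoeff χ) s) ∧
        ∀ s : ℂ, 1 - Δ / 2 ≤ s.re → s.re ≤ 1 + Δ → |s.im| ≤ q - 1 →
          ‖g s‖ ≤ C * (Real.log q + |s.im| + 1 / Δ) := by
  obtain ⟨C, hC0, hC⟩ := exists_norm_twistL_le_exp hF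
  set B : ℝ := ∑' p : Nat.Primes, d * (2 * ((p : ℕ) : ℝ) ^ (-(3 / 2) : ℝ)) with hB
  have hB0 : 0 ≤ B := tsum_nonneg fun p => by positivity
  refine ⟨12 * C + 6 + 14 * d + 8 * B, by positivity, ?_⟩
  filter_upwards [hC, eventually_ge_atTop 3] with q hCq hq3 χ hχ Δ hΔ0 hΔ1 hzf
  have hq2 : 2 ≤ q := by omega
  have hqr : (3 : ℝ) ≤ q := by exact_mod_cast hq3
  have hlog : 1 ≤ Real.log q := by
    rw [Real.le_log_iff_exp_le (by linarith)]
    linarith [Real.exp_one_lt_d9]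
  set U : Set ℂ := {s | 1 - Δ < s.re ∧ |s.im| < q} with hUdef
  have hopen_re : ∀ a : ℝ, IsOpen {s : ℂ | a < s.re} := fun a =>
    isOpen_lt continuous_const Complex.continuous_re
  have hopen_im : IsOpen {s : ℂ | |s.im| < q} :=
    isOpen_lt Complex.continuous_im.abs continuous_const
  have hconv : ∀ a : ℝ, Convex ℝ {s : ℂ | a < s.re ∧ |s.im| < q} := by
    intro a
    have h1 : {s : ℂ | a < s.re ∧ |s.im| < q} =
        {s : ℂ | a < s.re} ∩ ({s : ℂ | -(q : ℝ) < s.im} ∩ {s : ℂ | s.im < q}) := by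
      ext s; simp [abs_lt]
    rw [h1]
    exact (convex_halfSpace_re_gt a).inter
      ((convex_halfSpace_im_gt _).inter (convex_halfSpace_im_lt _))
  have hUo : IsOpen U := (hopen_re _).inter hopen_im
  obtain ⟨G, hGd, hGe⟩ := exists_differentiableOn_log hUo (hconv _)
    ⟨2, by simp [hUdef]; exact ⟨by linarith, by linarith⟩⟩
    (differentiable_twistL hF hq2 hχ).differentiableOn fun z hz => hzf z hz.1 hz.2
  set V : Set ℂ := {s | 1 < s.re ∧ |s.im| < q} with hVdef
  have hVo : IsOpen V := (hopen_re _).inter hopen_im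
  have hVU : V ⊆ U := fun s hs => ⟨by linarith [hs.1], hs.2⟩
  have hser : DifferentiableOn ℂ (LSeries (F.primeCoeff χ)) V := by
    intro s hs
    have hab : LSeries.abscissaOfAbsConv (F.primeCoeff χ) ≤ 1 :=
      LSeries.abscissaOfAbsConv_le_one_of_isBigO_one
        (Asymptotics.isBigO_of_le' (c := d) _ fun n => by
          simpa using hA.norm_primeCoeff_le n)
    refine (LSeries_differentiableOn _ s ?_).mono_of_mem_nhdsWithin ?_
    · exact hab.trans_lt (by exact_mod_cast hs.1)
    · refine mem_nhdsWithin_of_mem_nhds ((hopen_re 1).mem_nhds hs.1 |> Filter.mem_of_superset <| ?_)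
      intro z hz
      exact hab.trans_lt (by exact_mod_cast hz)
  have herr : DifferentiableOn ℂ (F.eulerError χ) U :=
    hA.differentiableOn_eulerError.mono fun s hs => by
      have := hs.1
      simp only [Set.mem_ofPred_eq]
      linarith
  -- in `1 < Re s` the two logarithms of the `L`-function differ by a constant
  obtain ⟨c, hc⟩ := eq_const_of_exp_eq_one hVo (hconv 1).isPreconnected
    (h := fun s => G s - (LSeries (F.primeCoeff χ) s + F.eulerError χ s))
    ((hGd.mono hVU).sub (hser.add (herr.mono hVU))) (fun z hz => by
      rw [Complex.exp_sub, hGe z (hVU hz), hA.exp_eq_LSeries hz.1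
        (hF.twist_series_converges q hq2 χ hχ z hz.1), ← twistL_eq_LSeries hz.1]
      exact div_self (hzf z (hVU hz).1 hz.2))
  have hcexp : Complex.exp c = 1 := by
    have h2 : (2 : ℂ) ∈ V := by simp [hVdef]; linarith
    rw [← hc 2 h2, Complex.exp_sub, hGe 2 (hVU h2), hA.exp_eq_LSeries h2.1
        (hF.twist_series_converges q hq2 χ hχ 2 h2.1), ← twistL_eq_LSeries h2.1]
    exact div_self (hzf 2 (hVU h2).1 h2.2)
  refine ⟨fun s => G s - c - F.eulerError χ s, (hGd.sub (differentiableOn_const c)).sub herr,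
    fun s hs1 hs2 => ?_, fun s hs1 hs2 hs3 => ?_⟩
  · have := hc s ⟨hs1, hs2⟩
    rw [← this]
    ring
  · have herrs : ‖F.eulerError χ s‖ ≤ B := hA.norm_eulerError_le (by linarith)
    -- Borel–Carathéodory on the disc of radius `2Δ` around a point on the line `Re z = 1 + Δ`
    set z₀ : ℂ := ((1 + Δ : ℝ) : ℂ) + s.im * Complex.I with hz₀
    have hz₀re : z₀.re = 1 + Δ := by simp [hz₀]
    have hz₀im : z₀.im = s.im := by simp [hz₀]
    have hz₀V : z₀ ∈ V := ⟨by rw [hz₀re]; linarith, by rw [hz₀im]; linarith⟩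
    have hz₀val : ‖G z₀ - c‖ ≤ d * (1 + 1 / Δ) + B := by
      have h1 : G z₀ - c = LSeries (F.primeCoeff χ) z₀ + F.eulerError χ z₀ := by
        have := hc z₀ hz₀V
        rw [← this]; ring
      rw [h1]
      refine (norm_add_le _ _).trans (add_le_add ?_ (hA.norm_eulerError_le (by rw [hz₀re]; linarith)))
      have h2 := norm_LSeries_le_of_bounded (a := F.primeCoeff χ) (s := z₀)
        (fun n => hA.norm_primeCoeff_le n) hz₀V.1
      rwa [hz₀re, add_sub_cancel_left] at h2
    set M : ℝ := C * (Real.log q + |s.im| + 1) + 1 with hM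
    have hM0 : 0 < M := by
      have : 0 ≤ C * (Real.log q + |s.im| + 1) := by positivity
      linarith
    set f : ℂ → ℂ := fun z => G (z₀ + z) - c with hf
    have hball : ∀ z ∈ Metric.ball (0 : ℂ) (2 * Δ), z₀ + z ∈ U ∧ (z₀ + z).re ≤ 3 ∧
        |(z₀ + z).im| ≤ |s.im| + 1 := by
      intro z hz
      rw [mem_ball_zero_iff] at hz
      have h1 := abs_le.1 (Complex.abs_re_le_norm z)
      have h2 := Complex.abs_im_le_norm z
      have h3 : |(z₀ + z).im| ≤ |s.im| + ‖z‖ := by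
        rw [Complex.add_im, hz₀im]
        exact (abs_add_le _ _).trans (by linarith)
      have h4 : (z₀ + z).re = 1 + Δ + z.re := by rw [Complex.add_re, hz₀re]
      exact ⟨⟨by rw [h4]; linarith, by linarith⟩, by rw [h4]; linarith, by linarith⟩
    have hbc := Complex.borelCaratheodory (f := f) (M := M) (R := 2 * Δ) (z := s - z₀) hM0
      (by
        refine DifferentiableOn.sub ?_ (differentiableOn_const c)
        exact hGd.comp (by fun_prop) fun z hz => (hball z hz).1)
      (fun z hz => by
        obtain ⟨h1, h2, h3⟩ := hball z hz
        have h4 : ‖Complex.exp (f z)‖ = ‖F.twistL χ (z₀ + z)‖ := by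
          rw [hf]
          simp only
          rw [Complex.exp_sub, hcexp, div_one, hGe _ h1]
        rw [Complex.norm_exp] at h4
        have h5 := hCq χ hχ (z₀ + z) (by linarith [h1.1]) h2
        rw [← h4, Real.exp_le_exp] at h5
        have h6 : C * (Real.log q + |(z₀ + z).im|) ≤ C * (Real.log q + |s.im| + 1) := by
          refine mul_le_mul_of_nonneg_left ?_ hC0
          linarith
        simp only [Set.mem_ofPred_eq]
        linarith)
      (by linarith) (by
        rw [mem_ball_zero_iff]
        have h1 : s - z₀ = ((s.re - (1 + Δ) : ℝ) : ℂ) := by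
          apply Complex.ext <;> simp [hz₀re, hz₀im]
        rw [h1, Complex.norm_real, Real.norm_eq_abs, abs_lt]
        constructor <;> linarith)
    have hnz : ‖s - z₀‖ ≤ 3 / 2 * Δ := by
      have h1 : s - z₀ = ((s.re - (1 + Δ) : ℝ) : ℂ) := by
        apply Complex.ext <;> simp [hz₀re, hz₀im]
      rw [h1, Complex.norm_real, Real.norm_eq_abs, abs_le]
      constructor <;> linarith
    set r := ‖s - z₀‖
    have hr0 : 0 ≤ r := norm_nonneg _
    have hf0 : ‖f 0‖ ≤ d * (1 + 1 / Δ) + B := by simpa [hf] using hz₀val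
    have hfs : f (s - z₀) = G s - c := by simp [hf]
    rw [hfs] at hbc
    have hden : 0 < 2 * Δ - r := by linarith
    have b1 : 2 * M * r / (2 * Δ - r) ≤ 6 * M := by
      rw [div_le_iff₀ hden]
      nlinarith
    have b2 : ‖f 0‖ * (2 * Δ + r) / (2 * Δ - r) ≤ 7 * ‖f 0‖ := by
      rw [div_le_iff₀ hden]
      nlinarith [norm_nonneg (f 0)]
    have hDi : 8 ≤ 1 / Δ := by rw [le_div_iff₀ hΔ0]; linarith
    have key : ‖G s - c - F.eulerError χ s‖ ≤ 6 * M + 7 * (d * (1 + 1 / Δ) + B) + B := by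
      refine (norm_sub_le _ _).trans ?_
      linarith
    refine key.trans ?_
    rw [hM]
    set X := 1 / Δ
    set Lq := Real.log q
    set v := |s.im| with hv
    have hv0 : 0 ≤ v := abs_nonneg _
    have e1 : 0 ≤ C * (Lq + v + 2 * X - 1) := mul_nonneg hC0 (by linarith)
    have e2 : 0 ≤ (d : ℝ) * (2 * Lq + 2 * v + X - 1) := mul_nonneg (by positivity) (by linarith)
    have e3 : 0 ≤ B * (Lq + v + X - 1) := mul_nonneg hB0 (by linarith)
    linarith

end LDatum

/-! ### A truncated Perron formula with a trapezoidal weight -/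

theorem norm_integral_sub_intervalIntegral_le {f : ℝ → ℂ} (hf : MeasureTheory.Integrable f)
    {B T : ℝ} (hT : 0 < T) (hB : ∀ v : ℝ, T ≤ |v| → ‖f v‖ ≤ B * |v| ^ (-2 : ℝ)) :
    ‖(∫ v, f v) - ∫ v in (-T)..T, f v‖ ≤ 2 * (B / T) := by
  have h1 : ∀ g : ℝ → ℂ, (∀ v : ℝ, T ≤ v → ‖g v‖ ≤ B * v ^ (-2 : ℝ)) →
      ‖∫ v in Set.Ioi T, g v‖ ≤ B / T := by
    intro g hg
    have h2 : MeasureTheory.Integrable (fun v : ℝ => B * v ^ (-2 : ℝ))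
        (MeasureTheory.volume.restrict (Set.Ioi T)) :=
      (integrableOn_Ioi_rpow_of_lt (a := -2) (by norm_num) hT).const_mul B
    refine (MeasureTheory.norm_integral_le_of_norm_le h2 ?_).trans (le_of_eq ?_)
    · filter_upwards [MeasureTheory.ae_restrict_mem measurableSet_Ioi] with v hv
      exact hg v (le_of_lt hv)
    · rw [MeasureTheory.integral_const_mul, integral_Ioi_rpow_of_lt (by norm_num) hT,
        show (-2 + 1 : ℝ) = -1 by norm_num, Real.rpow_neg_one]
      field_simp
  have e1 := intervalIntegral.integral_Iic_add_Ioi (b := T) hf.integrableOn hf.integrableOn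
  have e2 := intervalIntegral.integral_Iic_sub_Iic (a := -T) (b := T) hf.integrableOn
    hf.integrableOn
  have e3 : (∫ v, f v) - ∫ v in (-T)..T, f v =
      (∫ v in Set.Ioi T, f (-v)) + ∫ v in Set.Ioi T, f v := by
    rw [integral_comp_neg_Ioi, ← e1, ← e2]; ring
  rw [e3]
  refine (norm_add_le _ _).trans ?_
  have h3 := h1 f fun v hv => by
    have := hB v (hv.trans (le_abs_self v))
    rwa [abs_of_pos (hT.trans_le hv)] at this
  have h4 := h1 (fun v => f (-v)) fun v hv => by
    have := hB (-v) (by rw [abs_neg]; exact hv.trans (le_abs_self v))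
    rwa [abs_neg, abs_of_pos (hT.trans_le hv)] at this
  linarith

/-- The continuous piecewise linear function that vanishes outside `[a, b + h]`, is equal to `1`
on `[a + h, b]` and is linear in between. -/
def trapezoid (a b h u : ℝ) : ℝ :=
  (max (b + h - u) 0 - max (b - u) 0 - max (a + h - u) 0 + max (a - u) 0) / h

/-- The entire function whose values away from the origin are
`(e^{(b + h) w} - e^{b w} - e^{(a + h) w} + e^{a w}) / (h w²)`. -/
def trapezoidKernel (a b h : ℝ) (w : ℂ) : ℂ :=
  (h : ℂ)⁻¹ * (dslope (fun w : ℂ => Complex.exp (h * w) - 1) 0 w *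
    dslope (fun w : ℂ => Complex.exp (b * w) - Complex.exp (a * w)) 0 w)

variable {a b h : ℝ}

theorem trapezoid_mem_Icc (hh : 0 < h) (hab : a + h ≤ b) (u : ℝ) :
    0 ≤ trapezoid a b h u ∧ trapezoid a b h u ≤ 1 := by
  unfold trapezoid
  rw [le_div_iff₀ hh, div_le_iff₀ hh, zero_mul, one_mul]
  rcases le_total (b + h - u) 0 with h1 | h1 <;> rcases le_total (b - u) 0 with h2 | h2 <;>
    rcases le_total (a + h - u) 0 with h3 | h3 <;> rcases le_total (a - u) 0 with h4 | h4 <;>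
    simp only [max_eq_left, max_eq_right, h1, h2, h3, h4] <;> constructor <;> linarith

theorem trapezoid_eq_one (hh : 0 < h) {u : ℝ} (h1 : a + h ≤ u) (h2 : u ≤ b) :
    trapezoid a b h u = 1 := by
  unfold trapezoid
  rw [max_eq_left (by linarith), max_eq_left (by linarith), max_eq_right (by linarith),
    max_eq_right (by linarith), div_eq_one_iff_eq hh.ne']
  ring

theorem trapezoid_eq_zero_of_le (hh : 0 < h) (hab : a + h ≤ b) {u : ℝ} (h1 : u ≤ a) :
    trapezoid a b h u = 0 := by
  unfold trapezoid
  rw [max_eq_left (by linarith), max_eq_left (by linarith), max_eq_left (by linarith),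
    max_eq_left (by linarith), div_eq_zero_iff]
  left; ring

theorem trapezoid_eq_zero_of_ge (hh : 0 < h) (hab : a + h ≤ b) {u : ℝ} (h1 : b + h ≤ u) :
    trapezoid a b h u = 0 := by
  unfold trapezoid
  rw [max_eq_right (by linarith), max_eq_right (by linarith), max_eq_right (by linarith),
    max_eq_right (by linarith)]
  simp

theorem differentiable_trapezoidKernel : Differentiable ℂ (trapezoidKernel a b h) := by
  have h1 : ∀ f : ℂ → ℂ, Differentiable ℂ f → Differentiable ℂ (dslope f 0) := fun f hf =>
    differentiableOn_univ.1
      ((Complex.differentiableOn_dslope univ_mem).2 hf.differentiableOn)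
  unfold trapezoidKernel
  exact ((h1 _ (by fun_prop)).mul (h1 _ (by fun_prop))).const_mul _

theorem trapezoidKernel_of_ne_zero {w : ℂ} (hw : w ≠ 0) :
    trapezoidKernel a b h w = (h : ℂ)⁻¹ * (Complex.exp ((b + h : ℝ) * w) / w ^ 2 -
      Complex.exp (b * w) / w ^ 2 - Complex.exp ((a + h : ℝ) * w) / w ^ 2 +
        Complex.exp (a * w) / w ^ 2) := by
  unfold trapezoidKernel
  rw [dslope_of_ne _ hw, dslope_of_ne _ hw, slope_def_field, slope_def_field]
  simp only [mul_zero, Complex.exp_zero, sub_self, sub_zero]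
  have e1 : Complex.exp ((b + h : ℝ) * w) = Complex.exp (h * w) * Complex.exp (b * w) := by
    rw [← Complex.exp_add]; push_cast; congr 1; ring
  have e2 : Complex.exp ((a + h : ℝ) * w) = Complex.exp (h * w) * Complex.exp (a * w) := by
    rw [← Complex.exp_add]; push_cast; congr 1; ring
  rw [e1, e2]
  field_simp
  ring

theorem norm_trapezoidKernel_le (hh : 0 < h) {E : ℝ} {w : ℂ} (hw : w ≠ 0)
    (hE : ∀ u : ℝ, a ≤ u → u ≤ b + h → Real.exp (u * w.re) ≤ E) (hab : a + h ≤ b) :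
    ‖trapezoidKernel a b h w‖ ≤ 4 * E / (h * ‖w‖ ^ 2) := by
  have h1 : ∀ u : ℝ, a ≤ u → u ≤ b + h → ‖Complex.exp (u * w) / w ^ 2‖ ≤ E / ‖w‖ ^ 2 := by
    intro u h1 h2
    rw [norm_div, norm_pow, Complex.norm_exp, Complex.re_ofReal_mul]
    gcongr
    exact hE u h1 h2
  rw [trapezoidKernel_of_ne_zero hw, norm_mul, norm_inv, Complex.norm_real,
    Real.norm_of_nonneg hh.le]
  have h2 := h1 (b + h) (by linarith) le_rfl
  have h3 := h1 b (by linarith) (by linarith)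
  have h4 := h1 (a + h) (by linarith) (by linarith)
  have h5 := h1 a le_rfl (by linarith)
  calc _ ≤ h⁻¹ * (E / ‖w‖ ^ 2 + E / ‖w‖ ^ 2 + E / ‖w‖ ^ 2 + E / ‖w‖ ^ 2) := by
        refine mul_le_mul_of_nonneg_left ?_ (by positivity)
        refine (norm_add_le _ _).trans (add_le_add ?_ h5)
        refine (norm_sub_le _ _).trans (add_le_add ?_ h4)
        exact (norm_sub_le _ _).trans (add_le_add h2 h3)
    _ = _ := by
        have : 0 < ‖w‖ := norm_pos_iff.2 hw
        field_simp
        ring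

theorem integrable_trapezoidKernel (hh : 0 < h) (hab : a + h ≤ b) {c : ℝ} (hc : 0 < c) :
    MeasureTheory.Integrable fun v : ℝ => trapezoidKernel a b h (c + v * Complex.I) := by
  set E : ℝ := Real.exp ((b + h) * c) with hE
  refine ((integrable_inv_sq_add_sq hc.ne').const_mul (4 * E / h)).mono'
    (Continuous.aestronglyMeasurable ?_) (MeasureTheory.ae_of_all _ fun v => ?_)
  · exact differentiable_trapezoidKernel.continuous.comp (by fun_prop)
  · refine (norm_trapezoidKernel_le hh (E := E) (add_mul_I_ne_zero hc.ne' v) ?_ hab).trans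
      (le_of_eq ?_)
    · intro u _ hu
      apply Real.exp_le_exp.2
      simp only [Complex.add_re, Complex.ofReal_re, Complex.mul_re, Complex.I_re, mul_zero,
        Complex.ofReal_im, Complex.I_im, mul_one, sub_self, add_zero]
      gcongr
    · rw [norm_add_mul_I_sq]
      rw [div_mul_eq_div_div, div_eq_mul_inv _ (c ^ 2 + v ^ 2)]

theorem integral_trapezoidKernel (hh : 0 < h) {c : ℝ} (hc : 0 < c) (y : ℝ) :
    ∫ v : ℝ, Complex.exp (-y * (c + v * Complex.I)) * trapezoidKernel a b h (c + v * Complex.I) =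
      ((2 * Real.pi * trapezoid a b h y : ℝ) : ℂ) := by
  have hint : ∀ x : ℝ, MeasureTheory.Integrable fun v : ℝ =>
      Complex.exp (x * (c + v * Complex.I)) / (c + v * Complex.I) ^ 2 := by
    intro x
    refine ((integrable_inv_sq_add_sq hc.ne').const_mul (Real.exp (x * c))).mono'
      (Continuous.aestronglyMeasurable ?_) (MeasureTheory.ae_of_all _ fun v => le_of_eq ?_)
    · exact Continuous.div (by fun_prop) (by fun_prop) fun v =>
        pow_ne_zero 2 (add_mul_I_ne_zero hc.ne' v)
    · rw [norm_div, norm_pow, norm_add_mul_I_sq, Complex.norm_exp, div_eq_mul_inv]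
      simp
  have h1 : ∀ v : ℝ, Complex.exp (-y * (c + v * Complex.I)) *
      trapezoidKernel a b h (c + v * Complex.I) = (h : ℂ)⁻¹ *
      (Complex.exp ((b + h - y : ℝ) * (c + v * Complex.I)) / (c + v * Complex.I) ^ 2 -
      Complex.exp ((b - y : ℝ) * (c + v * Complex.I)) / (c + v * Complex.I) ^ 2 -
      Complex.exp ((a + h - y : ℝ) * (c + v * Complex.I)) / (c + v * Complex.I) ^ 2 +
      Complex.exp ((a - y : ℝ) * (c + v * Complex.I)) / (c + v * Complex.I) ^ 2) := by
    intro v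
    rw [trapezoidKernel_of_ne_zero (add_mul_I_ne_zero hc.ne' v)]
    have e : ∀ x : ℝ, Complex.exp ((x - y : ℝ) * (c + v * Complex.I)) =
        Complex.exp (-y * (c + v * Complex.I)) * Complex.exp (x * (c + v * Complex.I)) := by
      intro x
      rw [← Complex.exp_add]; push_cast; congr 1; ring
    rw [e, e, e, e]
    ring
  simp only [h1]
  rw [MeasureTheory.integral_const_mul, MeasureTheory.integral_add, MeasureTheory.integral_sub,
    MeasureTheory.integral_sub, integral_exp_div_sq hc, integral_exp_div_sq hc,
    integral_exp_div_sq hc, integral_exp_div_sq hc]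
  · unfold trapezoid
    push_cast
    have : (h : ℂ) ≠ 0 := by exact_mod_cast hh.ne'
    field_simp
  · exact hint _
  · exact hint _
  · exact (hint _).sub (hint _)
  · exact hint _
  · exact ((hint _).sub (hint _)).sub (hint _)
  · exact hint _

/-- Perron's formula for the trapezoidal weight. -/
theorem tsum_term_mul_trapezoid {x : ℕ → ℂ} {D : ℝ} (hx : ∀ n, ‖x n‖ ≤ D) (hh : 0 < h)
    (hab : a + h ≤ b) {s : ℂ} (hs : s.re = 1) {c : ℝ} (hc : 0 < c) :
    ∫ v : ℝ, LSeries x (s + (c + v * Complex.I)) * trapezoidKernel a b h (c + v * Complex.I) =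
      2 * Real.pi * ∑' n : ℕ, LSeries.term x s n * (trapezoid a b h (Real.log n) : ℝ) := by
  set K : ℝ → ℂ := fun v => trapezoidKernel a b h (c + v * Complex.I) with hK
  have hKi := integrable_trapezoidKernel hh hab hc
  have hterm : ∀ (n : ℕ) (v : ℝ), LSeries.term x (s + (c + v * Complex.I)) n =
      LSeries.term x s n * Complex.exp (-(Real.log n : ℝ) * (c + v * Complex.I)) := by
    intro n v
    rcases Nat.eq_zero_or_pos n with rfl | hn
    · simp
    have hn0 : (n : ℂ) ≠ 0 := by exact_mod_cast hn.ne'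
    rw [LSeries.term_of_ne_zero hn.ne', LSeries.term_of_ne_zero hn.ne', Complex.cpow_add _ _ hn0,
      Complex.cpow_def_of_ne_zero hn0 (c + v * Complex.I), ← Complex.natCast_log,
      neg_mul, Complex.exp_neg]
    field_simp
  set G : ℕ → ℝ → ℂ := fun n v => LSeries.term x (s + (c + v * Complex.I)) n * K v with hG
  have hGn : ∀ n v, ‖G n v‖ = ‖LSeries.term x (s + c) n‖ * ‖K v‖ := by
    intro n v
    simp only [hG]
    rw [norm_mul, LSeries.norm_term_eq, LSeries.norm_term_eq]
    congr 3
    simp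
  have hGi : ∀ n, MeasureTheory.Integrable (G n) := by
    intro n
    refine (hKi.norm.const_mul ‖LSeries.term x (s + c) n‖).mono' ?_
      (MeasureTheory.ae_of_all _ fun v => (hGn n v).le)
    refine Continuous.aestronglyMeasurable ?_
    simp only [hG, hterm]
    exact (continuous_const.mul (by fun_prop)).mul
      (differentiable_trapezoidKernel.continuous.comp (by fun_prop))
  have hsum : Summable fun n => ∫ v, ‖G n v‖ := by
    simp only [hGn]
    simp only [MeasureTheory.integral_const_mul]
    refine Summable.mul_right _ ?_
    exact (LSeriesSummable_of_bounded_of_one_lt_re (f := x) (fun n _ => hx n)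
      (by simp [hs, hc])).norm
  have key := MeasureTheory.hasSum_integral_of_summable_integral_norm hGi hsum
  have h2 : ∀ n, ∫ v, G n v = 2 * Real.pi *
      (LSeries.term x s n * (trapezoid a b h (Real.log n) : ℝ)) := by
    intro n
    simp only [hG, hterm, mul_assoc]
    rw [MeasureTheory.integral_const_mul, integral_trapezoidKernel hh hc]
    push_cast
    ring
  simp only [h2] at key
  rw [← tsum_mul_left, key.tsum_eq]
  congr 1
  ext v
  simp only [hG]
  rw [tsum_mul_right]
  rfl

variable {a b h : ℝ}

/-- Moving the line of integration in Perron's formula to `Re w = -β`, between the heights `±T`,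
given a holomorphic continuation `g` of the Dirichlet series. -/
theorem norm_tsum_term_mul_trapezoid_le {x : ℕ → ℂ} {D : ℝ} (hx : ∀ n, ‖x n‖ ≤ D) (hh : 0 < h)
    (ha : 0 ≤ a) (hab : a + h ≤ b) {s : ℂ} (hs : s.re = 1) {c β T G E : ℝ} (hc : 0 < c)
    (hβ : 0 < β) (hT : 0 < T) (hE : Real.exp ((b + h) * c) ≤ E) {g : ℂ → ℂ}
    (hg : DifferentiableOn ℂ g (Set.Icc (-β) c ×ℂ Set.Icc (-T) T))
    (hgx : ∀ v : ℝ, |v| ≤ T → g (c + v * Complex.I) = LSeries x (s + (c + v * Complex.I)))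
    (hG : ∀ w : ℂ, -β ≤ w.re → w.re ≤ c → |w.im| ≤ T → ‖g w‖ ≤ G) :
    ‖∑' n : ℕ, LSeries.term x s n * (trapezoid a b h (Real.log n) : ℝ)‖ ≤
      2 * (D * (1 + 1 / c) * (4 * E / h) / T) + 2 * (G * (4 * E / (h * T ^ 2)) * (β + c)) +
        G * (4 * Real.exp (-(a * β)) / (h * β ^ 2)) * (2 * T) := by
  set K := trapezoidKernel a b h with hK
  have hD : 0 ≤ D := (norm_nonneg _).trans (hx 0)
  have hE0 : 0 < E := (Real.exp_pos _).trans_le hE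
  have hG0 : 0 ≤ G := (norm_nonneg _).trans (hG 0 (by simpa using hβ.le) (by simpa using hc.le)
    (by simpa using hT.le))
  have hKE : ∀ w : ℂ, w ≠ 0 → w.re ≤ c → ‖K w‖ ≤ 4 * E / (h * ‖w‖ ^ 2) := by
    intro w hw hwc
    refine norm_trapezoidKernel_le hh hw (fun u h1 h2 => ?_) hab
    refine le_trans (Real.exp_le_exp.2 ?_) hE
    exact (mul_le_mul_of_nonneg_left hwc (ha.trans h1)).trans
      (mul_le_mul_of_nonneg_right h2 hc.le)
  set f : ℝ → ℂ := fun v => LSeries x (s + (c + v * Complex.I)) * K (c + v * Complex.I) with hf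
  have hre : ∀ σ v : ℝ, (σ + v * Complex.I : ℂ).re = σ := by intro σ v; simp
  have him : ∀ σ v : ℝ, (σ + v * Complex.I : ℂ).im = v := by intro σ v; simp
  have hLb : ∀ v : ℝ, ‖LSeries x (s + (c + v * Complex.I))‖ ≤ D * (1 + 1 / c) := by
    intro v
    have h1 : (s + (c + v * Complex.I)).re = 1 + c := by rw [Complex.add_re, hs, hre]
    have h2 := norm_LSeries_le_of_bounded hx (s := s + (c + v * Complex.I)) (by rw [h1]; linarith)
    rwa [h1, add_sub_cancel_left] at h2
  have hfi : MeasureTheory.Integrable f := by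
    have hab1 : LSeries.abscissaOfAbsConv x ≤ 1 :=
      LSeries.abscissaOfAbsConv_le_one_of_isBigO_one
        (Asymptotics.isBigO_of_le' (c := D) _ fun n => by simpa using hx n)
    have hcont : Continuous fun v : ℝ => LSeries x (s + (c + v * Complex.I)) := by
      refine continuous_iff_continuousAt.2 fun v => ?_
      have h1 : ContinuousAt (LSeries x) (s + (c + v * Complex.I)) := by
        refine (LSeries_hasDerivAt (hab1.trans_lt ?_)).continuousAt
        rw [Complex.add_re, hs, hre]
        exact_mod_cast (by linarith : (1 : ℝ) < 1 + c)
      exact h1.comp (f := fun v : ℝ => s + (c + v * Complex.I)) (by fun_prop)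
    refine ((integrable_trapezoidKernel hh hab hc).norm.const_mul (D * (1 + 1 / c))).mono'
      (Continuous.aestronglyMeasurable ?_) (MeasureTheory.ae_of_all _ fun v => ?_)
    · exact hcont.mul (differentiable_trapezoidKernel.continuous.comp (by fun_prop))
    · simp only [hf]
      rw [norm_mul]
      exact mul_le_mul_of_nonneg_right (hLb v) (norm_nonneg _)
  have hperron := tsum_term_mul_trapezoid hx hh hab hs hc
  have htail := norm_integral_sub_intervalIntegral_le hfi (B := D * (1 + 1 / c) * (4 * E / h)) hT
    (fun v hv => by
      have hv0 : 0 < |v| := hT.trans_le hv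
      have h1 := hKE _ (add_mul_I_ne_zero hc.ne' v) (hre c v).le
      simp only [hf]
      rw [norm_mul, mul_assoc]
      refine mul_le_mul (hLb v) (h1.trans ?_) (norm_nonneg _) (by positivity)
      rw [norm_add_mul_I_sq, Real.rpow_neg hv0.le, ← div_eq_mul_inv, div_div]
      have h2 : |v| ^ (2 : ℝ) = v ^ 2 := by
        rw [Real.rpow_two, sq_abs]
      rw [h2]
      have : 0 < v ^ 2 := by rw [← sq_abs]; positivity
      gcongr
      nlinarith [sq_nonneg c])
  set H : ℂ → ℂ := fun w => g w * K w with hH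
  have hrect := Complex.integral_boundary_rect_eq_zero_of_differentiableOn H
    (((-β : ℝ) : ℂ) + (-T : ℝ) * Complex.I) ((c : ℂ) + T * Complex.I) (by
      rw [hre, hre, him, him, Set.uIcc_of_le (by linarith), Set.uIcc_of_le (by linarith)]
      exact hg.mul differentiable_trapezoidKernel.differentiableOn)
  rw [hre, hre, him, him] at hrect
  have hhor : ∀ τ : ℝ, |τ| = T → ‖∫ y : ℝ in (-β)..c, H (y + τ * Complex.I)‖ ≤
      G * (4 * E / (h * T ^ 2)) * (β + c) := by
    intro τ hτ
    have h1 := intervalIntegral.norm_integral_le_of_norm_le_const (a := -β) (b := c)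
      (f := fun y : ℝ => H (y + τ * Complex.I)) (C := G * (4 * E / (h * T ^ 2))) (by
        intro y hy
        rw [Set.uIoc_of_le (by linarith)] at hy
        have hne : (y + τ * Complex.I : ℂ) ≠ 0 := by
          intro h0
          have := congrArg Complex.im h0
          rw [him, Complex.zero_im] at this
          rw [this, abs_zero] at hτ
          linarith
        simp only [hH]
        rw [norm_mul]
        refine mul_le_mul (hG _ (by rw [hre]; exact hy.1.le) (by rw [hre]; exact hy.2)
          (by rw [him]; exact hτ.le)) ((hKE _ hne (by rw [hre]; exact hy.2)).trans ?_)
          (norm_nonneg _) hG0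
        rw [norm_add_mul_I_sq]
        have : T ^ 2 = τ ^ 2 := by rw [← hτ, sq_abs]
        rw [this]
        have : 0 < τ ^ 2 := by rw [← this]; positivity
        gcongr
        nlinarith [sq_nonneg y])
    rwa [show |c - -β| = β + c by rw [abs_of_pos (by linarith)]; ring] at h1
  have hleft : ‖∫ y : ℝ in (-T)..T, H (((-β : ℝ) : ℂ) + y * Complex.I)‖ ≤
      G * (4 * Real.exp (-(a * β)) / (h * β ^ 2)) * (2 * T) := by
    have h1 := intervalIntegral.norm_integral_le_of_norm_le_const (a := -T) (b := T)
      (f := fun y : ℝ => H (((-β : ℝ) : ℂ) + y * Complex.I))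
      (C := G * (4 * Real.exp (-(a * β)) / (h * β ^ 2))) (by
        intro y hy
        rw [Set.uIoc_of_le (by linarith)] at hy
        have hne : (((-β : ℝ) : ℂ) + y * Complex.I : ℂ) ≠ 0 :=
          add_mul_I_ne_zero (by linarith) y
        simp only [hH]
        rw [norm_mul]
        refine mul_le_mul (hG _ (by rw [hre]) (by rw [hre]; linarith)
          (by rw [him]; exact abs_le.2 ⟨hy.1.le, hy.2⟩))
          ((norm_trapezoidKernel_le hh hne (E := Real.exp (-(a * β))) ?_ hab).trans ?_)
          (norm_nonneg _) hG0
        · intro u hu _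
          rw [hre]
          apply Real.exp_le_exp.2
          nlinarith
        · rw [norm_add_mul_I_sq]
          gcongr
          nlinarith [sq_nonneg y])
    rwa [show |T - -T| = 2 * T by rw [abs_of_pos (by linarith)]; ring] at h1
  have hmid : ∫ v in (-T)..T, f v = ∫ y : ℝ in (-T)..T, H (c + y * Complex.I) := by
    refine intervalIntegral.integral_congr fun v hv => ?_
    rw [Set.uIcc_of_le (by linarith)] at hv
    simp only [hf, hH]
    rw [hgx v (abs_le.2 hv)]
  have hmidn : ‖∫ v in (-T)..T, f v‖ ≤ 2 * (G * (4 * E / (h * T ^ 2)) * (β + c)) +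
      G * (4 * Real.exp (-(a * β)) / (h * β ^ 2)) * (2 * T) := by
    rw [hmid]
    have h1 := hhor (-T) (by rw [abs_neg, abs_of_pos hT])
    have h2 := hhor T (abs_of_pos hT)
    set A₁ := ∫ y : ℝ in (-β)..c, H (y + (-T : ℝ) * Complex.I)
    set A₂ := ∫ y : ℝ in (-β)..c, H (y + T * Complex.I)
    set A₃ := ∫ y : ℝ in (-T)..T, H (((-β : ℝ) : ℂ) + y * Complex.I)
    set A₄ := ∫ y : ℝ in (-T)..T, H (c + y * Complex.I)
    have h3 : A₄ = Complex.I * (A₁ - A₂) + A₃ := by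
      simp only [smul_eq_mul] at hrect
      linear_combination (-Complex.I) * hrect + (A₄ - A₃) * Complex.I_sq
    rw [h3]
    refine (norm_add_le _ _).trans ?_
    rw [norm_mul, Complex.norm_I, one_mul]
    have := norm_sub_le A₁ A₂
    linarith
  have htot : ‖∫ v, f v‖ ≤ 2 * (D * (1 + 1 / c) * (4 * E / h) / T) +
      2 * (G * (4 * E / (h * T ^ 2)) * (β + c)) +
        G * (4 * Real.exp (-(a * β)) / (h * β ^ 2)) * (2 * T) := by
    have h1 := norm_add_le ((∫ v, f v) - ∫ v in (-T)..T, f v) (∫ v in (-T)..T, f v)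
    rw [sub_add_cancel] at h1
    linarith
  refine le_trans ?_ htot
  rw [hperron, norm_mul, norm_mul, Complex.norm_real, Complex.norm_ofNat,
    Real.norm_of_nonneg Real.pi_pos.le]
  have h1 : 1 ≤ 2 * Real.pi := by linarith [Real.pi_gt_three]
  exact le_mul_of_one_le_left (norm_nonneg _) h1

/-- The integers in a short multiplicative interval `(e^u, e^{u + h})`. -/
theorem sum_inv_filter_log_le {u : ℝ} (hh : 0 < h) (hh1 : h ≤ 1) (R : ℕ) :
    ∑ n ∈ (Finset.Icc 1 R).filter (fun n : ℕ => u < Real.log n ∧ Real.log n < u + h),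
      (n : ℝ)⁻¹ ≤ 2 * h + Real.exp (-u) := by
  set S := (Finset.Icc 1 R).filter (fun n : ℕ => u < Real.log n ∧ Real.log n < u + h) with hS
  have hmem : ∀ n ∈ S, Real.exp u < n ∧ (n : ℝ) < Real.exp (u + h) := by
    intro n hn
    rw [hS, Finset.mem_filter, Finset.mem_Icc] at hn
    have hn0 : (0 : ℝ) < n := by exact_mod_cast hn.1.1
    exact ⟨(Real.lt_log_iff_exp_lt hn0).1 hn.2.1, (Real.log_lt_iff_lt_exp hn0).1 hn.2.2⟩
  have hsub : S ⊆ Finset.Ioc ⌊Real.exp u⌋₊ ⌊Real.exp (u + h)⌋₊ := by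
    intro n hn
    rw [Finset.mem_Ioc]
    exact ⟨(Nat.floor_lt (Real.exp_pos _).le).2 (hmem n hn).1, Nat.le_floor (hmem n hn).2.le⟩
  have hcard : (S.card : ℝ) ≤ Real.exp u * (2 * h) + 1 := by
    have h1 : (S.card : ℝ) ≤ (⌊Real.exp (u + h)⌋₊ - ⌊Real.exp u⌋₊ : ℕ) := by
      have := Finset.card_le_card hsub
      rw [Nat.card_Ioc] at this
      exact_mod_cast this
    rw [Nat.cast_sub (Nat.floor_le_floor (Real.exp_le_exp.2 (by linarith)))] at h1
    have h2 := Nat.floor_le (Real.exp_pos (u + h)).le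
    have h3 := Nat.lt_floor_add_one (Real.exp u)
    have h4 : Real.exp (u + h) ≤ Real.exp u * (1 + 2 * h) := by
      rw [Real.exp_add]
      gcongr
      have := Real.abs_exp_sub_one_le (x := h) (by rw [abs_of_pos hh]; exact hh1)
      rw [abs_of_pos hh] at this
      linarith [le_abs_self (Real.exp h - 1)]
    linarith
  calc ∑ n ∈ S, (n : ℝ)⁻¹ ≤ ∑ n ∈ S, Real.exp (-u) := by
        refine Finset.sum_le_sum fun n hn => ?_
        rw [Real.exp_neg]
        exact inv_anti₀ (Real.exp_pos _) (hmem n hn).1.le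
    _ = S.card * Real.exp (-u) := by rw [Finset.sum_const, nsmul_eq_mul]
    _ ≤ (Real.exp u * (2 * h) + 1) * Real.exp (-u) := by gcongr
    _ = _ := by
        have : Real.exp u * Real.exp (-u) = 1 := by rw [← Real.exp_add]; simp
        linear_combination (2 * h) * this

/-- Replacing the sharp cut-off to `I` by the trapezoidal weight only affects the integers on the two
edges of the trapezoid. -/
theorem norm_sum_sub_tsum_trapezoid_le {x : ℕ → ℂ} {D : ℝ} (hx : ∀ n, ‖x n‖ ≤ D) (hh : 0 < h)
    (hh1 : h ≤ 1) (hab : a + h ≤ b) {s : ℂ} (hs : s.re = 1) {I : Finset ℕ}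
    (hI : ∀ n ∈ I, 1 ≤ n ∧ a + h ≤ Real.log n ∧ Real.log n ≤ b)
    (hI' : ∀ n : ℕ, 1 ≤ n → x n ≠ 0 → a + h ≤ Real.log n → Real.log n ≤ b → n ∈ I) :
    ‖∑ n ∈ I, LSeries.term x s n -
      ∑' n : ℕ, LSeries.term x s n * (trapezoid a b h (Real.log n) : ℝ)‖ ≤
        D * (4 * h + 2 * Real.exp (-a)) := by
  have hD : 0 ≤ D := (norm_nonneg _).trans (hx 0)
  set R : ℕ := ⌊Real.exp (b + h)⌋₊ with hR
  have hmemR : ∀ n : ℕ, 1 ≤ n → Real.log n ≤ b + h → n ∈ Finset.Icc 1 R := by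
    intro n h1 h2
    have hn0 : (0 : ℝ) < n := by exact_mod_cast h1
    exact Finset.mem_Icc.2 ⟨h1, Nat.le_floor ((Real.log_le_iff_le_exp hn0).1 h2)⟩
  have htsum : ∑' n : ℕ, LSeries.term x s n * (trapezoid a b h (Real.log n) : ℝ) =
      ∑ n ∈ Finset.Icc 1 R, LSeries.term x s n * (trapezoid a b h (Real.log n) : ℝ) := by
    refine tsum_eq_sum fun n hn => ?_
    rcases Nat.eq_zero_or_pos n with rfl | hn0
    · simp
    · have h1 : b + h ≤ Real.log n := by
        by_contra! hc
        exact hn (hmemR n hn0 hc.le)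
      rw [trapezoid_eq_zero_of_ge hh hab h1]
      simp
  classical
  have hsub : I ⊆ Finset.Icc 1 R := fun n hn =>
    hmemR n (hI n hn).1 (by linarith [(hI n hn).2.2])
  have hIsum : ∑ n ∈ I, LSeries.term x s n =
      ∑ n ∈ Finset.Icc 1 R, if n ∈ I then LSeries.term x s n else 0 := by
    rw [← Finset.sum_filter, Finset.filter_mem_eq_inter, Finset.inter_eq_right.2 hsub]
  rw [htsum, hIsum, ← Finset.sum_sub_distrib]
  refine (norm_sum_le _ _).trans ?_
  have hpt : ∀ n ∈ Finset.Icc 1 R, ‖(if n ∈ I then LSeries.term x s n else 0) -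
      LSeries.term x s n * (trapezoid a b h (Real.log n) : ℝ)‖ ≤
      (if a < Real.log n ∧ Real.log n < a + h then D * (n : ℝ)⁻¹ else 0) +
      (if b < Real.log n ∧ Real.log n < b + h then D * (n : ℝ)⁻¹ else 0) := by
    intro n hn
    rw [Finset.mem_Icc] at hn
    have hn0 : (0 : ℝ) < n := by exact_mod_cast hn.1
    have hnn : 0 ≤ D * (n : ℝ)⁻¹ := by positivity
    have hR0 : 0 ≤ (if a < Real.log n ∧ Real.log n < a + h then D * (n : ℝ)⁻¹ else 0) := by
      split_ifs <;> simp [hnn]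
    have hR1 : 0 ≤ (if b < Real.log n ∧ Real.log n < b + h then D * (n : ℝ)⁻¹ else 0) := by
      split_ifs <;> simp [hnn]
    have hterm : ‖LSeries.term x s n‖ ≤ D * (n : ℝ)⁻¹ := by
      rw [LSeries.norm_term_eq, if_neg (by omega), hs, Real.rpow_one, div_eq_mul_inv]
      exact mul_le_mul_of_nonneg_right (hx n) (by positivity)
    by_cases hnI : n ∈ I
    · rw [if_pos hnI, trapezoid_eq_one hh (hI n hnI).2.1 (hI n hnI).2.2]
      simp only [Complex.ofReal_one, mul_one, sub_self, norm_zero]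
      positivity
    by_cases hx0 : x n = 0
    · have : LSeries.term x s n = 0 := by
        rw [LSeries.term_of_ne_zero (by omega), hx0, zero_div]
      simp only [this, zero_mul, ite_self, sub_self, norm_zero]
      positivity
    rw [if_neg hnI, zero_sub, norm_neg, norm_mul, Complex.norm_real,
      Real.norm_of_nonneg (trapezoid_mem_Icc hh hab _).1]
    have hle : ‖LSeries.term x s n‖ * trapezoid a b h (Real.log n) ≤ D * (n : ℝ)⁻¹ :=
      (mul_le_of_le_one_right (norm_nonneg _) (trapezoid_mem_Icc hh hab _).2).trans hterm
    rcases le_or_gt (Real.log n) a with h1 | h1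
    · rw [trapezoid_eq_zero_of_le hh hab h1, mul_zero]
      positivity
    rcases le_or_gt (b + h) (Real.log n) with h2 | h2
    · rw [trapezoid_eq_zero_of_ge hh hab h2, mul_zero]
      positivity
    rcases lt_or_ge (Real.log n) (a + h) with h3 | h3
    · rw [if_pos ⟨h1, h3⟩]
      linarith
    rcases lt_or_ge b (Real.log n) with h4 | h4
    · rw [if_pos (show b < Real.log n ∧ Real.log n < b + h from ⟨h4, h2⟩)]
      linarith
    · exact absurd (hI' n hn.1 hx0 h3 h4) hnI
  refine (Finset.sum_le_sum hpt).trans ?_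
  rw [Finset.sum_add_distrib, ← Finset.sum_filter, ← Finset.sum_filter, ← Finset.mul_sum,
    ← Finset.mul_sum, ← mul_add]
  refine mul_le_mul_of_nonneg_left ?_ hD
  have e1 := sum_inv_filter_log_le (u := a) hh hh1 R
  have e2 := sum_inv_filter_log_le (u := b) hh hh1 R
  have e3 : Real.exp (-b) ≤ Real.exp (-a) := Real.exp_le_exp.2 (by linarith)
  linarith

/-! ### Sums over primes -/

theorem eventually_rpow_mul_exp_neg_le (k : ℝ) {κ b : ℝ} (hκ : 0 < κ) (hb : 0 < b) :
    ∀ᶠ x : ℝ in atTop, x ^ k * Real.exp (-(b * x ^ κ)) ≤ 1 := by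
  have h1 := (tendsto_rpow_mul_exp_neg_mul_atTop_nhds_zero (k / κ) b hb).comp
    (tendsto_rpow_atTop hκ)
  filter_upwards [h1.eventually (Iic_mem_nhds one_pos), eventually_gt_atTop 0] with x hx hx0
  have h2 : (x ^ κ) ^ (k / κ) = x ^ k := by
    rw [← Real.rpow_mul hx0.le, mul_div_cancel₀ _ hκ.ne']
  simpa [h2] using hx

theorem tendsto_log_natCast : Tendsto (fun q : ℕ => Real.log q) atTop atTop :=
  Real.tendsto_log_atTop.comp tendsto_natCast_atTop_atTop

/-- The primes `p` with `(log q)^(1-η) ≤ log p ≤ (log q)/100`. -/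
def primeRange (η : ℝ) (q : ℕ) : Finset ℕ :=
  (Finset.Icc ⌈Real.exp (Real.log q ^ (1 - η))⌉₊ ⌊Real.exp (Real.log q / 100)⌋₊).filter Nat.Prime

theorem mem_primeRange {η : ℝ} {q p : ℕ} : p ∈ primeRange η q ↔
    p.Prime ∧ Real.log q ^ (1 - η) ≤ Real.log p ∧ Real.log p ≤ Real.log q / 100 := by
  rw [primeRange, Finset.mem_filter, Finset.mem_Icc, and_comm]
  refine and_congr_right fun hp => ?_
  have hp0 : (0 : ℝ) < p := by exact_mod_cast hp.pos
  rw [Nat.ceil_le, Nat.le_floor_iff (Real.exp_pos _).le, Real.le_log_iff_exp_le hp0,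
    Real.log_le_iff_le_exp hp0]

/-- The three parts of the shifted contour, for the heights `±L ^ 10`. -/
theorem contour_bound {D C L X Δ : ℝ} (hD : 0 ≤ D) (hC0 : 0 ≤ C) (hL : 8 ≤ L) (hΔ0 : 0 < Δ)
    (hΔ1 : Δ ≤ 1) (hΔi : 1 / Δ ≤ L) (hX : L ^ 29 * Real.exp (-(1 / 2 * (X * Δ))) ≤ 1) :
    2 * (D * (1 + 1 / L⁻¹) * (4 * 3 / (L ^ 4)⁻¹) / L ^ 10) +
      2 * (4 * C * L ^ 10 * (4 * 3 / ((L ^ 4)⁻¹ * (L ^ 10) ^ 2)) * (Δ / 2 + L⁻¹)) +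
      4 * C * L ^ 10 * (4 * Real.exp (-((X - (L ^ 4)⁻¹) * (Δ / 2))) /
        ((L ^ 4)⁻¹ * (Δ / 2) ^ 2)) * (2 * L ^ 10) ≤
      (48 * D + 192 * C + 128 * C * Real.exp 1) / L ^ 3 := by
  have hL0 : 0 < L := by linarith
  have hL3 : 0 < L ^ 3 := by positivity
  have hLi : L⁻¹ ≤ 1 := inv_le_one_of_one_le₀ (by linarith)
  have b1 : 2 * (D * (1 + 1 / L⁻¹) * (4 * 3 / (L ^ 4)⁻¹) / L ^ 10) ≤ 48 * D / L ^ 3 := by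
    have e2 : (1 + L) / L ^ 3 ≤ 2 := by
      rw [div_le_iff₀ hL3]
      have : L ≤ L ^ 3 := le_self_pow₀ (by linarith) (by norm_num)
      linarith
    calc _ = 24 * D * ((1 + L) / L ^ 3) / L ^ 3 := by field_simp; ring
      _ ≤ 24 * D * 2 / L ^ 3 := by gcongr
      _ = _ := by ring
  have b2 : 2 * (4 * C * L ^ 10 * (4 * 3 / ((L ^ 4)⁻¹ * (L ^ 10) ^ 2)) * (Δ / 2 + L⁻¹)) ≤
      192 * C / L ^ 3 := by
    have e1 : Δ / 2 + L⁻¹ ≤ 2 := by linarith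
    calc _ ≤ 2 * (4 * C * L ^ 10 * (4 * 3 / ((L ^ 4)⁻¹ * (L ^ 10) ^ 2)) * 2) := by gcongr
      _ = 192 * C / L ^ 6 := by field_simp; ring
      _ ≤ _ := by
          gcongr
          · linarith
          · norm_num
  have hexp : Real.exp (-((X - (L ^ 4)⁻¹) * (Δ / 2))) ≤
      Real.exp 1 * Real.exp (-(1 / 2 * (X * Δ))) := by
    rw [← Real.exp_add]
    apply Real.exp_le_exp.2
    have e1 : -((X - (L ^ 4)⁻¹) * (Δ / 2)) = -(1 / 2 * (X * Δ)) + (L ^ 4)⁻¹ * Δ / 2 := by ring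
    have e2 : (L ^ 4)⁻¹ * Δ ≤ 1 * 1 := by
      gcongr
      exact inv_le_one_of_one_le₀ (one_le_pow₀ (by linarith))
    linarith
  have b3 : 4 * C * L ^ 10 * (4 * Real.exp (-((X - (L ^ 4)⁻¹) * (Δ / 2))) /
      ((L ^ 4)⁻¹ * (Δ / 2) ^ 2)) * (2 * L ^ 10) ≤ 128 * C * Real.exp 1 / L ^ 3 := by
    have e1 : ((L ^ 4)⁻¹ * (Δ / 2) ^ 2)⁻¹ ≤ 4 * L ^ 6 := by
      have : (Δ / 2)⁻¹ ≤ 2 * L := by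
        rw [inv_div, div_eq_mul_one_div]
        gcongr
      calc ((L ^ 4)⁻¹ * (Δ / 2) ^ 2)⁻¹ = L ^ 4 * ((Δ / 2)⁻¹) ^ 2 := by
            rw [mul_inv, inv_inv, inv_pow]
        _ ≤ L ^ 4 * (2 * L) ^ 2 := by gcongr
        _ = _ := by ring
    calc _ = 32 * C * L ^ 20 * Real.exp (-((X - (L ^ 4)⁻¹) * (Δ / 2))) *
            ((L ^ 4)⁻¹ * (Δ / 2) ^ 2)⁻¹ := by
          rw [div_eq_mul_inv]; ring
      _ ≤ 32 * C * L ^ 20 * (Real.exp 1 * Real.exp (-(1 / 2 * (X * Δ)))) * (4 * L ^ 6) := by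
          gcongr
      _ = 128 * C * Real.exp 1 * (L ^ 29 * Real.exp (-(1 / 2 * (X * Δ)))) / L ^ 3 := by
          field_simp; ring
      _ ≤ 128 * C * Real.exp 1 * 1 / L ^ 3 := by gcongr
      _ = _ := by rw [mul_one]
  refine (add_le_add (add_le_add b1 b2) b3).trans (le_of_eq ?_)
  ring

/-- The contribution of the two edges of the trapezoid. -/
theorem edge_bound {D L X : ℝ} (hD : 0 ≤ D) (hL : 8 ≤ L) (hX : L ^ 3 * Real.exp (-X) ≤ 1) :
    D * (4 * (L ^ 4)⁻¹ + 2 * Real.exp (-(X - (L ^ 4)⁻¹))) ≤ 7 * D / L ^ 3 := by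
  have hL0 : 0 < L := by linarith
  have hL3 : 0 < L ^ 3 := by positivity
  have e1 : (L ^ 4)⁻¹ ≤ (1 / 8) / L ^ 3 := by
    rw [le_div_iff₀ hL3]
    have : (L ^ 4)⁻¹ * L ^ 3 = L⁻¹ := by field_simp
    rw [this, inv_le_comm₀ hL0 (by norm_num)]
    linarith
  have e2 : Real.exp (-X) ≤ 1 / L ^ 3 := by rwa [le_div_iff₀' hL3]
  have e3 : Real.exp (-(X - (L ^ 4)⁻¹)) ≤ 3 * (1 / L ^ 3) := by
    rw [neg_sub, sub_eq_add_neg, Real.exp_add]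
    refine mul_le_mul ?_ e2 (Real.exp_pos _).le (by norm_num)
    have : (L ^ 4)⁻¹ ≤ 1 := inv_le_one_of_one_le₀ (one_le_pow₀ (by linarith))
    refine (Real.exp_le_exp.2 this).trans ?_
    linarith [Real.exp_one_lt_d9]
  calc _ ≤ D * (4 * ((1 / 8) / L ^ 3) + 2 * (3 * (1 / L ^ 3))) := by gcongr
    _ = (13 / 2) * D / L ^ 3 := by ring
    _ ≤ _ := by gcongr; norm_num

namespace LDatum

variable {d : ℕ} {F : LDatum d} {q : ℕ} {χ : DirichletCharacter ℂ q}

/-- There is a saving of a power of `log q` in the sum `∑ λ_F(p) χ(p) p^{-1-it}` over the primes of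
`primeRange η q` if `L(s, F × χ)` has no zeros close to the line `Re s = 1`: on the shifted contour
the kernel of Perron's formula has size about `exp(-(log q)^(δ - η) / 2)`. -/
theorem exists_norm_sum_primeRange_le_of_abs_le (hF : F.IsStandard) (hA : F.RamanujanBound)
    {η δ : ℝ} (hη : 0 < η) (hηδ : η < δ) (hδ : δ < 1) :
    ∃ C : ℝ, 0 ≤ C ∧ ∀ᶠ q : ℕ in atTop, ∀ χ : DirichletCharacter ℂ q, χ.IsPrimitive →
      (∀ s : ℂ, 1 - Real.log q ^ (δ - 1) < s.re → |s.im| < q → F.twistL χ s ≠ 0) →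
      ∀ t : ℝ, |t| ≤ Real.log q →
        ‖∑ p ∈ primeRange η q, LSeries.term (F.primeCoeff χ) (1 + t * Complex.I) p‖ ≤
          C / Real.log q ^ 3 := by
  obtain ⟨C, hC0, hC⟩ := exists_extension_of_zero_free hF hA
  refine ⟨55 * d + 192 * C + 128 * C * Real.exp 1, by positivity, ?_⟩
  have hlogT := tendsto_log_natCast
  have f1 := hlogT.eventually (eventually_ge_atTop 8)
  have f2 := hlogT.eventually (eventually_rpow_mul_exp_neg_le 11 (κ := 1) (b := 1) one_pos one_pos)
  have f3 := hlogT.eventually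
    (eventually_rpow_mul_exp_neg_le 29 (κ := δ - η) (b := 1 / 2) (by linarith) (by norm_num))
  have f4 := (((tendsto_rpow_neg_atTop (y := 1 - δ) (by linarith)).comp hlogT).eventually
    (Iic_mem_nhds (by norm_num : (0 : ℝ) < 1 / 8)))
  have f5 := (((tendsto_rpow_neg_atTop (y := η) hη).comp hlogT).eventually
    (Iic_mem_nhds (by norm_num : (0 : ℝ) < 1 / 100)))
  have f6 := hlogT.eventually
    (eventually_rpow_mul_exp_neg_le 3 (κ := 1 - η) (b := 1) (by linarith) one_pos)
  filter_upwards [hC, f1, f2, f3, f4, f5, f6, eventually_ge_atTop 3] with q hCq f1 f2 f3 f4 f5 f6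
    hq3 χ hχ hzf t ht
  have hq0 : (0 : ℝ) < q := by exact_mod_cast (by omega : 0 < q)
  set L := Real.log q with hL
  have hL0 : 0 < L := by linarith
  simp only [Function.comp_apply] at f4 f5
  rw [neg_sub] at f4
  set Δ := L ^ (δ - 1) with hΔ
  have hΔ0 : 0 < Δ := by positivity
  have hΔL : L⁻¹ ≤ Δ := by
    rw [← Real.rpow_neg_one]
    exact Real.rpow_le_rpow_of_exponent_le (by linarith) (by linarith)
  have hΔi : 1 / Δ ≤ L := by
    rw [div_le_iff₀ hΔ0, ← div_le_iff₀' hL0, one_div]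
    exact hΔL
  obtain ⟨g, hgd, hge, hgb⟩ := hCq χ hχ Δ hΔ0 f4 hzf
  -- the edges of the trapezoid, of length `h`, contribute `O(h)`
  set h : ℝ := (L ^ 4)⁻¹ with hh
  have hh0 : 0 < h := by positivity
  have hh1 : h ≤ 1 := inv_le_one_of_one_le₀ (one_le_pow₀ (by linarith))
  set a : ℝ := L ^ (1 - η) - h with ha
  have hu1 : 1 ≤ L ^ (1 - η) := Real.one_le_rpow (by linarith) (by linarith)
  have ha0 : 0 ≤ a := by linarith
  have hab : a + h ≤ L / 100 := by
    rw [ha, sub_add_cancel, sub_eq_add_neg, Real.rpow_add hL0, Real.rpow_one]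
    have := mul_le_mul_of_nonneg_left (Set.mem_Iic.1 f5) hL0.le
    linarith
  set s₀ : ℂ := 1 + t * Complex.I with hs₀
  have hs₀re : s₀.re = 1 := by simp [hs₀]
  have hs₀im : s₀.im = t := by simp [hs₀]
  -- the height `T` makes the truncation error `h⁻¹ L / T` negligible, and is much smaller than `q`
  set T : ℝ := L ^ 10 with hT
  have hT0 : 0 < T := by positivity
  have hqT : L + T + 1 ≤ q := by
    have e1 : Real.exp (-(1 * L ^ (1 : ℝ))) = (q : ℝ)⁻¹ := by
      rw [Real.rpow_one, one_mul, Real.exp_neg, hL, Real.exp_log hq0]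
    rw [e1, mul_inv_le_iff₀ hq0, one_mul] at f2
    have e2 : L ^ (11 : ℝ) = L ^ 11 := by exact_mod_cast Real.rpow_natCast L 11
    rw [e2] at f2
    refine le_trans ?_ f2
    have e3 : L ≤ L ^ 10 := le_self_pow₀ (by linarith) (by norm_num)
    have e4 : 1 ≤ L ^ 10 := one_le_pow₀ (by linarith)
    have e5 : L ^ 11 = L ^ 10 * L := by ring
    rw [e5, hT]
    nlinarith
  have hLT : L ≤ T := le_self_pow₀ (by linarith) (by norm_num)
  have hre : ∀ w : ℂ, (s₀ + w).re = 1 + w.re := fun w => by rw [Complex.add_re, hs₀re]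
  have him : ∀ w : ℂ, |w.im| ≤ T → |(s₀ + w).im| ≤ L + T := fun w hw => by
    rw [Complex.add_im, hs₀im]
    exact (abs_add_le _ _).trans (add_le_add ht hw)
  have hbound := norm_tsum_term_mul_trapezoid_le (x := F.primeCoeff χ) (D := d) (a := a)
    (b := L / 100) (h := h) (s := s₀) (c := L⁻¹) (β := Δ / 2) (T := T) (G := 4 * C * T) (E := 3)
    (fun n => hA.norm_primeCoeff_le n) hh0 ha0 hab hs₀re (by positivity) (by positivity) hT0 (by
      have : (L / 100 + h) * L⁻¹ ≤ 1 := by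
        rw [mul_inv_le_iff₀ hL0]; linarith
      refine (Real.exp_le_exp.2 this).trans ?_
      linarith [Real.exp_one_lt_d9])
    (g := fun w => g (s₀ + w)) (by
      refine hgd.comp (by fun_prop) fun w hw => ?_
      rw [Complex.mem_reProdIm] at hw
      refine ⟨?_, ?_⟩
      · rw [hre]; linarith [hw.1.1]
      · have := him w (abs_le.2 hw.2)
        linarith)
    (fun v hv => by
      refine hge _ ?_ ?_
      · rw [hre]; simp [hL0]
      · have := him ((L⁻¹ : ℝ) + v * Complex.I) (by simpa using hv)
        linarith)
    (fun w h1 h2 h3 => by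
      have e1 := him w h3
      refine (hgb _ (by rw [hre]; linarith) (by rw [hre]; linarith) (by linarith)).trans ?_
      rw [mul_comm 4 C, mul_assoc]
      refine mul_le_mul_of_nonneg_left ?_ hC0
      linarith)
  have hedge := norm_sum_sub_tsum_trapezoid_le (x := F.primeCoeff χ) (D := d) (a := a)
    (b := L / 100) (h := h) (s := s₀) (I := primeRange η q) (fun n => hA.norm_primeCoeff_le n)
    hh0 hh1 hab hs₀re (fun n hn => by
      have := mem_primeRange.1 hn
      exact ⟨this.1.one_lt.le, by rw [ha, sub_add_cancel]; exact this.2.1, this.2.2⟩)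
    (fun n _ hn h1 h2 => by
      refine mem_primeRange.2 ⟨?_, by rwa [ha, sub_add_cancel] at h1, h2⟩
      by_contra hp
      exact hn (by rw [primeCoeff, if_neg hp]))
  have hδη : L ^ (1 - η) * Δ = L ^ (δ - η) := by
    rw [hΔ, ← Real.rpow_add hL0]; congr 1; ring
  rw [← hδη] at f3
  have e29 : L ^ (29 : ℝ) = L ^ 29 := by exact_mod_cast Real.rpow_natCast L 29
  have e3 : L ^ (3 : ℝ) = L ^ 3 := by exact_mod_cast Real.rpow_natCast L 3
  rw [e29] at f3
  rw [e3, one_mul] at f6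
  have b := contour_bound d.cast_nonneg hC0 f1 hΔ0 (by linarith) hΔi f3
  have b4 := edge_bound (D := d) d.cast_nonneg f1 f6
  have htri := norm_add_le (∑ n ∈ primeRange η q, LSeries.term (F.primeCoeff χ) s₀ n -
      ∑' n : ℕ, LSeries.term (F.primeCoeff χ) s₀ n * (trapezoid a (L / 100) h (Real.log n) : ℝ))
    (∑' n : ℕ, LSeries.term (F.primeCoeff χ) s₀ n * (trapezoid a (L / 100) h (Real.log n) : ℝ))
  rw [sub_add_cancel] at htri
  refine htri.trans ?_
  refine (add_le_add (hedge.trans b4) (hbound.trans b)).trans (le_of_eq ?_)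
  ring

end LDatum

namespace LDatum

variable {d : ℕ} {F : LDatum d} {q : ℕ} {χ : DirichletCharacter ℂ q}

/-- The bound for the sum over primes for all `t`; the growth in `t` is absorbed by the decay of the
kernel of the approximate functional equation. -/
theorem exists_norm_sum_primeRange_le (hF : F.IsStandard) (hA : F.RamanujanBound)
    {η δ : ℝ} (hη : 0 < η) (hηδ : η < δ) (hδ : δ < 1) :
    ∃ C : ℝ, 0 ≤ C ∧ ∀ᶠ q : ℕ in atTop, ∀ χ : DirichletCharacter ℂ q, χ.IsPrimitive →
      (∀ s : ℂ, 1 - Real.log q ^ (δ - 1) < s.re → |s.im| < q → F.twistL χ s ≠ 0) →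
      ∀ t : ℝ, ‖∑ p ∈ primeRange η q, LSeries.term (F.primeCoeff χ) (1 + t * Complex.I) p‖ ≤
          C / Real.log q ^ 3 * (1 + |t|) ^ 4 := by
  obtain ⟨C, hC0, hC⟩ := exists_norm_sum_primeRange_le_of_abs_le hF hA hη hηδ hδ
  refine ⟨C + 2 * d, by positivity, ?_⟩
  filter_upwards [hC, tendsto_log_natCast.eventually (eventually_ge_atTop 1)] with q hCq hL1 χ hχ
    hzf t
  set L := Real.log q with hL
  have hL0 : 0 < L := by linarith
  have ht0 := abs_nonneg t
  rcases le_or_gt |t| L with ht | ht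
  · refine (hCq χ hχ hzf t ht).trans ?_
    have h1 : 1 ≤ (1 + |t|) ^ 4 := one_le_pow₀ (by linarith)
    have h2 : C / L ^ 3 ≤ (C + 2 * d) / L ^ 3 := by
      gcongr
      have : (0 : ℝ) ≤ d := by positivity
      linarith
    exact h2.trans (le_mul_of_one_le_right (by positivity) h1)
  · -- for large `t` the trivial bound suffices
    have h1 : ∀ p ∈ primeRange η q, ‖LSeries.term (F.primeCoeff χ) (1 + t * Complex.I) p‖ ≤
        d * (p : ℝ)⁻¹ := by
      intro p hp
      have hp0 := (mem_primeRange.1 hp).1.pos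
      rw [LSeries.norm_term_eq, if_neg hp0.ne', div_eq_mul_inv]
      have hre : (1 + t * Complex.I : ℂ).re = 1 := by simp
      rw [hre, Real.rpow_one]
      exact mul_le_mul_of_nonneg_right (hA.norm_primeCoeff_le p) (by positivity)
    have h2 : ∑ p ∈ primeRange η q, (p : ℝ)⁻¹ ≤ 2 * L := by
      calc ∑ p ∈ primeRange η q, (p : ℝ)⁻¹ ≤
          ∑ n ∈ Finset.Icc 1 ⌊Real.exp (L / 100)⌋₊, (n : ℝ)⁻¹ := by
            refine Finset.sum_le_sum_of_subset_of_nonneg (fun p hp => ?_) fun _ _ _ => by positivity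
            rw [primeRange, Finset.mem_filter, Finset.mem_Icc] at hp
            exact Finset.mem_Icc.2 ⟨hp.2.one_lt.le, hp.1.2⟩
        _ ≤ 1 + Real.log ⌊Real.exp (L / 100)⌋₊ := sum_Icc_inv_le _
        _ ≤ 1 + L / 100 := by
            have h3 : (1 : ℕ) ≤ ⌊Real.exp (L / 100)⌋₊ :=
              Nat.le_floor (by simpa using Real.one_le_exp (by positivity : 0 ≤ L / 100))
            have h4 := Nat.floor_le (Real.exp_pos (L / 100)).le
            have h5 := Real.log_le_log (by exact_mod_cast h3) h4
            rw [Real.log_exp] at h5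
            linarith
        _ ≤ 2 * L := by linarith
    calc _ ≤ ∑ p ∈ primeRange η q, d * (p : ℝ)⁻¹ :=
          (norm_sum_le _ _).trans (Finset.sum_le_sum h1)
      _ ≤ d * (2 * L) := by
          rw [← Finset.mul_sum]
          exact mul_le_mul_of_nonneg_left h2 (by positivity)
      _ = 2 * d / L ^ 3 * L ^ 4 := by field_simp
      _ ≤ (C + 2 * d) / L ^ 3 * (1 + |t|) ^ 4 := by
          gcongr
          · linarith
          · linarith

/-! ### Characters with a zero close to the line `Re s = 1` -/

theorem twistL_ne_zero_of_one_lt_re (hF : F.IsStandard) (hA : F.RamanujanBound) (hq : 2 ≤ q)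
    (hχ : χ.IsPrimitive) {s : ℂ} (hs : 1 < s.re) : F.twistL χ s ≠ 0 := by
  rw [twistL_eq_LSeries hs, ← hA.exp_eq_LSeries hs (hF.twist_series_converges q hq χ hχ s hs)]
  exact Complex.exp_ne_zero _

theorem finite_zeros (hF : F.IsStandard) (hA : F.RamanujanBound) (hq : 2 ≤ q)
    (hχ : χ.IsPrimitive) (σ T : ℝ) :
    {s : ℂ | σ ≤ s.re ∧ |s.im| ≤ T ∧ F.twistL χ s = 0}.Finite := by
  by_contra hinf
  set Z := {s : ℂ | σ ≤ s.re ∧ |s.im| ≤ T ∧ F.twistL χ s = 0} with hZ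
  have hsub : Z ⊆ Set.Icc σ 1 ×ℂ Set.Icc (-T) T := by
    intro s hs
    rw [Complex.mem_reProdIm]
    refine ⟨⟨hs.1, ?_⟩, abs_le.1 hs.2.1⟩
    by_contra! h
    exact twistL_ne_zero_of_one_lt_re hF hA hq hχ h hs.2.2
  obtain ⟨z, -, hz⟩ := Set.Infinite.exists_accPt_of_subset_isCompact hinf
    (isCompact_Icc.reProdIm isCompact_Icc) hsub
  have han : AnalyticOnNhd ℂ (F.twistL χ) Set.univ :=
    (differentiable_twistL hF hq hχ).differentiableOn.analyticOnNhd isOpen_univ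
  have hfreq : ∃ᶠ w in 𝓝[≠] z, F.twistL χ w = 0 := by
    rw [accPt_iff_frequently_nhdsNE] at hz
    exact hz.mono fun w hw => hw.2.2
  have h0 := han.eqOn_zero_of_preconnected_of_frequently_eq_zero isPreconnected_univ
    (Set.mem_univ z) hfreq
  exact twistL_ne_zero_of_one_lt_re hF hA hq hχ (s := 2) (by norm_num) (h0 (Set.mem_univ 2))

/-- The sum over the zeros that defines `zeroCount` has finitely many terms, hence is not a junk value,
and all of its terms are positive. -/
theorem one_le_zeroCount (hF : F.IsStandard) (hA : F.RamanujanBound) (hq : 2 ≤ q)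
    (hχ : χ.IsPrimitive) {σ T : ℝ} {s : ℂ} (h1 : σ ≤ s.re) (h2 : |s.im| ≤ T)
    (h3 : F.twistL χ s = 0) : 1 ≤ F.zeroCount χ σ T := by
  have hfin := finite_zeros hF hA hq hχ σ T
  have han : AnalyticOnNhd ℂ (F.twistL χ) Set.univ :=
    (differentiable_twistL hF hq hχ).differentiableOn.analyticOnNhd isOpen_univ
  have hord : 1 ≤ analyticOrderNatAt (F.twistL χ) s := by
    rw [Nat.one_le_iff_ne_zero]
    intro h0
    rcases ENat.toNat_eq_zero.1 h0 with h | h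
    · exact ((han s (Set.mem_univ s)).analyticOrderAt_ne_zero.2 h3) h
    · rw [analyticOrderAt_eq_top] at h
      have h4 := han.eqOn_zero_of_preconnected_of_eventuallyEq_zero isPreconnected_univ
        (Set.mem_univ s) h
      exact twistL_ne_zero_of_one_lt_re hF hA hq hχ (s := 2) (by norm_num) (h4 (Set.mem_univ 2))
  rw [zeroCount, finsum_mem_eq_finite_toFinset_sum _ hfin]
  refine hord.trans (Finset.single_le_sum (f := fun z => analyticOrderNatAt (F.twistL χ) z)
    (fun _ _ => Nat.zero_le _) ?_)
  rw [Set.Finite.mem_toFinset]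
  exact ⟨h1, h2, h3⟩

open Classical in
variable (F) in
/-- The primitive characters modulo `q` whose `L`-function has a zero with `1 - Δ < Re s` and
`|Im s| < q`. -/
def exceptionalChars (q : ℕ) [NeZero q] (Δ : ℝ) : Finset (DirichletCharacter ℂ q) :=
  (primitiveChars q).filter fun χ => ∃ s : ℂ, 1 - Δ < s.re ∧ |s.im| < q ∧ F.twistL χ s = 0

theorem mem_exceptionalChars [NeZero q] {Δ : ℝ} : χ ∈ F.exceptionalChars q Δ ↔
    χ ∈ primitiveChars q ∧ ∃ s : ℂ, 1 - Δ < s.re ∧ |s.im| < q ∧ F.twistL χ s = 0 := by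
  classical
  simp [exceptionalChars]

theorem mem_primitiveChars [NeZero q] : χ ∈ primitiveChars q ↔ χ.IsPrimitive := by
  simp [primitiveChars]

theorem card_exceptionalChars_le (hF : F.IsStandard) (hA : F.RamanujanBound) [NeZero q]
    (hq : 2 ≤ q) {C A K Δ : ℝ} (hZ : F.ZeroDensityBound q C A K) (h0 : 0 < Δ)
    (h1 : Δ < 1 / 2024) :
    ((F.exceptionalChars q Δ).card : ℝ) ≤ K * ((q : ℝ) ^ (C * Δ) * Real.log q ^ A) := by
  have hq1 : (1 : ℝ) ≤ q := by exact_mod_cast (by omega : 1 ≤ q)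
  have h2 := hZ (1 - Δ) q (by linarith) (by linarith) hq1 le_rfl
  rw [sub_sub_cancel] at h2
  refine le_trans ?_ h2
  calc ((F.exceptionalChars q Δ).card : ℝ) = ∑ χ ∈ F.exceptionalChars q Δ, (1 : ℝ) := by simp
    _ ≤ ∑ χ ∈ F.exceptionalChars q Δ, (F.zeroCount χ (1 - Δ) q : ℝ) := by
        refine Finset.sum_le_sum fun χ hχ => ?_
        obtain ⟨hp, s, hs1, hs2, hs3⟩ := mem_exceptionalChars.1 hχ
        exact_mod_cast one_le_zeroCount hF hA hq (mem_primitiveChars.1 hp) hs1.le hs2.le hs3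
    _ ≤ _ := Finset.sum_le_sum_of_subset_of_nonneg (fun χ hχ => (mem_exceptionalChars.1 hχ).1)
        fun _ _ _ => by positivity

/-- The exceptional characters are few, by the zero density estimate, and for each of them the
subconvexity bound is available. -/
theorem eventually_sum_exceptionalChars_le (hF : F.IsStandard) (hA : F.RamanujanBound)
    (C A K₅ K₆ η : ℝ) {δ' δ : ℝ} (hδ0 : 0 < δ) (hδ'δ : δ' < δ) (hδ1 : δ < 1) :
    ∀ᶠ q : ℕ in atTop, ∀ [NeZero q], F.ZeroDensityBound q C A K₅ → F.SubconvexityBound q δ K₆ →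
      ∑ χ ∈ F.exceptionalChars q (Real.log q ^ (δ' - 1)), ‖F.twistL χ (1 / 2)‖ ^ 2 ≤
        |K₅| * K₆ ^ 2 * ((q : ℝ) ^ ((d : ℝ) / 2) / Real.log q ^ η) := by
  have hlogT := tendsto_log_natCast
  have f1 := hlogT.eventually (eventually_ge_atTop 1)
  have f2 := hlogT.eventually
    (eventually_rpow_mul_exp_neg_le (A + η) (κ := δ) (b := 1) hδ0 one_pos)
  have f3 := (((tendsto_rpow_neg_atTop (y := 1 - δ') (by linarith)).comp hlogT).eventually
    (Iio_mem_nhds (by norm_num : (0 : ℝ) < 1 / 2024)))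
  have f4 := (((tendsto_rpow_neg_atTop (y := δ - δ') (by linarith)).comp hlogT).const_mul
    C).eventually (Iic_mem_nhds (by norm_num : C * 0 < 1))
  filter_upwards [f1, f2, f3, f4, eventually_ge_atTop 2] with q f1 f2 f3 f4 hq2 _ hZ hS
  have hq0 : (0 : ℝ) < q := by exact_mod_cast (by omega : 0 < q)
  set L := Real.log q with hL
  have hL0 : 0 < L := by linarith
  simp only [Function.comp_apply] at f3 f4
  rw [neg_sub] at f3 f4
  set Δ := L ^ (δ' - 1) with hΔ
  have hcard := card_exceptionalChars_le hF hA hq2 hZ (Δ := Δ) (by positivity) f3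
  have hpt : ∀ χ ∈ F.exceptionalChars q Δ, ‖F.twistL χ (1 / 2)‖ ^ 2 ≤
      K₆ ^ 2 * ((q : ℝ) ^ ((d : ℝ) / 2) * Real.exp (-(2 * L ^ δ))) := by
    intro χ hχ
    have h1 := hS χ (mem_exceptionalChars.1 hχ).1
    have e1 : ((q : ℝ) ^ ((d : ℝ) / 4)) ^ 2 = (q : ℝ) ^ ((d : ℝ) / 2) := by
      rw [← Real.rpow_natCast ((q : ℝ) ^ ((d : ℝ) / 4)) 2, ← Real.rpow_mul hq0.le]
      congr 1; push_cast; ring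
    have e2 : Real.exp (-(L ^ δ)) ^ 2 = Real.exp (-(2 * L ^ δ)) := by
      rw [← Real.exp_nat_mul]; congr 1; push_cast; ring
    calc ‖F.twistL χ (1 / 2)‖ ^ 2 ≤ (K₆ * ((q : ℝ) ^ ((d : ℝ) / 4) / Real.exp (L ^ δ))) ^ 2 := by
          gcongr
      _ = K₆ ^ 2 * (((q : ℝ) ^ ((d : ℝ) / 4)) ^ 2 * (Real.exp (-(L ^ δ))) ^ 2) := by
          rw [Real.exp_neg]; ring
      _ = _ := by rw [e1, e2]
  have hexp : (q : ℝ) ^ (C * Δ) * Real.exp (-(2 * L ^ δ)) ≤ Real.exp (-(1 * L ^ δ)) := by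
    rw [Real.rpow_def_of_pos hq0, ← hL, ← Real.exp_add]
    apply Real.exp_le_exp.2
    have e1 : L * Δ = L ^ δ * L ^ (δ' - δ) := by
      rw [hΔ, ← Real.rpow_add hL0]
      nth_rewrite 1 [← Real.rpow_one L]
      rw [← Real.rpow_add hL0]
      congr 1; ring
    have e2 := mul_le_mul_of_nonneg_left (Set.mem_Iic.1 f4) (by positivity : 0 ≤ L ^ δ)
    have e3 : L * (C * Δ) = L ^ δ * (C * L ^ (δ' - δ)) := by
      rw [mul_left_comm, e1]; ring
    rw [e3]
    linarith
  calc ∑ χ ∈ F.exceptionalChars q Δ, ‖F.twistL χ (1 / 2)‖ ^ 2 ≤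
        (F.exceptionalChars q Δ).card *
          (K₆ ^ 2 * ((q : ℝ) ^ ((d : ℝ) / 2) * Real.exp (-(2 * L ^ δ)))) := by
        rw [← nsmul_eq_mul]
        exact Finset.sum_le_card_nsmul _ _ _ hpt
    _ ≤ (|K₅| * ((q : ℝ) ^ (C * Δ) * L ^ A)) *
          (K₆ ^ 2 * ((q : ℝ) ^ ((d : ℝ) / 2) * Real.exp (-(2 * L ^ δ)))) := by
        gcongr
        refine hcard.trans ?_
        gcongr
        exact le_abs_self _
    _ = |K₅| * K₆ ^ 2 * ((q : ℝ) ^ ((d : ℝ) / 2) *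
          (L ^ A * ((q : ℝ) ^ (C * Δ) * Real.exp (-(2 * L ^ δ))))) := by ring
    _ ≤ |K₅| * K₆ ^ 2 * ((q : ℝ) ^ ((d : ℝ) / 2) * (L ^ A * Real.exp (-(1 * L ^ δ)))) := by
        gcongr
    _ ≤ |K₅| * K₆ ^ 2 * ((q : ℝ) ^ ((d : ℝ) / 2) * (1 / L ^ η)) := by
        gcongr
        rw [le_div_iff₀ (by positivity)]
        calc L ^ A * Real.exp (-(1 * L ^ δ)) * L ^ η =
            L ^ (A + η) * Real.exp (-(1 * L ^ δ)) := by rw [Real.rpow_add hL0]; ring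
          _ ≤ 1 := f2
    _ = _ := by ring

end LDatum

/-! ### The bilinear sums -/

section Weights

variable {d : ℕ} {μ : Fin d → ℂ}

/-- The lines `Re s = 1/20` and `Re s = 2` give the two bounds whose minimum is `afeWeight`. -/
theorem exists_norm_rpow_mul_afeV_le (hμ : ∀ j, -1 < (μ j).re) (K : ℝ) :
    ∃ C : ℝ, 0 ≤ C ∧ ∀ N Q : ℝ, 0 < N → 0 < Q → N ≤ K * Q ^ 2 → ∀ n : ℕ, 1 ≤ n →
      ‖((((n : ℝ) ^ (-(1 / 2) : ℝ) : ℝ) : ℂ) * afeV μ (n / √N))‖ ≤ C * afeWeight Q n := by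
  obtain ⟨C₁, hC₁0, hC₁⟩ := exists_norm_afeV_le hμ (c := 1 / 20) (by norm_num)
  obtain ⟨C₂, hC₂0, hC₂⟩ := exists_norm_afeV_le hμ (c := 2) (by norm_num)
  set X : ℝ := √(max K 1) with hX
  have hX1 : 1 ≤ X := by rw [hX, Real.one_le_sqrt]; exact le_max_right _ _
  have hX0 : 0 < X := by linarith
  refine ⟨(C₁ + C₂) * X ^ (2 : ℝ), by positivity, fun N Q hN hQ hNQ n hn => ?_⟩
  have hn0 : (0 : ℝ) < n := by exact_mod_cast hn
  have hM : √N ≤ X * Q := by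
    rw [Real.sqrt_le_left (by positivity), mul_pow, hX, Real.sq_sqrt (by positivity)]
    refine hNQ.trans ?_
    gcongr
    exact le_max_left _ _
  have hM0 : 0 < √N := Real.sqrt_pos.2 hN
  have hy0 : 0 < (n / √N : ℝ) := by positivity
  have key : ∀ c : ℝ, 0 ≤ c → c ≤ 2 → (n / √N : ℝ) ^ (-c) ≤ X ^ (2 : ℝ) * (Q / n) ^ c := by
    intro c hc0 hc2
    calc (n / √N : ℝ) ^ (-c) = (√N / n) ^ c := by
          rw [Real.rpow_neg hy0.le, ← Real.inv_rpow hy0.le, inv_div]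
      _ ≤ (X * (Q / n)) ^ c := by
          refine Real.rpow_le_rpow (by positivity) ?_ hc0
          rw [← mul_div_assoc]
          gcongr
      _ = X ^ c * (Q / n) ^ c := Real.mul_rpow hX0.le (by positivity)
      _ ≤ _ := by
          gcongr
  have h1 := (hC₁ _ hy0).trans (mul_le_mul_of_nonneg_left (key _ (by norm_num) (by norm_num)) hC₁0)
  have h2 := (hC₂ _ hy0).trans (mul_le_mul_of_nonneg_left (key _ (by norm_num) le_rfl) hC₂0)
  rw [norm_mul, Complex.norm_real, Real.norm_of_nonneg (by positivity), afeWeight, mul_left_comm]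
  refine mul_le_mul_of_nonneg_left ?_ (by positivity)
  set A := (Q / n) ^ (1 / 20 : ℝ)
  set B := (Q / n) ^ (2 : ℝ)
  have hA : 0 ≤ A := by positivity
  have hB : 0 ≤ B := by positivity
  have hX2 : 0 ≤ X ^ (2 : ℝ) := by positivity
  rw [mul_min_of_nonneg _ _ (by positivity)]
  refine le_min (h1.trans ?_) (h2.trans ?_)
  · have : 0 ≤ C₂ * (X ^ (2 : ℝ) * A) := by positivity
    linarith
  · have : 0 ≤ C₁ * (X ^ (2 : ℝ) * B) := by positivity
    linarith

theorem integrable_afeKernel_mul (hμ : ∀ j, -1 < (μ j).re) :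
    MeasureTheory.Integrable fun v : ℝ =>
      ‖afeKernel μ (((1 / 2 : ℝ) : ℂ) + v * Complex.I)‖ * (1 + |v|) ^ 4 := by
  obtain ⟨C, hC0, hC⟩ := exists_norm_afeKernel_le hμ (a := 1 / 2) (b := 1 / 2) (by norm_num) le_rfl
  refine ((integrable_exp_neg_mul_sq (b := 1 / 4) (by norm_num)).const_mul
    (C * Real.exp 16)).mono' (Continuous.aestronglyMeasurable ?_)
    (MeasureTheory.ae_of_all _ fun v => ?_)
  · exact (continuous_afeKernel_line hμ (by norm_num)).norm.mul (by fun_prop)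
  · have h1 := hC (1 / 2) v le_rfl le_rfl
    have h2 : (1 + |v|) ^ 4 ≤ Real.exp (4 * |v|) := by
      have h3 : 1 + |v| ≤ Real.exp |v| := by linarith [Real.add_one_le_exp |v|]
      calc (1 + |v|) ^ 4 ≤ Real.exp |v| ^ 4 := by gcongr
        _ = _ := by rw [← Real.exp_nat_mul]; norm_num
    rw [Real.norm_of_nonneg (by positivity)]
    calc _ ≤ (C * Real.exp (-(1 / 2) * v ^ 2)) * Real.exp (4 * |v|) := by gcongr
      _ = C * Real.exp (-(1 / 2) * v ^ 2 + 4 * |v|) := by rw [Real.exp_add]; ring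
      _ ≤ C * Real.exp (16 + -(1 / 4) * v ^ 2) := by
          refine mul_le_mul_of_nonneg_left (Real.exp_le_exp.2 ?_) hC0
          nlinarith [sq_nonneg (|v| - 8), sq_abs v]
      _ = _ := by rw [Real.exp_add]; ring

/-- The Cauchy–Schwarz inequality for a nonnegative weight. -/
theorem sq_integral_mul_le {κ f : ℝ → ℝ} (hκ : MeasureTheory.Integrable κ) (hκ0 : ∀ v, 0 ≤ κ v)
    (hf : MeasureTheory.Integrable fun v => κ v * f v)
    (hf2 : MeasureTheory.Integrable fun v => κ v * f v ^ 2) :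
    (∫ v, κ v * f v) ^ 2 ≤ (∫ v, κ v) * ∫ v, κ v * f v ^ 2 := by
  have key : ∀ t : ℝ, 0 ≤ (∫ v, κ v) * (t * t) + (-(2 * ∫ v, κ v * f v)) * t +
      ∫ v, κ v * f v ^ 2 := by
    intro t
    have h1 : 0 ≤ ∫ v, κ v * (f v - t) ^ 2 :=
      MeasureTheory.integral_nonneg fun v => mul_nonneg (hκ0 v) (sq_nonneg _)
    have h2 : ∫ v, κ v * (f v - t) ^ 2 =
        (∫ v, κ v * f v ^ 2) - 2 * t * (∫ v, κ v * f v) + t ^ 2 * ∫ v, κ v := by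
      have i1 : MeasureTheory.Integrable fun v => κ v * f v ^ 2 - 2 * t * (κ v * f v) :=
        hf2.sub (hf.const_mul _)
      rw [← MeasureTheory.integral_const_mul, ← MeasureTheory.integral_const_mul,
        ← MeasureTheory.integral_sub hf2 (hf.const_mul _),
        ← MeasureTheory.integral_add i1 (hκ.const_mul _)]
      congr 1
      ext v
      ring
    rw [h2] at h1
    linarith
  have := discrim_le_zero key
  rw [discrim] at this
  linarith

end Weights

namespace LDatum

variable {d : ℕ} {F : LDatum d} {q : ℕ} {χ : DirichletCharacter ℂ q}

/-- On the line `Re s = 1/2`, Mellin inversion separates the variables `p` and `m` of the bilinear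
sum. -/
theorem bilinear_integral_eq {μ : Fin d → ℂ} (hμ : ∀ j, -1 < (μ j).re) {I : Finset ℕ}
    (hI : ∀ p ∈ I, p.Prime) {a b R : ℕ} (ha : 1 ≤ a) (hR : ∀ p ∈ I, p * b ≤ R) {N : ℝ}
    (hN : 0 < N) :
    ∑ n ∈ Finset.Icc 1 R, F.bilinearCoeff I a b n *
      (((((n : ℝ) ^ (-(1 / 2) : ℝ) : ℝ) : ℂ) * afeV μ (n / √N)) * χ n) =
    ∫ v : ℝ, afeKernel μ (((1 / 2 : ℝ) : ℂ) + v * Complex.I) *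
      ((√N : ℝ) : ℂ) ^ (((1 / 2 : ℝ) : ℂ) + v * Complex.I) *
      (∑ p ∈ I, LSeries.term (F.primeCoeff χ) (1 + v * Complex.I) p) *
      ∑ m ∈ Finset.Icc a b, F.ramareCoeff I m * (m : ℂ) ^ (-(1 + v * Complex.I)) * χ m := by
  have hM0 : 0 < √N := Real.sqrt_pos.2 hN
  have hMc : ((√N : ℝ) : ℂ) ≠ 0 := by exact_mod_cast hM0.ne'
  have hker := integrable_afeKernel_line hμ (c := 1 / 2) (by norm_num)
  rw [← sum_bilinear_eq hI ha hR (fun n => ((((n : ℝ) ^ (-(1 / 2) : ℝ) : ℝ) : ℂ) *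
    afeV μ (n / √N)) * χ n)]
  have hpow : ∀ n : ℕ, 1 ≤ n → ∀ v : ℝ,
      ((((n : ℝ) ^ (-(1 / 2) : ℝ) : ℝ) : ℂ)) *
        ((n / √N : ℝ) : ℂ) ^ (-(((1 / 2 : ℝ) : ℂ) + v * Complex.I)) =
      ((√N : ℝ) : ℂ) ^ (((1 / 2 : ℝ) : ℂ) + v * Complex.I) * (n : ℂ) ^ (-(1 + v * Complex.I)) := by
    intro n hn v
    have hn0 : (0 : ℝ) < n := by exact_mod_cast hn
    have hnc : (n : ℂ) ≠ 0 := by exact_mod_cast hn0.ne'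
    rw [div_eq_mul_inv (n : ℝ) √N, Complex.ofReal_mul, Complex.mul_cpow_ofReal_nonneg hn0.le (by positivity),
      Complex.ofReal_inv, Complex.inv_cpow, ← Complex.cpow_neg, neg_neg, Complex.ofReal_natCast,
      Complex.ofReal_cpow hn0.le, Complex.ofReal_natCast, ← mul_assoc,
      ← Complex.cpow_add _ _ hnc, mul_comm]
    · congr 2
      push_cast
      ring
    · rw [Complex.arg_ofReal_of_nonneg (Real.sqrt_nonneg _)]
      exact Real.pi_pos.ne
  -- the integrand for a single pair `(p, m)`
  set H : ℕ → ℕ → ℝ → ℂ := fun p m v => afeKernel μ (((1 / 2 : ℝ) : ℂ) + v * Complex.I) *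
      ((√N : ℝ) : ℂ) ^ (((1 / 2 : ℝ) : ℂ) + v * Complex.I) *
      LSeries.term (F.primeCoeff χ) (1 + v * Complex.I) p *
      (F.ramareCoeff I m * (m : ℂ) ^ (-(1 + v * Complex.I)) * χ m) with hH
  have hHeq : ∀ p ∈ I, ∀ m ∈ Finset.Icc a b, ∀ v, H p m v =
      (F.coeff p * F.ramareCoeff I m * ((((p * m : ℕ) : ℝ) ^ (-(1 / 2) : ℝ) : ℝ) : ℂ) *
        χ (p * m : ℕ)) * (afeKernel μ (((1 / 2 : ℝ) : ℂ) + v * Complex.I) *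
        (((p * m : ℕ) / √N : ℝ) : ℂ) ^ (-(((1 / 2 : ℝ) : ℂ) + v * Complex.I))) := by
    intro p hp m hm v
    have hp0 := (hI p hp).pos
    have hm0 : 1 ≤ m := ha.trans (Finset.mem_Icc.1 hm).1
    have h1 := hpow (p * m) (Nat.mul_pos hp0 hm0) v
    simp only [hH]
    rw [LSeries.term_of_ne_zero hp0.ne', primeCoeff, if_pos (hI p hp), twistCoeff,
      div_eq_mul_inv (F.coeff p * χ p), ← Complex.cpow_neg]
    calc _ = F.coeff p * F.ramareCoeff I m * (χ p * χ m) *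
          afeKernel μ (((1 / 2 : ℝ) : ℂ) + v * Complex.I) *
          (((√N : ℝ) : ℂ) ^ (((1 / 2 : ℝ) : ℂ) + v * Complex.I) *
            ((p : ℂ) ^ (-(1 + v * Complex.I)) * (m : ℂ) ^ (-(1 + v * Complex.I)))) := by ring
      _ = F.coeff p * F.ramareCoeff I m * χ (p * m : ℕ) *
          afeKernel μ (((1 / 2 : ℝ) : ℂ) + v * Complex.I) *
          (((((p * m : ℕ) : ℝ) ^ (-(1 / 2) : ℝ) : ℝ) : ℂ) *
        (((p * m : ℕ) / √N : ℝ) : ℂ) ^ (-(((1 / 2 : ℝ) : ℂ) + v * Complex.I))) := by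
          rw [h1, ← Complex.natCast_mul_natCast_cpow, ← map_mul, ← Nat.cast_mul, ← Nat.cast_mul]
      _ = _ := by ring
  have hHi : ∀ p ∈ I, ∀ m ∈ Finset.Icc a b, MeasureTheory.Integrable (H p m) := by
    intro p hp m hm
    have hm0 : 1 ≤ m := ha.trans (Finset.mem_Icc.1 hm).1
    have hpm : (0 : ℝ) < (p * m : ℕ) := by exact_mod_cast Nat.mul_pos (hI p hp).pos hm0
    have hy : (0 : ℝ) < (p * m : ℕ) / √N := by positivity
    rw [show H p m = _ from funext (hHeq p hp m hm)]
    refine MeasureTheory.Integrable.const_mul ?_ _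
    refine (hker.norm.mul_const ((((p * m : ℕ) : ℝ) / √N) ^ (-(1 / 2) : ℝ))).mono'
      (Continuous.aestronglyMeasurable ?_) (MeasureTheory.ae_of_all _ fun v => ?_)
    · refine (continuous_afeKernel_line hμ (by norm_num)).mul ?_
      exact Continuous.const_cpow (by fun_prop) (Or.inl (by exact_mod_cast hy.ne'))
    · rw [norm_mul, norm_cpow_neg_line hy]
  have hint : ∀ p ∈ I, ∀ m ∈ Finset.Icc a b, ∫ v, H p m v =
      F.coeff p * F.ramareCoeff I m * (((((p * m : ℕ) : ℝ) ^ (-(1 / 2) : ℝ) : ℝ) : ℂ) *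
        afeV μ ((p * m : ℕ) / √N) * χ (p * m : ℕ)) := by
    intro p hp m hm
    have hm0 : 1 ≤ m := ha.trans (Finset.mem_Icc.1 hm).1
    have hpm : (0 : ℝ) < (p * m : ℕ) := by exact_mod_cast Nat.mul_pos (hI p hp).pos hm0
    rw [show H p m = _ from funext (hHeq p hp m hm), MeasureTheory.integral_const_mul,
      ← afeV_eq hμ (c := 1 / 2) (by norm_num) (by positivity)]
    ring
  calc _ = ∑ p ∈ I, ∑ m ∈ Finset.Icc a b, ∫ v, H p m v :=
        Finset.sum_congr rfl fun p hp => Finset.sum_congr rfl fun m hm => (hint p hp m hm).symm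
    _ = ∫ v, ∑ p ∈ I, ∑ m ∈ Finset.Icc a b, H p m v := by
        rw [MeasureTheory.integral_finsetSum]
        · refine Finset.sum_congr rfl fun p hp => ?_
          rw [MeasureTheory.integral_finsetSum]
          exact fun m hm => hHi p hp m hm
        · exact fun p hp => MeasureTheory.integrable_finsetSum _ fun m hm => hHi p hp m hm
    _ = _ := by
        congr 1
        ext v
        simp only [hH]
        rw [mul_assoc, Finset.sum_mul_sum, Finset.mul_sum]
        refine Finset.sum_congr rfl fun p _ => ?_
        rw [Finset.mul_sum]
        refine Finset.sum_congr rfl fun m _ => ?_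
        ring

end LDatum

namespace LDatum

variable {d : ℕ} {F : LDatum d} {q : ℕ} {χ : DirichletCharacter ℂ q}

/-- The large sieve with the weight `1 / m`; as `q ≤ m`, no residue class is favoured by its first
element. -/
theorem sum_norm_sq_ramare_le [NeZero q] {B : ℝ}
    (hB : ∀ N : ℕ, ∑ n ∈ Finset.Icc 1 N, ‖F.coeff n‖ ^ 2 ≤ B * N)
    (S : Finset (DirichletCharacter ℂ q)) (I : Finset ℕ) (b : ℕ) (v : ℝ) :
    ∑ χ ∈ S, ‖∑ m ∈ Finset.Icc q b,
      F.ramareCoeff I m * (m : ℂ) ^ (-(1 + v * Complex.I)) * χ m‖ ^ 2 ≤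
        (2 + Real.log b) * (B * (1 + Real.log b)) := by
  have hq1 : 1 ≤ q := NeZero.one_le
  have hq0 : (0 : ℝ) < q := by exact_mod_cast hq1
  have hlog : 0 ≤ Real.log b := Real.log_natCast_nonneg b
  have hsub : Finset.Icc q b ⊆ Finset.Icc 1 b := Finset.Icc_subset_Icc_left hq1
  have hinv : ∑ n ∈ Finset.Icc q b, (n : ℝ)⁻¹ ≤ 1 + Real.log b :=
    (Finset.sum_le_sum_of_subset_of_nonneg hsub fun _ _ _ => by positivity).trans (sum_Icc_inv_le b)
  have hls := sum_norm_sq_sum_mul_char_le S (Finset.Icc q b)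
    (fun m => F.ramareCoeff I m * (m : ℂ) ^ (-(1 + v * Complex.I))) (fun n => (n : ℝ)⁻¹)
    (W := (2 + Real.log b) / q) (fun n hn => by
      have : (0 : ℝ) < n := by exact_mod_cast hq1.trans (Finset.mem_Icc.1 hn).1
      positivity)
    (fun r => by
      refine (sum_residueClass_le (fun n => by positivity) (fun m n hm hmn => ?_) r).trans ?_
      · have h1 : (0 : ℝ) < m := by exact_mod_cast hq1.trans hm
        exact inv_anti₀ h1 (by exact_mod_cast hmn)
      · calc (q : ℝ)⁻¹ + 1 / q * ∑ n ∈ Finset.Icc q b, (n : ℝ)⁻¹ ≤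
              (q : ℝ)⁻¹ + 1 / q * (1 + Real.log b) := by gcongr
          _ = _ := by field_simp; ring)
  refine hls.trans ?_
  rw [mul_div_cancel₀ _ hq0.ne']
  refine mul_le_mul_of_nonneg_left ?_ (by linarith)
  have hpt : ∀ n ∈ Finset.Icc q b, ‖F.ramareCoeff I n * (n : ℂ) ^ (-(1 + v * Complex.I))‖ ^ 2 /
      (n : ℝ)⁻¹ ≤ ‖F.coeff n‖ ^ 2 * (n : ℝ)⁻¹ := by
    intro n hn
    have hn1 : 0 < n := hq1.trans (Finset.mem_Icc.1 hn).1
    have hn0 : (0 : ℝ) < n := by exact_mod_cast hn1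
    rw [norm_mul, Complex.norm_natCast_cpow_of_pos hn1]
    have hre : (-(1 + v * Complex.I) : ℂ).re = -1 := by simp
    rw [hre, Real.rpow_neg_one, mul_pow, div_inv_eq_mul]
    have h1 := norm_ramareCoeff_le (F := F) (I := I) n
    calc ‖F.ramareCoeff I n‖ ^ 2 * ((n : ℝ)⁻¹) ^ 2 * n =
          ‖F.ramareCoeff I n‖ ^ 2 * (n : ℝ)⁻¹ := by field_simp
      _ ≤ _ := by gcongr
  calc _ ≤ ∑ n ∈ Finset.Icc q b, ‖F.coeff n‖ ^ 2 * (n : ℝ)⁻¹ := Finset.sum_le_sum hpt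
    _ ≤ ∑ n ∈ Finset.Icc 1 b, ‖F.coeff n‖ ^ 2 * (n : ℝ)⁻¹ :=
        Finset.sum_le_sum_of_subset_of_nonneg hsub fun _ _ _ => by positivity
    _ ≤ B * ∑ n ∈ Finset.Icc 1 b, (n : ℝ)⁻¹ := by
        refine sum_mul_le_of_sum_le (fun n => by positivity) (fun n hn => ?_) fun n _ => hB n
        have h1 : (0 : ℝ) < n := by exact_mod_cast hn
        exact inv_anti₀ h1 (by push_cast; linarith)
    _ ≤ _ := by
        have hB0 : 0 ≤ B := by
          have := (Finset.sum_nonneg fun n _ => sq_nonneg ‖F.coeff n‖).trans (hB 1)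
          simpa using this
        exact mul_le_mul_of_nonneg_left (sum_Icc_inv_le b) hB0

/-- The mean square of the bilinear sums: the sum over primes is small for each character
by hypothesis, the sum over `m` is small on average by the large sieve. -/
theorem sum_norm_sq_bilinear_le [NeZero q] {μ : Fin d → ℂ} (hμ : ∀ j, -1 < (μ j).re) {B : ℝ}
    (hB : ∀ N : ℕ, ∑ n ∈ Finset.Icc 1 N, ‖F.coeff n‖ ^ 2 ≤ B * N)
    (S : Finset (DirichletCharacter ℂ q)) {I : Finset ℕ} (hI : ∀ p ∈ I, p.Prime) {b R : ℕ}
    (hR : ∀ p ∈ I, p * b ≤ R) {N : ℝ} (hN : 0 < N) {c₀ : ℝ}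
    (hP : ∀ χ ∈ S, ∀ t : ℝ, ‖∑ p ∈ I, LSeries.term (F.primeCoeff χ) (1 + t * Complex.I) p‖ ≤
      c₀ * (1 + |t|) ^ 4) :
    ∑ χ ∈ S, ‖∑ n ∈ Finset.Icc 1 R, F.bilinearCoeff I q b n *
      (((((n : ℝ) ^ (-(1 / 2) : ℝ) : ℝ) : ℂ) * afeV μ (n / √N)) * χ n)‖ ^ 2 ≤
    √N * c₀ ^ 2 * (∫ v : ℝ, ‖afeKernel μ (((1 / 2 : ℝ) : ℂ) + v * Complex.I)‖ *
      (1 + |v|) ^ 4) ^ 2 * ((2 + Real.log b) * (B * (1 + Real.log b))) := by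
  have hq1 : 1 ≤ q := NeZero.one_le
  have hM0 : 0 < √N := Real.sqrt_pos.2 hN
  set κ : ℝ → ℝ := fun v => ‖afeKernel μ (((1 / 2 : ℝ) : ℂ) + v * Complex.I)‖ * (1 + |v|) ^ 4
    with hκdef
  have hκ : MeasureTheory.Integrable κ := integrable_afeKernel_mul hμ
  have hκ0 : ∀ v, 0 ≤ κ v := fun v => by positivity
  have hκc : Continuous κ :=
    (continuous_afeKernel_line hμ (by norm_num)).norm.mul (by fun_prop)
  set f : DirichletCharacter ℂ q → ℝ → ℝ := fun χ v => ‖∑ m ∈ Finset.Icc q b,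
      F.ramareCoeff I m * (m : ℂ) ^ (-(1 + v * Complex.I)) * χ m‖ with hf
  have hfc : ∀ χ, Continuous (f χ) := by
    intro χ
    refine Continuous.norm (continuous_finsetSum _ fun m hm => ?_)
    have hm0 : (m : ℂ) ≠ 0 := by
      exact_mod_cast (Nat.pos_iff_ne_zero.1 (hq1.trans (Finset.mem_Icc.1 hm).1))
    exact (continuous_const.mul (Continuous.const_cpow (by fun_prop) (Or.inl hm0))).mul
      continuous_const
  have hfb : ∀ χ, ∃ A : ℝ, ∀ v, f χ v ≤ A := by
    intro χ
    refine ⟨∑ m ∈ Finset.Icc q b, ‖F.ramareCoeff I m‖ * (m : ℝ) ^ (-1 : ℝ) * ‖χ m‖, fun v => ?_⟩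
    refine (norm_sum_le _ _).trans (Finset.sum_le_sum fun m hm => ?_)
    rw [norm_mul, norm_mul, Complex.norm_natCast_cpow_of_pos (hq1.trans (Finset.mem_Icc.1 hm).1)]
    have hre : (-(1 + v * Complex.I) : ℂ).re = -1 := by simp
    rw [hre]
  have hi1 : ∀ χ, MeasureTheory.Integrable fun v => κ v * f χ v := by
    intro χ
    obtain ⟨A, hA⟩ := hfb χ
    refine (hκ.mul_const A).mono' (hκc.mul (hfc χ)).aestronglyMeasurable
      (MeasureTheory.ae_of_all _ fun v => ?_)
    rw [Real.norm_of_nonneg (mul_nonneg (hκ0 v) (norm_nonneg _))]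
    exact mul_le_mul_of_nonneg_left (hA v) (hκ0 v)
  have hi2 : ∀ χ, MeasureTheory.Integrable fun v => κ v * f χ v ^ 2 := by
    intro χ
    obtain ⟨A, hA⟩ := hfb χ
    refine (hκ.mul_const (A ^ 2)).mono' (hκc.mul ((hfc χ).pow 2)).aestronglyMeasurable
      (MeasureTheory.ae_of_all _ fun v => ?_)
    rw [Real.norm_of_nonneg (mul_nonneg (hκ0 v) (sq_nonneg _))]
    exact mul_le_mul_of_nonneg_left (pow_le_pow_left₀ (norm_nonneg _) (hA v) 2) (hκ0 v)
  have hχ : ∀ χ ∈ S, ‖∑ n ∈ Finset.Icc 1 R, F.bilinearCoeff I q b n *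
      (((((n : ℝ) ^ (-(1 / 2) : ℝ) : ℝ) : ℂ) * afeV μ (n / √N)) * χ n)‖ ^ 2 ≤
      √N * c₀ ^ 2 * ((∫ v, κ v) * ∫ v, κ v * f χ v ^ 2) := by
    intro χ hχS
    rw [bilinear_integral_eq hμ hI hq1 hR hN]
    have h1 : ‖∫ v : ℝ, afeKernel μ (((1 / 2 : ℝ) : ℂ) + v * Complex.I) *
        ((√N : ℝ) : ℂ) ^ (((1 / 2 : ℝ) : ℂ) + v * Complex.I) *
        (∑ p ∈ I, LSeries.term (F.primeCoeff χ) (1 + v * Complex.I) p) *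
        ∑ m ∈ Finset.Icc q b, F.ramareCoeff I m * (m : ℂ) ^ (-(1 + v * Complex.I)) * χ m‖ ≤
        ∫ v, (√N ^ (1 / 2 : ℝ) * c₀) * (κ v * f χ v) := by
      refine MeasureTheory.norm_integral_le_of_norm_le ((hi1 χ).const_mul _)
        (MeasureTheory.ae_of_all _ fun v => ?_)
      rw [norm_mul, norm_mul, norm_mul, Complex.norm_cpow_eq_rpow_re_of_pos hM0]
      have hre : (((1 / 2 : ℝ) : ℂ) + v * Complex.I).re = 1 / 2 := by simp
      rw [hre]
      calc _ ≤ ‖afeKernel μ (((1 / 2 : ℝ) : ℂ) + v * Complex.I)‖ * √N ^ (1 / 2 : ℝ) *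
            (c₀ * (1 + |v|) ^ 4) * f χ v := by
            refine mul_le_mul_of_nonneg_right ?_ (norm_nonneg _)
            exact mul_le_mul_of_nonneg_left (hP χ hχS v) (by positivity)
        _ = _ := by simp only [hκdef]; ring
    rw [MeasureTheory.integral_const_mul] at h1
    calc _ ≤ ((√N ^ (1 / 2 : ℝ) * c₀) * ∫ v, κ v * f χ v) ^ 2 :=
          pow_le_pow_left₀ (norm_nonneg _) h1 2
      _ = (√N ^ (1 / 2 : ℝ)) ^ 2 * c₀ ^ 2 * (∫ v, κ v * f χ v) ^ 2 := by ring
      _ = √N * c₀ ^ 2 * (∫ v, κ v * f χ v) ^ 2 := by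
          rw [← Real.rpow_natCast (√N ^ (1 / 2 : ℝ)), ← Real.rpow_mul hM0.le]
          norm_num
      _ ≤ _ := by
          refine mul_le_mul_of_nonneg_left ?_ (by positivity)
          exact sq_integral_mul_le hκ hκ0 (hi1 χ) (hi2 χ)
  refine (Finset.sum_le_sum hχ).trans ?_
  rw [← Finset.mul_sum, ← Finset.mul_sum, ← MeasureTheory.integral_finsetSum _ fun χ _ => hi2 χ,
    pow_two (∫ v, κ v), mul_assoc (√N * c₀ ^ 2), mul_assoc (∫ v, κ v)]
  refine mul_le_mul_of_nonneg_left (mul_le_mul_of_nonneg_left ?_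
    (MeasureTheory.integral_nonneg hκ0)) (by positivity)
  rw [← MeasureTheory.integral_mul_const]
  refine MeasureTheory.integral_mono (MeasureTheory.integrable_finsetSum _ fun χ _ => hi2 χ)
    (hκ.mul_const _) fun v => ?_
  simp only
  rw [← Finset.mul_sum]
  exact mul_le_mul_of_nonneg_left (sum_norm_sq_ramare_le hB S I b v) (hκ0 v)

end LDatum

/-! ### The error in Ramaré's identity -/

namespace LDatum

variable {d : ℕ} {F : LDatum d} {q : ℕ} {χ : DirichletCharacter ℂ q}

theorem card_le_modulus [NeZero q] (S : Finset (DirichletCharacter ℂ q)) : (S.card : ℝ) ≤ q := by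
  have h := sum_norm_sq_sum_mul_char_le S {1} (fun _ => 1) (fun _ => 1) (fun _ _ => one_pos)
    (W := 1) (fun r => by
      rw [Finset.sum_const, nsmul_eq_mul, mul_one]
      exact_mod_cast (Finset.card_filter_le _ _).trans (by simp))
  simpa using h

/-- The large sieve for the terms with `n < q`, where the residue classes contain at most one
integer. -/
theorem sum_norm_sq_initial_le [NeZero q] (S : Finset (DirichletCharacter ℂ q)) {Q C D : ℝ}
    (hQ : 0 < Q) {w e : ℕ → ℂ} (hw : ∀ n, 1 ≤ n → ‖w n‖ ≤ C * afeWeight Q n)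
    (he : ∀ N < q, ∑ n ∈ Finset.Icc 1 N, ‖e n‖ ^ 2 ≤ D * N) (hD : 0 ≤ D) :
    ∑ χ ∈ S, ‖∑ n ∈ Finset.Icc 1 (q - 1), e n * (w n * χ n)‖ ^ 2 ≤
      q * (C ^ 2 * (Q ^ (1 / 10 : ℝ) * (D * ∑' n : ℕ, (n : ℝ) ^ (-(11 / 10) : ℝ)))) := by
  have hq1 : 1 ≤ q := NeZero.one_le
  have hls := sum_norm_sq_sum_mul_char_le S (Finset.Icc 1 (q - 1)) (fun n => e n * w n)
    (fun _ => 1) (fun _ _ => one_pos) (W := 1) (fun r => by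
      rw [Finset.sum_const, nsmul_eq_mul, mul_one]
      have : (Finset.filter (fun n : ℕ => (n : ZMod q) = r) (Finset.Icc 1 (q - 1))).card ≤ 1 := by
        rw [Finset.card_le_one]
        intro m hm n hn
        rw [Finset.mem_filter, Finset.mem_Icc] at hm hn
        have h1 : (m : ZMod q) = n := hm.2.trans hn.2.symm
        rw [ZMod.natCast_eq_natCast_iff'] at h1
        rwa [Nat.mod_eq_of_lt (by omega), Nat.mod_eq_of_lt (by omega)] at h1
      exact_mod_cast this)
  simp only [mul_assoc] at hls
  refine hls.trans ?_
  rw [one_mul]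
  refine mul_le_mul_of_nonneg_left ?_ (by positivity)
  have hpt : ∀ n ∈ Finset.Icc 1 (q - 1), ‖e n * w n‖ ^ 2 / 1 ≤
      C ^ 2 * (Q ^ (1 / 10 : ℝ) * (‖e n‖ ^ 2 * (n : ℝ) ^ (-(11 / 10) : ℝ))) := by
    intro n hn
    have hn1 := (Finset.mem_Icc.1 hn).1
    have hn0 : (0 : ℝ) < n := by exact_mod_cast hn1
    have h1 : ‖w n‖ ^ 2 ≤ (C * afeWeight Q n) ^ 2 := pow_le_pow_left₀ (norm_nonneg _) (hw n hn1) 2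
    have h2 : afeWeight Q n ^ 2 ≤ Q ^ (1 / 10 : ℝ) * (n : ℝ) ^ (-(11 / 10) : ℝ) := by
      calc afeWeight Q n ^ 2 ≤ (Q ^ (1 / 20 : ℝ) * (n : ℝ) ^ ((9 / 20 : ℝ) - 1)) ^ 2 :=
            pow_le_pow_left₀ (afeWeight_nonneg hQ n) (afeWeight_le_left hQ hn1) 2
        _ = _ := by
            rw [mul_pow, ← Real.rpow_natCast, ← Real.rpow_natCast, ← Real.rpow_mul hQ.le,
              ← Real.rpow_mul hn0.le]
            norm_num
    rw [div_one, norm_mul, mul_pow]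
    calc ‖e n‖ ^ 2 * ‖w n‖ ^ 2 ≤ ‖e n‖ ^ 2 * (C ^ 2 * (Q ^ (1 / 10 : ℝ) *
          (n : ℝ) ^ (-(11 / 10) : ℝ))) := by
          refine mul_le_mul_of_nonneg_left (h1.trans ?_) (by positivity)
          rw [mul_pow]
          exact mul_le_mul_of_nonneg_left h2 (by positivity)
      _ = _ := by ring
  refine (Finset.sum_le_sum hpt).trans ?_
  rw [← Finset.mul_sum, ← Finset.mul_sum]
  have habel := sum_mul_le_of_sum_le (a := fun n => ‖e n‖ ^ 2)
    (u := fun n : ℕ => (n : ℝ) ^ (-(11 / 10) : ℝ)) (B := D) (N := q - 1)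
    (fun n => by positivity) (fun n hn => by
      have h1 : (0 : ℝ) < n := by exact_mod_cast hn
      exact Real.rpow_le_rpow_of_nonpos h1 (by push_cast; linarith) (by norm_num))
    (fun n hn => he n (by omega))
  have hsum : ∑ n ∈ Finset.Icc 1 (q - 1), (n : ℝ) ^ (-(11 / 10) : ℝ) ≤
      ∑' n : ℕ, (n : ℝ) ^ (-(11 / 10) : ℝ) :=
    (Real.summable_nat_rpow.2 (by norm_num)).sum_le_tsum _ fun _ _ => by positivity
  have := habel.trans (mul_le_mul_of_nonneg_left hsum hD)
  gcongr

/-- The large sieve for the terms with `q ≤ n`, with the weight of the approximate functional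
equation as density. -/
theorem sum_norm_sq_final_le [NeZero q] (S : Finset (DirichletCharacter ℂ q)) {Q C : ℝ}
    (hQ : 0 < Q) (hqQ : (q : ℝ) ≤ Q) {w e : ℕ → ℂ}
    (hw : ∀ n, 1 ≤ n → ‖w n‖ ≤ C * afeWeight Q n) (R : ℕ) :
    ∑ χ ∈ S, ‖∑ n ∈ Finset.Icc q R, e n * (w n * χ n)‖ ^ 2 ≤
      6 * Q ^ (1 / 2 : ℝ) * (C ^ 2 * ∑ n ∈ Finset.Icc q R, ‖e n‖ ^ 2 * afeWeight Q n) := by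
  have hq1 : 1 ≤ q := NeZero.one_le
  have hq0 : (0 : ℝ) < q := by exact_mod_cast hq1
  have hls := sum_norm_sq_sum_mul_char_le S (Finset.Icc q R) (fun n => e n * w n)
    (afeWeight Q) (fun n hn => afeWeight_pos hQ (hq1.trans (Finset.mem_Icc.1 hn).1))
    (W := 6 * Q ^ (1 / 2 : ℝ) / q) (fun r => by
      refine (sum_residueClass_le (afeWeight_nonneg hQ)
        (fun m n hm hmn => afeWeight_anti hQ (hq1.trans hm) hmn) r).trans ?_
      have h1 : ∑ n ∈ Finset.Icc q R, afeWeight Q n ≤ 5 * Q ^ (1 / 2 : ℝ) :=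
        (Finset.sum_le_sum_of_subset_of_nonneg (Finset.Icc_subset_Icc_left hq1)
          fun n _ _ => afeWeight_nonneg hQ n).trans (sum_afeWeight_le hQ R)
      have h2 : afeWeight Q q ≤ Q ^ (1 / 2 : ℝ) / q := by
        refine (afeWeight_le_left hQ hq1).trans ?_
        rw [Real.rpow_sub_one hq0.ne', ← mul_div_assoc]
        gcongr
        calc Q ^ (1 / 20 : ℝ) * (q : ℝ) ^ (9 / 20 : ℝ) ≤ Q ^ (1 / 20 : ℝ) * Q ^ (9 / 20 : ℝ) := by
              gcongr
          _ = _ := by rw [← Real.rpow_add hQ]; norm_num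
      calc afeWeight Q q + 1 / q * ∑ n ∈ Finset.Icc q R, afeWeight Q n ≤
            Q ^ (1 / 2 : ℝ) / q + 1 / q * (5 * Q ^ (1 / 2 : ℝ)) := by gcongr
        _ = _ := by ring)
  simp only [mul_assoc (e _)] at hls
  refine hls.trans ?_
  rw [mul_div_cancel₀ _ hq0.ne', Finset.mul_sum (a := C ^ 2)]
  refine mul_le_mul_of_nonneg_left (Finset.sum_le_sum fun n hn => ?_) (by positivity)
  have hn1 := hq1.trans (Finset.mem_Icc.1 hn).1
  have hU := afeWeight_pos hQ hn1
  rw [div_le_iff₀ hU, norm_mul, mul_pow]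
  calc ‖e n‖ ^ 2 * ‖w n‖ ^ 2 ≤ ‖e n‖ ^ 2 * (C * afeWeight Q n) ^ 2 := by
        gcongr
        exact hw n hn1
    _ = _ := by ring

theorem sum_mul_afeWeight_le {Q B : ℝ} (hQ : 0 < Q) {a : ℕ → ℝ} {R : ℕ} (hB : 0 ≤ B)
    (ha : ∀ n ≤ R, ∑ k ∈ Finset.Icc 1 n, a k ≤ B * n) :
    ∑ n ∈ Finset.Icc 1 R, a n * afeWeight Q n ≤ B * (5 * Q ^ (1 / 2 : ℝ)) :=
  (sum_mul_le_of_sum_le (afeWeight_nonneg hQ)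
    (fun n hn => afeWeight_anti hQ hn (Nat.le_succ n)) ha).trans
    (mul_le_mul_of_nonneg_left (sum_afeWeight_le hQ R) hB)

open Classical in
/-- The weighted mean square of the error in Ramaré's identity. The range `n < q P` and the range
`b < n`, where some of the `n / p` are outside `[q, b]`, are treated trivially. -/
theorem sum_error_sq_mul_weight_le (hA1 : F.RamanujanBound) {I : Finset ℕ}
    (hI : ∀ p ∈ I, p.Prime) (hq : 1 ≤ q) {P b R : ℕ} (hP : ∀ p ∈ I, p ≤ P) {Q B B₁ B₂ B₃ : ℝ}
    (hQ : 0 < Q) (hQb : Q ^ 2 ≤ b)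
    (hB : ∀ N : ℕ, ∑ n ∈ Finset.Icc 1 N, ‖F.coeff n‖ ^ 2 ≤ B * N)
    (hB₁0 : 0 ≤ B₁) (hB₂0 : 0 ≤ B₂) (hB₃0 : 0 ≤ B₃)
    (hB₁ : ∀ N : ℕ, ∑ n ∈ Finset.Icc 1 N,
      (if q * P ≤ n ∧ ∀ p ∈ I, ¬ p ∣ n then ‖F.coeff n‖ ^ 2 else 0) ≤ B₁ * N)
    (hB₂ : ∀ N : ℕ, ∑ n ∈ Finset.Icc 1 N,
      (if ∃ p ∈ I, p ^ 2 ∣ n then ‖F.coeff n‖ ^ 2 else 0) ≤ B₂ * N)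
    (hB₃ : ∀ N ≤ R, ∑ n ∈ Finset.Icc 1 N, F.squareError I n ^ 2 ≤ B₃ * N) :
    ∑ n ∈ Finset.Icc q R, ‖F.coeff n - F.bilinearCoeff I q b n‖ ^ 2 * afeWeight Q n ≤
      3 * (B₁ + B₂ + B₃) * (5 * Q ^ (1 / 2 : ℝ)) +
      8 * (B * (3 * (Q ^ (1 / 20 : ℝ) * ((q * P : ℕ) : ℝ) ^ (9 / 20 : ℝ)))) +
      8 * (B * ∑' n : ℕ, (n : ℝ) ^ (-(3 / 2) : ℝ)) := by
  have hB0 : 0 ≤ B := by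
    have := (Finset.sum_nonneg fun n _ => sq_nonneg ‖F.coeff n‖).trans (hB 1)
    simpa using this
  set G : ℕ → ℝ := fun n => ‖F.coeff n‖ ^ 2 with hG
  have hG0 : ∀ n, 0 ≤ G n := fun n => sq_nonneg _
  set E : ℕ → ℝ := fun n => F.squareError I n ^ 2 with hE
  have hE0 : ∀ n, 0 ≤ E n := fun n => sq_nonneg _
  set g₁ : ℕ → ℝ := fun n => if q * P ≤ n ∧ ∀ p ∈ I, ¬ p ∣ n then G n else 0 with hg₁
  set g₂ : ℕ → ℝ := fun n => if ∃ p ∈ I, p ^ 2 ∣ n then G n else 0 with hg₂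
  have hg₁0 : ∀ n, 0 ≤ g₁ n := fun n => by simp only [hg₁]; split_ifs; exacts [hG0 n, le_rfl]
  have hg₂0 : ∀ n, 0 ≤ g₂ n := fun n => by simp only [hg₂]; split_ifs; exacts [hG0 n, le_rfl]
  have hpt : ∀ n ∈ Finset.Icc q R, ‖F.coeff n - F.bilinearCoeff I q b n‖ ^ 2 ≤
      3 * (g₁ n + g₂ n + E n) + 8 * (if n ≤ q * P then G n else 0) +
        8 * (if b < n then G n else 0) := by
    intro n hn
    have hi1 : 0 ≤ (if n ≤ q * P then G n else 0) := by split_ifs; exacts [hG0 n, le_rfl]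
    have hi2 : 0 ≤ (if b < n then G n else 0) := by split_ifs; exacts [hG0 n, le_rfl]
    by_cases hmid : q * P ≤ n ∧ n ≤ b
    · have h1 := norm_coeff_sub_bilinearCoeff_le (F := F) hA1 hI (a := q) (b := b) (n := n)
        (fun p hp hpn => by
          have hp0 := (hI p hp).pos
          rw [Finset.mem_Icc]
          refine ⟨(Nat.le_div_iff_mul_le hp0).2 ?_, (Nat.div_le_self _ _).trans hmid.2⟩
          exact (Nat.mul_le_mul_left q (hP p hp)).trans hmid.1)
      set x := (if ∀ p ∈ I, ¬ p ∣ n then ‖F.coeff n‖ else 0) with hx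
      set y := (if ∃ p ∈ I, p ^ 2 ∣ n then ‖F.coeff n‖ else 0) with hy
      have hx2 : x ^ 2 = g₁ n := by
        simp only [hx, hg₁, hG, hmid.1, true_and]
        split_ifs <;> simp
      have hy2 : y ^ 2 = g₂ n := by
        simp only [hy, hg₂, hG]
        split_ifs <;> simp
      have h2 : ‖F.coeff n - F.bilinearCoeff I q b n‖ ^ 2 ≤ (x + y + F.squareError I n) ^ 2 :=
        pow_le_pow_left₀ (norm_nonneg _) h1 2
      have h3 : (x + y + F.squareError I n) ^ 2 ≤ 3 * (x ^ 2 + y ^ 2 + F.squareError I n ^ 2) := by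
        nlinarith [sq_nonneg (x - y), sq_nonneg (x - F.squareError I n),
          sq_nonneg (y - F.squareError I n)]
      rw [hx2, hy2] at h3
      linarith
    · have h1 : ‖F.coeff n - F.bilinearCoeff I q b n‖ ≤ 2 * ‖F.coeff n‖ + F.squareError I n := by
        refine (norm_sub_le _ _).trans ?_
        have := norm_bilinearCoeff_le (F := F) hA1 hI q b n
        linarith
      have h2 : ‖F.coeff n - F.bilinearCoeff I q b n‖ ^ 2 ≤ 8 * G n + 2 * E n := by
        refine (pow_le_pow_left₀ (norm_nonneg _) h1 2).trans ?_
        simp only [hG, hE]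
        nlinarith [sq_nonneg (2 * ‖F.coeff n‖ - F.squareError I n)]
      have h3 : G n ≤ (if n ≤ q * P then G n else 0) + (if b < n then G n else 0) := by
        rcases not_and_or.1 hmid with h | h
        · rw [if_pos (by omega : n ≤ q * P)]; linarith
        · rw [if_pos (by omega : b < n)]; linarith
      linarith [hg₁0 n, hg₂0 n, hE0 n]
  have hU0 := afeWeight_nonneg hQ
  have hsub : Finset.Icc q R ⊆ Finset.Icc 1 R := Finset.Icc_subset_Icc_left hq
  have s1 := sum_mul_afeWeight_le hQ (R := R) hB₁0 fun n _ => hB₁ n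
  have s2 := sum_mul_afeWeight_le hQ (R := R) hB₂0 fun n _ => hB₂ n
  have s3 := sum_mul_afeWeight_le hQ (R := R) hB₃0 hB₃
  have s4 : ∑ n ∈ Finset.Icc 1 R, (if n ≤ q * P then G n else 0) * afeWeight Q n ≤
      B * (3 * (Q ^ (1 / 20 : ℝ) * ((q * P : ℕ) : ℝ) ^ (9 / 20 : ℝ))) := by
    calc _ = ∑ n ∈ (Finset.Icc 1 R).filter (fun n => n ≤ q * P), G n * afeWeight Q n := by
          rw [Finset.sum_filter]
          exact Finset.sum_congr rfl fun n _ => by split_ifs <;> simp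
      _ ≤ ∑ n ∈ Finset.Icc 1 (q * P), G n * afeWeight Q n := by
          refine Finset.sum_le_sum_of_subset_of_nonneg (fun n hn => ?_)
            fun n _ _ => mul_nonneg (hG0 n) (hU0 n)
          rw [Finset.mem_filter, Finset.mem_Icc] at hn
          exact Finset.mem_Icc.2 ⟨hn.1.1, hn.2⟩
      _ ≤ B * ∑ n ∈ Finset.Icc 1 (q * P), afeWeight Q n :=
          sum_mul_le_of_sum_le hU0 (fun n hn => afeWeight_anti hQ hn (Nat.le_succ n))
            fun n _ => hB n
      _ ≤ _ := mul_le_mul_of_nonneg_left (sum_afeWeight_le_rpow hQ _) hB0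
  have s5 : ∑ n ∈ Finset.Icc 1 R, (if b < n then G n else 0) * afeWeight Q n ≤
      B * ∑' n : ℕ, (n : ℝ) ^ (-(3 / 2) : ℝ) := by
    calc _ ≤ ∑ n ∈ Finset.Icc 1 R, G n * (n : ℝ) ^ (-(3 / 2) : ℝ) := by
          refine Finset.sum_le_sum fun n hn => ?_
          have hn1 := (Finset.mem_Icc.1 hn).1
          split_ifs with hbn
          · refine mul_le_mul_of_nonneg_left (afeWeight_le_of_sq_le hQ hn1 ?_) (hG0 n)
            exact hQb.trans (by exact_mod_cast hbn.le)
          · rw [zero_mul]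
            exact mul_nonneg (hG0 n) (by positivity)
      _ ≤ B * ∑ n ∈ Finset.Icc 1 R, (n : ℝ) ^ (-(3 / 2) : ℝ) := by
          refine sum_mul_le_of_sum_le (fun n => by positivity) (fun n hn => ?_) fun n _ => hB n
          have h1 : (0 : ℝ) < n := by exact_mod_cast hn
          exact Real.rpow_le_rpow_of_nonpos h1 (by push_cast; linarith) (by norm_num)
      _ ≤ _ := mul_le_mul_of_nonneg_left (sum_Icc_rpow_neg_three_halves_le R) hB0
  calc _ ≤ ∑ n ∈ Finset.Icc q R, (3 * (g₁ n + g₂ n + E n) + 8 * (if n ≤ q * P then G n else 0) +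
        8 * (if b < n then G n else 0)) * afeWeight Q n :=
        Finset.sum_le_sum fun n hn => mul_le_mul_of_nonneg_right (hpt n hn) (hU0 n)
    _ ≤ ∑ n ∈ Finset.Icc 1 R, (3 * (g₁ n + g₂ n + E n) + 8 * (if n ≤ q * P then G n else 0) +
        8 * (if b < n then G n else 0)) * afeWeight Q n := by
        refine Finset.sum_le_sum_of_subset_of_nonneg hsub fun n _ _ => mul_nonneg ?_ (hU0 n)
        have hi1 : 0 ≤ (if n ≤ q * P then G n else 0) := by split_ifs; exacts [hG0 n, le_rfl]
        have hi2 : 0 ≤ (if b < n then G n else 0) := by split_ifs; exacts [hG0 n, le_rfl]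
        linarith [hg₁0 n, hg₂0 n, hE0 n]
    _ = 3 * (∑ n ∈ Finset.Icc 1 R, g₁ n * afeWeight Q n) +
        3 * (∑ n ∈ Finset.Icc 1 R, g₂ n * afeWeight Q n) +
        3 * (∑ n ∈ Finset.Icc 1 R, E n * afeWeight Q n) +
        8 * (∑ n ∈ Finset.Icc 1 R, (if n ≤ q * P then G n else 0) * afeWeight Q n) +
        8 * (∑ n ∈ Finset.Icc 1 R, (if b < n then G n else 0) * afeWeight Q n) := by
        rw [Finset.mul_sum, Finset.mul_sum, Finset.mul_sum, Finset.mul_sum, Finset.mul_sum,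
          ← Finset.sum_add_distrib, ← Finset.sum_add_distrib, ← Finset.sum_add_distrib,
          ← Finset.sum_add_distrib]
        exact Finset.sum_congr rfl fun n _ => by ring
    _ ≤ _ := by linarith

end LDatum

/-! ### Bounds for a large modulus -/

namespace LDatum

variable {d : ℕ} {F : LDatum d} {q : ℕ} {χ : DirichletCharacter ℂ q}

/-- The terms with `n > R ≥ Q²` of the approximate functional equation contribute `O(1)`. -/
theorem norm_tsum_afeTerm_sub_sum_le (hF : F.IsStandard) (hq : 2 ≤ q) (hχ : χ.IsPrimitive)
    {Q C : ℝ} (hQ : 0 < Q) (hC : 0 ≤ C)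
    (hw : ∀ n : ℕ, 1 ≤ n → ‖((((n : ℝ) ^ (-(1 / 2) : ℝ) : ℝ) : ℂ) *
      afeV (F.mu χ) (n / √(F.N q)))‖ ≤ C * afeWeight Q n) {R : ℕ} (hR : Q ^ 2 ≤ R) :
    ‖∑' n, F.afeTerm χ n - ∑ n ∈ Finset.Icc 1 R, F.coeff n *
      (((((n : ℝ) ^ (-(1 / 2) : ℝ) : ℝ) : ℂ) * afeV (F.mu χ) (n / √(F.N q))) * χ n)‖ ≤
      C * ∑' n, ‖LSeries.term F.coeff (3 / 2) n‖ := by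
  have hsum := (summable_and_integral_eq hF hq hχ).1
  have hterm : ∀ n, F.afeTerm χ n = F.coeff n *
      (((((n : ℝ) ^ (-(1 / 2) : ℝ) : ℝ) : ℂ) * afeV (F.mu χ) (n / √(F.N q))) * χ n) := by
    intro n
    rw [afeTerm, twistCoeff]; ring
  have h0 : F.afeTerm χ 0 = 0 := by rw [hterm, coeff_zero, zero_mul]
  have hfin : ∑ n ∈ Finset.Icc 1 R, F.coeff n *
      (((((n : ℝ) ^ (-(1 / 2) : ℝ) : ℝ) : ℂ) * afeV (F.mu χ) (n / √(F.N q))) * χ n) =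
      ∑ n ∈ Finset.range (R + 1), F.afeTerm χ n := by
    simp only [← hterm]
    refine Finset.sum_subset (fun n hn => ?_) fun n hn hn' => ?_
    · rw [Finset.mem_Icc] at hn
      rw [Finset.mem_range]; omega
    · rw [Finset.mem_range] at hn
      rw [Finset.mem_Icc] at hn'
      rw [show n = 0 by omega, h0]
  set t : ℕ → ℝ := fun n => ‖LSeries.term F.coeff (3 / 2) n‖ with ht
  have hts : Summable t := (hF.series_converges (3 / 2) (by norm_num)).norm
  rw [hfin, ← hsum.sum_add_tsum_nat_add (R + 1), add_sub_cancel_left]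
  have hpt : ∀ i, ‖F.afeTerm χ (i + (R + 1))‖ ≤ C * t (i + (R + 1)) := by
    intro i
    set n := i + (R + 1) with hn
    have hn1 : 1 ≤ n := by omega
    rw [hterm, norm_mul, norm_mul, ht]
    simp only
    rw [LSeries.norm_term_eq, if_neg (by omega)]
    have h1 : afeWeight Q n ≤ (n : ℝ) ^ (-(3 / 2) : ℝ) := by
      refine afeWeight_le_of_sq_le hQ hn1 (hR.trans ?_)
      exact_mod_cast (by omega : R ≤ n)
    have h2 := (hw n hn1).trans (mul_le_mul_of_nonneg_left h1 hC)
    calc _ ≤ ‖F.coeff n‖ * (C * (n : ℝ) ^ (-(3 / 2) : ℝ) * 1) := by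
          refine mul_le_mul_of_nonneg_left ?_ (norm_nonneg _)
          exact mul_le_mul h2 (DirichletCharacter.norm_le_one χ _) (norm_nonneg _) (by positivity)
      _ = _ := by
          have : ((3 / 2 : ℂ)).re = 3 / 2 := by norm_num
          rw [this, Real.rpow_neg (by positivity)]
          ring
  have hts' : Summable fun i => t (i + (R + 1)) := (summable_nat_add_iff (R + 1)).2 hts
  refine (tsum_of_norm_bounded (hts'.mul_left C).hasSum hpt).trans ?_
  rw [tsum_mul_left]
  refine mul_le_mul_of_nonneg_left ?_ hC
  rw [← hts.sum_add_tsum_nat_add (R + 1)]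
  have : 0 ≤ ∑ n ∈ Finset.range (R + 1), t n := Finset.sum_nonneg fun n _ => norm_nonneg _
  linarith

/-- Powers of `q` and `Q ≥ q^{3/2}` of small total weight are dominated by `Q`, with a power of
`log q` to spare. -/
theorem rpow_mul_rpow_mul_le {x Q l a b : ℝ} (hx : 1 ≤ x) (hxQ : x ^ (3 / 2 : ℝ) ≤ Q)
    (hl : l ≤ x ^ (1 / 5 : ℝ)) (ha : 0 ≤ a) (hab : 2 / 3 * (a + 1 / 5) + b ≤ 1) :
    x ^ a * Q ^ b * l ≤ Q := by
  have hx0 : 0 < x := by linarith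
  have hQ1 : 1 ≤ Q := (Real.one_le_rpow hx (by norm_num)).trans hxQ
  have hQ0 : 0 < Q := by linarith
  calc x ^ a * Q ^ b * l ≤ x ^ a * Q ^ b * x ^ (1 / 5 : ℝ) := by gcongr
    _ = (x ^ (3 / 2 : ℝ)) ^ (2 / 3 * (a + 1 / 5)) * Q ^ b := by
        rw [← Real.rpow_mul hx0.le, show 3 / 2 * (2 / 3 * (a + 1 / 5)) = a + 1 / 5 by ring,
          Real.rpow_add hx0]
        ring
    _ ≤ Q ^ (2 / 3 * (a + 1 / 5)) * Q ^ b := by gcongr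
    _ = Q ^ (2 / 3 * (a + 1 / 5) + b) := by rw [Real.rpow_add hQ0]
    _ ≤ Q ^ (1 : ℝ) := Real.rpow_le_rpow_of_exponent_le hQ1 hab
    _ = Q := Real.rpow_one Q

open Classical in
/-- The integers without prime factor in `primeRange η q` have density `O((log q)^{-η})`, with the
weight `|λ_F|²`. -/
theorem SieveBound.exists_sum_not_dvd_le (hA3 : F.SieveBound) {η : ℝ} (hη0 : 0 < η)
    (hη1 : η < 1) :
    ∃ K : ℝ, 0 ≤ K ∧ ∀ᶠ q : ℕ in atTop, ∀ N : ℕ, ∑ n ∈ Finset.Icc 1 N,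
      (if q * ⌊Real.exp (Real.log q / 100)⌋₊ ≤ n ∧ ∀ p ∈ primeRange η q, ¬ p ∣ n
        then ‖F.coeff n‖ ^ 2 else 0) ≤ K / Real.log q ^ η * N := by
  obtain ⟨K, hK⟩ := hA3
  refine ⟨100 * |K|, by positivity, ?_⟩
  have f5 := (((tendsto_rpow_neg_atTop (y := η) hη0).comp tendsto_log_natCast).eventually
    (Iic_mem_nhds (by norm_num : (0 : ℝ) < 1 / 100)))
  filter_upwards [tendsto_log_natCast.eventually (eventually_ge_atTop 1), f5,
    eventually_ge_atTop 2] with q hL1 f5 hq2 N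
  have hq0 : (0 : ℝ) < q := by exact_mod_cast (by omega : 0 < q)
  set L := Real.log q with hL
  have hL0 : 0 < L := by linarith
  simp only [Function.comp_apply] at f5
  have hP1 : 1 ≤ ⌊Real.exp (L / 100)⌋₊ :=
    Nat.le_floor (by simpa using Real.one_le_exp (by positivity : 0 ≤ L / 100))
  rcases lt_or_ge N (q * ⌊Real.exp (L / 100)⌋₊) with hN | hN
  · rw [Finset.sum_eq_zero fun n hn => ?_]
    · positivity
    · rw [if_neg]
      have := (Finset.mem_Icc.1 hn).2
      omega
  · have hqN : (q : ℝ) ≤ N := by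
      have : q ≤ N := (Nat.le_mul_of_pos_right q hP1).trans hN
      exact_mod_cast this
    have hexpq : Real.exp (L / 100) ≤ q := by
      rw [← Real.le_log_iff_exp_le hq0, ← hL]; linarith
    have hle : L ^ (1 - η) ≤ L / 100 := by
      rw [sub_eq_add_neg, Real.rpow_add hL0, Real.rpow_one]
      have := mul_le_mul_of_nonneg_left (Set.mem_Iic.1 f5) hL0.le
      linarith
    have h2 : (2 : ℝ) ≤ Real.exp (L ^ (1 - η)) := by
      have e1 : 1 ≤ L ^ (1 - η) := Real.one_le_rpow hL1 (by linarith)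
      have := Real.add_one_le_exp (L ^ (1 - η))
      linarith
    have h := hK N (Real.exp (L ^ (1 - η))) (Real.exp (L / 100)) h2 (Real.exp_le_exp.2 hle)
      (hexpq.trans hqN)
    rw [Nat.floor_natCast, Finset.sum_filter, Real.log_exp, Real.log_exp] at h
    have hpt : ∀ n ∈ Finset.Icc 1 N,
        (if q * ⌊Real.exp (L / 100)⌋₊ ≤ n ∧ ∀ p ∈ primeRange η q, ¬ p ∣ n
          then ‖F.coeff n‖ ^ 2 else 0) ≤
        (if ∀ p : ℕ, p.Prime → Real.exp (L ^ (1 - η)) ≤ p → (p : ℝ) ≤ Real.exp (L / 100) → ¬ p ∣ n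
          then ‖F.coeff n‖ ^ 2 else 0) := by
      intro n _
      split_ifs with h1 h3 h3
      · exact le_rfl
      · exfalso
        refine h3 fun p hp hp1 hp2 => h1.2 p (mem_primeRange.2 ⟨hp, ?_, ?_⟩)
        · exact (Real.le_log_iff_exp_le (by exact_mod_cast hp.pos)).2 hp1
        · exact (Real.log_le_iff_le_exp (by exact_mod_cast hp.pos)).2 hp2
      · positivity
      · exact le_rfl
    refine (Finset.sum_le_sum hpt).trans (h.trans ?_)
    have e1 : L ^ (1 - η) / (L / 100) = 100 / L ^ η := by
      rw [Real.rpow_sub hL0, Real.rpow_one]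
      field_simp
    rw [e1]
    calc K * (N * (100 / L ^ η)) ≤ |K| * (N * (100 / L ^ η)) := by
          gcongr
          exact le_abs_self K
      _ = _ := by ring

theorem natLog_two_le {n : ℕ} (hn : 1 ≤ n) : (Nat.log 2 n : ℝ) ≤ 2 * Real.log n := by
  have h1 : (2 : ℝ) ^ Nat.log 2 n ≤ n := by exact_mod_cast Nat.pow_log_le_self 2 (by omega)
  have h2 := Real.log_le_log (by positivity) h1
  rw [Real.log_pow] at h2
  have h3 := Real.log_two_gt_d9
  have h4 : (0 : ℝ) ≤ Nat.log 2 n := by positivity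
  nlinarith

open Classical in
/-- The contribution of the integers divisible by the square of a prime of `primeRange η q`. -/
theorem exists_sum_square_primeRange_le (hA1 : F.RamanujanBound) (hA3 : F.SieveBound) {η : ℝ}
    (hη1 : η < 1) :
    ∃ K : ℝ, 0 ≤ K ∧ ∀ᶠ q : ℕ in atTop,
      (∀ N : ℕ, ∑ n ∈ Finset.Icc 1 N, (if ∃ p ∈ primeRange η q, p ^ 2 ∣ n
        then ‖F.coeff n‖ ^ 2 else 0) ≤ K / Real.log q ^ η * N) ∧
      ∀ N ≤ q ^ d * q, ∑ n ∈ Finset.Icc 1 N, F.squareError (primeRange η q) n ^ 2 ≤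
        K / Real.log q ^ η * N := by
  obtain ⟨K, hK0, hK⟩ := exists_sum_square_bounds F hA1 hA3
  refine ⟨2 * (d + 1) * K, by positivity, ?_⟩
  have f1 := tendsto_log_natCast.eventually
    (eventually_rpow_mul_exp_neg_le (η + 1) (κ := 1 - η) (b := 1) (by linarith) one_pos)
  filter_upwards [tendsto_log_natCast.eventually (eventually_ge_atTop 1), f1,
    eventually_ge_atTop 2] with q hL1 f1 hq2
  have hq0 : (0 : ℝ) < q := by exact_mod_cast (by omega : 0 < q)
  set L := Real.log q with hL
  have hL0 : 0 < L := by linarith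
  rw [one_mul] at f1
  have hP : ∀ p ∈ primeRange η q, Real.exp (L ^ (1 - η)) ≤ (p : ℝ) := fun p hp => by
    have := mem_primeRange.1 hp
    exact (Real.le_log_iff_exp_le (by exact_mod_cast this.1.pos)).1 this.2.1
  have hinv : L / Real.exp (L ^ (1 - η)) ≤ 1 / L ^ η := by
    rw [le_div_iff₀ (by positivity), div_eq_mul_inv, ← Real.exp_neg]
    refine le_trans (le_of_eq ?_) f1
    rw [Real.rpow_add hL0, Real.rpow_one]; ring
  have hinv' : 1 / Real.exp (L ^ (1 - η)) ≤ 1 / L ^ η :=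
    (div_le_div_of_nonneg_right hL1 (Real.exp_pos _).le).trans hinv
  have hbd := hK (primeRange η q) (Real.exp (L ^ (1 - η)))
    (fun p hp => (mem_primeRange.1 hp).1) (Real.one_le_exp (by positivity)) hP
  refine ⟨fun N => ?_, fun N hN => ?_⟩
  · have h1 := (hbd N).1
    rw [Finset.sum_filter] at h1
    have h2 : ∑ n ∈ Finset.Icc 1 N, (if ∃ p ∈ primeRange η q, p ^ 2 ∣ n
        then ‖F.coeff n‖ ^ 2 else 0) ≤ K * (N / Real.exp (L ^ (1 - η))) := by
      convert h1 using 3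
    refine h2.trans ?_
    calc K * (N / Real.exp (L ^ (1 - η))) = K * (N * (1 / Real.exp (L ^ (1 - η)))) := by ring
      _ ≤ K * (N * (1 / L ^ η)) := by gcongr
      _ = 1 * K / L ^ η * N := by ring
      _ ≤ _ := by
          gcongr
          have : (0 : ℝ) ≤ d := by positivity
          linarith
  · refine ((hbd N).2 _ hN).trans ?_
    have hlog : (Nat.log 2 (q ^ d * q) : ℝ) ≤ 2 * (d + 1) * L := by
      refine (natLog_two_le (Nat.one_le_iff_ne_zero.2 (by positivity))).trans (le_of_eq ?_)
      push_cast
      rw [Real.log_mul (by positivity) (by positivity), Real.log_pow]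
      ring
    calc _ ≤ K * (2 * (d + 1) * L) * (N / Real.exp (L ^ (1 - η))) := by gcongr
      _ = K * (2 * (d + 1)) * N * (L / Real.exp (L ^ (1 - η))) := by ring
      _ ≤ K * (2 * (d + 1)) * N * (1 / L ^ η) := by gcongr
      _ = _ := by ring

end LDatum

/-! ### The mean square over the characters without exceptional zeros -/

namespace LDatum

variable {d : ℕ} {F : LDatum d} {q : ℕ} {χ : DirichletCharacter ℂ q}

/-- The four parts of the approximate functional equation: its tail, the bilinear main part, and
the error of Ramaré's identity below and above `q`. -/
theorem sum_norm_sq_tsum_le [NeZero q] (S : Finset (DirichletCharacter ℂ q))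
    {f : DirichletCharacter ℂ q → ℂ} {g h w : ℕ → ℂ} {R : ℕ} (hqR : q ≤ R) {T V₁ V₂ V₃ : ℝ}
    (hT : ∀ χ ∈ S, ‖f χ - ∑ n ∈ Finset.Icc 1 R, g n * (w n * χ n)‖ ≤ T)
    (hV₁ : ∑ χ ∈ S, ‖∑ n ∈ Finset.Icc 1 R, h n * (w n * χ n)‖ ^ 2 ≤ V₁)
    (hV₂ : ∑ χ ∈ S, ‖∑ n ∈ Finset.Icc 1 (q - 1), (g n - h n) * (w n * χ n)‖ ^ 2 ≤ V₂)
    (hV₃ : ∑ χ ∈ S, ‖∑ n ∈ Finset.Icc q R, (g n - h n) * (w n * χ n)‖ ^ 2 ≤ V₃) :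
    ∑ χ ∈ S, ‖f χ‖ ^ 2 ≤ 4 * (q * T ^ 2 + V₁ + V₂ + V₃) := by
  have hq1 : 1 ≤ q := NeZero.one_le
  have hpt : ∀ χ ∈ S, ‖f χ‖ ^ 2 ≤ 4 * T ^ 2 +
      4 * ‖∑ n ∈ Finset.Icc 1 R, h n * (w n * χ n)‖ ^ 2 +
      4 * ‖∑ n ∈ Finset.Icc 1 (q - 1), (g n - h n) * (w n * χ n)‖ ^ 2 +
      4 * ‖∑ n ∈ Finset.Icc q R, (g n - h n) * (w n * χ n)‖ ^ 2 := by
    intro χ hχ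
    have hsplit : ∑ n ∈ Finset.Icc 1 R, g n * (w n * χ n) =
        ∑ n ∈ Finset.Icc 1 R, h n * (w n * χ n) +
        (∑ n ∈ Finset.Icc 1 (q - 1), (g n - h n) * (w n * χ n) +
          ∑ n ∈ Finset.Icc q R, (g n - h n) * (w n * χ n)) := by
      rw [← Finset.sum_union]
      · have : Finset.Icc 1 (q - 1) ∪ Finset.Icc q R = Finset.Icc 1 R := by
          ext n
          simp only [Finset.mem_union, Finset.mem_Icc]
          omega
        rw [this, ← Finset.sum_add_distrib]
        exact Finset.sum_congr rfl fun n _ => by ring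
      · rw [Finset.disjoint_left]
        intro n h1 h2
        rw [Finset.mem_Icc] at h1 h2
        omega
    have h1 := hT χ hχ
    rw [hsplit] at h1
    set x := ∑ n ∈ Finset.Icc 1 R, h n * (w n * χ n)
    set y := ∑ n ∈ Finset.Icc 1 (q - 1), (g n - h n) * (w n * χ n)
    set z := ∑ n ∈ Finset.Icc q R, (g n - h n) * (w n * χ n)
    have h2 : ‖f χ‖ ≤ T + ‖x‖ + ‖y‖ + ‖z‖ := by
      calc ‖f χ‖ = ‖(f χ - (x + (y + z))) + x + y + z‖ := by congr 1; ring
        _ ≤ ‖(f χ - (x + (y + z)))‖ + ‖x‖ + ‖y‖ + ‖z‖ := norm_add₄_le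
        _ ≤ _ := by linarith
    refine (pow_le_pow_left₀ (norm_nonneg _) h2 2).trans ?_
    nlinarith [sq_nonneg (T - ‖x‖), sq_nonneg (T - ‖y‖), sq_nonneg (T - ‖z‖),
      sq_nonneg (‖x‖ - ‖y‖), sq_nonneg (‖x‖ - ‖z‖), sq_nonneg (‖y‖ - ‖z‖)]
  refine (Finset.sum_le_sum hpt).trans ?_
  rw [Finset.sum_add_distrib, Finset.sum_add_distrib, Finset.sum_add_distrib, Finset.sum_const,
    nsmul_eq_mul, ← Finset.mul_sum, ← Finset.mul_sum, ← Finset.mul_sum]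
  have := mul_le_mul_of_nonneg_right (card_le_modulus S) (by positivity : 0 ≤ 4 * T ^ 2)
  linarith

theorem eventually_rpow_log_le (η : ℝ) :
    ∀ᶠ q : ℕ in atTop, Real.log q ^ η ≤ (q : ℝ) ^ (1 / 5 : ℝ) := by
  filter_upwards [tendsto_log_natCast.eventually (eventually_rpow_mul_exp_neg_le η
    (κ := 1) (b := 1 / 5) one_pos (by norm_num)), eventually_ge_atTop 1] with q h hq
  have hq0 : (0 : ℝ) < q := by exact_mod_cast hq
  rw [Real.rpow_one, Real.exp_neg, ← div_eq_mul_inv, div_le_one (Real.exp_pos _)] at h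
  rwa [Real.rpow_def_of_pos hq0, mul_comm (Real.log _)]

/-- The weighted estimate of the bilinear part, with the logarithms of its two factors compared:
the square of the sum over primes saves `(log q)⁶`, and the large sieve loses `(log q)²`. -/
theorem bilinear_numeric_le {M K Q C₁ L J B η D : ℝ} (hM0 : 0 ≤ M) (hM : M ≤ K * Q)
    (hL : 1 ≤ L) (hB : 0 ≤ B) (hη : η ≤ 1) (hD : 0 ≤ D) :
    M * (C₁ / L ^ 3) ^ 2 * J ^ 2 * ((2 + D * L) * (B * (1 + D * L))) ≤
      K * C₁ ^ 2 * J ^ 2 * B * (2 + D) ^ 2 * (Q / L ^ η) := by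
  have hL0 : 0 < L := by linarith
  have h1 : (2 + D * L) * (B * (1 + D * L)) ≤ B * ((2 + D) ^ 2 * L ^ 2) := by
    have e1 : 2 + D * L ≤ (2 + D) * L := by nlinarith
    have e2 : 1 + D * L ≤ (2 + D) * L := by nlinarith
    calc (2 + D * L) * (B * (1 + D * L)) = B * ((2 + D * L) * (1 + D * L)) := by ring
      _ ≤ B * (((2 + D) * L) * ((2 + D) * L)) := by gcongr
      _ = _ := by ring
  have h2 : L ^ η ≤ L ^ 4 := by
    rw [← Real.rpow_natCast]
    exact Real.rpow_le_rpow_of_exponent_le hL (by norm_num; linarith)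
  have hKQ : 0 ≤ K * Q := hM0.trans hM
  calc _ ≤ K * Q * (C₁ / L ^ 3) ^ 2 * J ^ 2 * (B * ((2 + D) ^ 2 * L ^ 2)) := by gcongr
    _ = K * Q * (C₁ ^ 2 * J ^ 2 * B * (2 + D) ^ 2 * (1 / L ^ 4)) := by field_simp
    _ ≤ K * Q * (C₁ ^ 2 * J ^ 2 * B * (2 + D) ^ 2 * (1 / L ^ η)) := by gcongr
    _ = _ := by ring

/-- The mean square of `L(1/2, F × χ)` over the characters of one parity whose `L`-function has no
zero near the line `Re s = 1`. The variable `m` of the bilinear sums runs over `q ≤ m ≤ q ^ d`, and the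
sums over `n = p m` up to `q ^ (d + 1)`, which is possible because the primes are at most `q`. -/
theorem exists_sum_norm_sq_tsum_afeTerm_le (hd : 3 ≤ d) (hF : F.IsStandard)
    (hA1 : F.RamanujanBound) (hA3 : F.SieveBound) {η δ : ℝ} (hη : 0 < η) (hηδ : η < δ)
    (hδ : δ < 1) {μ : Fin d → ℂ} (hμ : ∀ j, -1 < (μ j).re) :
    ∃ C : ℝ, 0 ≤ C ∧ ∀ᶠ q : ℕ in atTop, ∀ [NeZero q] (S : Finset (DirichletCharacter ℂ q)),
      (∀ χ ∈ S, χ.IsPrimitive ∧ F.mu χ = μ ∧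
        ∀ s : ℂ, 1 - Real.log q ^ (δ - 1) < s.re → |s.im| < q → F.twistL χ s ≠ 0) →
      ∑ χ ∈ S, ‖∑' n, F.afeTerm χ n‖ ^ 2 ≤
        C * ((q : ℝ) ^ ((d : ℝ) / 2) / Real.log q ^ η) := by
  obtain ⟨K, hK⟩ := hF.conductor_bound
  obtain ⟨B, hB0, hB⟩ := hA3.exists_sum_sq_le
  obtain ⟨C, hC0, hC⟩ := exists_norm_rpow_mul_afeV_le hμ |K|
  obtain ⟨C₁, hC₁0, hC₁⟩ := exists_norm_sum_primeRange_le hF hA1 hη hηδ hδ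
  obtain ⟨K₁, hK₁0, hK₁⟩ := hA3.exists_sum_not_dvd_le hη (hηδ.trans hδ)
  obtain ⟨K₂, hK₂0, hK₂⟩ := exists_sum_square_primeRange_le hA1 hA3 (hηδ.trans hδ)
  set T : ℝ := C * ∑' n, ‖LSeries.term F.coeff (3 / 2) n‖ with hT
  set J : ℝ := ∫ v : ℝ, ‖afeKernel μ (((1 / 2 : ℝ) : ℂ) + v * Complex.I)‖ * (1 + |v|) ^ 4 with hJ
  set Z : ℝ := ∑' n : ℕ, (n : ℝ) ^ (-(11 / 10) : ℝ) with hZ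
  set Z' : ℝ := ∑' n : ℕ, (n : ℝ) ^ (-(3 / 2) : ℝ) with hZ'
  have hZ0 : 0 ≤ Z := tsum_nonneg fun n => by positivity
  have hZ'0 : 0 ≤ Z' := tsum_nonneg fun n => by positivity
  refine ⟨4 * (T ^ 2 + √|K| * C₁ ^ 2 * J ^ 2 * B * (2 + d) ^ 2 + C ^ 2 * (8 * B + 2 * K₂) * Z +
    6 * C ^ 2 * (15 * (K₁ + K₂ + K₂) + 24 * B + 8 * B * Z')), by positivity, ?_⟩
  filter_upwards [hK, hC₁, hK₁, hK₂, eventually_rpow_log_le η,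
    tendsto_log_natCast.eventually (eventually_ge_atTop 1), eventually_ge_atTop 2] with q hK hC₁
    hK₁ hK₂ hl hL1 hq2 _ S hS
  have hq1 : (1 : ℝ) ≤ q := by exact_mod_cast (by omega : 1 ≤ q)
  have hq0 : (0 : ℝ) < q := by linarith
  rcases S.eq_empty_or_nonempty with rfl | ⟨χ₀, hχ₀⟩
  · rw [Finset.sum_empty]
    positivity
  have hN0 := hF.conductor_pos q hq2
  have hNK := (hK χ₀ (hS χ₀ hχ₀).1).2
  obtain ⟨hK₂, hK₃⟩ := hK₂
  set L := Real.log q with hL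
  have hL0 : 0 < L := by linarith
  have hLη0 : 0 < L ^ η := by positivity
  have hLη1 : 1 ≤ L ^ η := Real.one_le_rpow hL1 hη.le
  set Q : ℝ := (q : ℝ) ^ ((d : ℝ) / 2) with hQ
  have hQ0 : 0 < Q := by positivity
  have hQ2 : Q ^ 2 = (q : ℝ) ^ d := by
    rw [hQ, ← Real.rpow_natCast, ← Real.rpow_mul hq0.le, ← Real.rpow_natCast]
    congr 1
    push_cast
    ring
  have hdR : (3 : ℝ) ≤ d := by exact_mod_cast hd
  have hxQ : (q : ℝ) ^ (3 / 2 : ℝ) ≤ Q := Real.rpow_le_rpow_of_exponent_le hq1 (by linarith)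
  have hqQ : (q : ℝ) ≤ Q := by
    refine le_trans ?_ hxQ
    calc (q : ℝ) = (q : ℝ) ^ (1 : ℝ) := (Real.rpow_one _).symm
      _ ≤ _ := Real.rpow_le_rpow_of_exponent_le hq1 (by norm_num)
  have hNQ : F.N q ≤ |K| * Q ^ 2 := by
    rw [hQ2]
    exact hNK.trans (by gcongr; exact le_abs_self K)
  set w : ℕ → ℂ := fun n => (((n : ℝ) ^ (-(1 / 2) : ℝ) : ℝ) : ℂ) * afeV μ (n / √(F.N q)) with hwdef
  have hw : ∀ n : ℕ, 1 ≤ n → ‖w n‖ ≤ C * afeWeight Q n := hC (F.N q) Q hN0 hQ0 hNQ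
  set I := primeRange η q with hI
  have hIp : ∀ p ∈ I, p.Prime := fun p hp => (mem_primeRange.1 hp).1
  set P : ℕ := ⌊Real.exp (L / 100)⌋₊ with hP
  have hIP : ∀ p ∈ I, p ≤ P := fun p hp => by
    have h := mem_primeRange.1 hp
    exact Nat.le_floor ((Real.log_le_iff_le_exp (by exact_mod_cast h.1.pos)).1 h.2.2)
  have hexp : Real.exp (L / 100) = (q : ℝ) ^ (1 / 100 : ℝ) := by
    rw [Real.rpow_def_of_pos hq0, ← hL]
    congr 1
    ring
  have hPq : (P : ℝ) ≤ (q : ℝ) ^ (1 / 100 : ℝ) :=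
    hexp ▸ Nat.floor_le (Real.exp_pos (L / 100)).le
  have hPq' : P ≤ q := by
    have : (q : ℝ) ^ (1 / 100 : ℝ) ≤ (q : ℝ) ^ (1 : ℝ) :=
      Real.rpow_le_rpow_of_exponent_le hq1 (by norm_num)
    rw [Real.rpow_one] at this
    exact_mod_cast hPq.trans this
  have hR : ∀ p ∈ I, p * q ^ d ≤ q ^ d * q := fun p hp => by
    rw [mul_comm]
    exact Nat.mul_le_mul_left _ ((hIP p hp).trans hPq')
  have hqR : q ≤ q ^ d * q := Nat.le_mul_of_pos_left q (by positivity)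
  have hV₁ := sum_norm_sq_bilinear_le hμ hB S hIp hR hN0
    (fun χ hχ t => hC₁ χ (hS χ hχ).1 (hS χ hχ).2.2 t)
  have hD : ∀ N < q, ∑ n ∈ Finset.Icc 1 N, ‖F.coeff n - F.bilinearCoeff I q (q ^ d) n‖ ^ 2 ≤
      (8 * B + 2 * K₂) * N := by
    intro N hN
    have h1 : ∀ n ∈ Finset.Icc 1 N, ‖F.coeff n - F.bilinearCoeff I q (q ^ d) n‖ ^ 2 ≤
        8 * ‖F.coeff n‖ ^ 2 + 2 * F.squareError I n ^ 2 := fun n _ => by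
      have h1 : ‖F.coeff n - F.bilinearCoeff I q (q ^ d) n‖ ≤
          2 * ‖F.coeff n‖ + F.squareError I n := by
        refine (norm_sub_le _ _).trans ?_
        have := norm_bilinearCoeff_le (F := F) hA1 hIp q (q ^ d) n
        linarith
      refine (pow_le_pow_left₀ (norm_nonneg _) h1 2).trans ?_
      nlinarith [sq_nonneg (2 * ‖F.coeff n‖ - F.squareError I n)]
    refine (Finset.sum_le_sum h1).trans ?_
    rw [Finset.sum_add_distrib, ← Finset.mul_sum, ← Finset.mul_sum]
    have h2 := hK₃ N (hN.le.trans hqR)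
    have h3 : K₂ / L ^ η * N ≤ K₂ * N := by
      gcongr
      exact div_le_self hK₂0 hLη1
    linarith [hB N]
  have hV₂ := sum_norm_sq_initial_le S hQ0 hw hD (by positivity)
  have hX := sum_error_sq_mul_weight_le (F := F) hA1 hIp (by omega : 1 ≤ q) hIP (b := q ^ d)
    (R := q ^ d * q) hQ0 (by push_cast; exact hQ2.le) hB (by positivity) (by positivity)
    (by positivity) hK₁ hK₂ hK₃
  have hV₃ := sum_norm_sq_final_le S hQ0 hqQ (e := fun n => F.coeff n -
    F.bilinearCoeff I q (q ^ d) n) hw (q ^ d * q)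
  have hTail : ∀ χ ∈ S, ‖∑' n, F.afeTerm χ n -
      ∑ n ∈ Finset.Icc 1 (q ^ d * q), F.coeff n * (w n * χ n)‖ ≤ T := by
    intro χ hχ
    obtain ⟨hχp, hχμ, -⟩ := hS χ hχ
    have hR' : Q ^ 2 ≤ ((q ^ d * q : ℕ) : ℝ) := by
      rw [hQ2]
      push_cast
      exact le_mul_of_one_le_right (by positivity) hq1
    have := norm_tsum_afeTerm_sub_sum_le hF hq2 hχp hQ0 hC0 (by rw [hχμ]; exact hw) hR'
    rwa [hχμ] at this
  have hmain := sum_norm_sq_tsum_le S hqR hTail hV₁ hV₂ (hV₃.trans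
    (mul_le_mul_of_nonneg_left (mul_le_mul_of_nonneg_left hX (sq_nonneg C)) (by positivity)))
  refine hmain.trans ?_
  -- the terms of the bound, one after the other
  have hdiv : ∀ {a b : ℝ}, 0 ≤ a → 2 / 3 * (a + 1 / 5) + b ≤ 1 →
      (q : ℝ) ^ a * Q ^ b ≤ Q / L ^ η := fun ha hab => by
    rw [le_div_iff₀ hLη0]
    exact rpow_mul_rpow_mul_le hq1 hxQ hl ha hab
  have n0 : (q : ℝ) ≤ Q / L ^ η := by
    have := hdiv (a := 1) (b := 0) (by norm_num) (by norm_num)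
    simpa using this
  have n2 : (q : ℝ) * Q ^ (1 / 10 : ℝ) ≤ Q / L ^ η := by
    have := hdiv (a := 1) (b := 1 / 10) (by norm_num) (by norm_num)
    rwa [Real.rpow_one] at this
  have n3 : Q ^ (1 / 2 : ℝ) ≤ Q / L ^ η := by
    have := hdiv (a := 0) (b := 1 / 2) (by norm_num) (by norm_num)
    rwa [Real.rpow_zero, one_mul] at this
  have n4 : Q ^ (1 / 2 : ℝ) * (Q ^ (1 / 20 : ℝ) * ((q * P : ℕ) : ℝ) ^ (9 / 20 : ℝ)) ≤
      Q / L ^ η := by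
    have e1 : ((q * P : ℕ) : ℝ) ≤ (q : ℝ) ^ (101 / 100 : ℝ) := by
      rw [show (101 / 100 : ℝ) = 1 + 1 / 100 by norm_num, Real.rpow_add hq0, Real.rpow_one]
      push_cast
      gcongr
    calc _ ≤ Q ^ (1 / 2 : ℝ) * (Q ^ (1 / 20 : ℝ) * ((q : ℝ) ^ (101 / 100 : ℝ)) ^ (9 / 20 : ℝ)) := by
          gcongr
      _ = (q : ℝ) ^ (909 / 2000 : ℝ) * Q ^ (11 / 20 : ℝ) := by
          rw [← mul_assoc, ← Real.rpow_add hQ0, mul_comm, ← Real.rpow_mul hq0.le]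
          norm_num1
          rfl
      _ ≤ _ := hdiv (by norm_num) (by norm_num)
  have n5 : Q ^ (1 / 2 : ℝ) * Q ^ (1 / 2 : ℝ) = Q := by
    rw [← Real.rpow_add hQ0]
    norm_num
  have n1 := bilinear_numeric_le (M := √(F.N q)) (K := √|K|) (Q := Q) (C₁ := C₁) (L := L) (J := J)
    (B := B) (η := η) (D := d) (Real.sqrt_nonneg _) (by
      rw [← Real.sqrt_sq hQ0.le, ← Real.sqrt_mul (abs_nonneg K)]
      exact Real.sqrt_le_sqrt hNQ) hL1 hB0 (hηδ.trans hδ).le (by positivity)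
  have hlogb : Real.log ((q ^ d : ℕ) : ℝ) = d * L := by
    push_cast
    rw [Real.log_pow]
  rw [hlogb]
  set Y := Q / L ^ η with hY
  have m0 : (q : ℝ) * T ^ 2 ≤ T ^ 2 * Y := by
    rw [mul_comm]
    gcongr
  have m2 : (q : ℝ) * (C ^ 2 * (Q ^ (1 / 10 : ℝ) * ((8 * B + 2 * K₂) * Z))) ≤
      C ^ 2 * (8 * B + 2 * K₂) * Z * Y := by
    calc _ = C ^ 2 * (8 * B + 2 * K₂) * Z * (q * Q ^ (1 / 10 : ℝ)) := by ring
      _ ≤ _ := by gcongr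
  have m3 : 6 * Q ^ (1 / 2 : ℝ) * (C ^ 2 * (3 * (K₁ / L ^ η + K₂ / L ^ η + K₂ / L ^ η) *
      (5 * Q ^ (1 / 2 : ℝ)) + 8 * (B * (3 * (Q ^ (1 / 20 : ℝ) * ((q * P : ℕ) : ℝ) ^ (9 / 20 : ℝ)))) +
      8 * (B * Z'))) ≤
      6 * C ^ 2 * (15 * (K₁ + K₂ + K₂) + 24 * B + 8 * B * Z') * Y := by
    calc _ = 6 * C ^ 2 * (15 * (K₁ + K₂ + K₂) * ((Q ^ (1 / 2 : ℝ) * Q ^ (1 / 2 : ℝ)) / L ^ η) +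
          24 * B * (Q ^ (1 / 2 : ℝ) * (Q ^ (1 / 20 : ℝ) * ((q * P : ℕ) : ℝ) ^ (9 / 20 : ℝ))) +
          8 * B * Z' * Q ^ (1 / 2 : ℝ)) := by ring
      _ ≤ 6 * C ^ 2 * (15 * (K₁ + K₂ + K₂) * Y + 24 * B * Y + 8 * B * Z' * Y) := by
          rw [n5]
          gcongr
      _ = _ := by ring
  calc _ ≤ 4 * (T ^ 2 * Y + √|K| * C₁ ^ 2 * J ^ 2 * B * (2 + d) ^ 2 * Y +
        C ^ 2 * (8 * B + 2 * K₂) * Z * Y +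
        6 * C ^ 2 * (15 * (K₁ + K₂ + K₂) + 24 * B + 8 * B * Z') * Y) := by gcongr
    _ = _ := by ring

/-- The mean square estimate for all sufficiently large moduli. -/
theorem exists_eventually_sum_norm_sq_le (hd : 3 ≤ d) (hF : F.IsStandard)
    (hA1 : F.RamanujanBound) (hA3 : F.SieveBound) (C A K₅ K₆ : ℝ) {η δ : ℝ} (hη : 0 < η)
    (hηδ : η < δ) (hδ : δ < 1) :
    ∃ K : ℝ, 0 ≤ K ∧ ∀ᶠ q : ℕ in atTop, ∀ [NeZero q],
      F.ZeroDensityBound q C A K₅ → F.SubconvexityBound q δ K₆ →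
      ∑ χ ∈ primitiveChars q, ‖F.twistL χ (1 / 2)‖ ^ 2 ≤
        K * ((q : ℝ) ^ ((d : ℝ) / 2) / Real.log q ^ η) := by
  classical
  -- the zero-free region of width `(log q) ^ (δ' - 1)` separates the two kinds of characters
  obtain ⟨δ', hηδ', hδ'δ⟩ := exists_between hηδ
  obtain ⟨C₀, hC₀0, hC₀⟩ := exists_norm_twistL_half_le hF
  obtain ⟨C₁, hC₁0, hC₁⟩ := exists_sum_norm_sq_tsum_afeTerm_le hd hF hA1 hA3 hη hηδ'
    (hδ'δ.trans hδ) hF.neg_one_lt_muEven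
  obtain ⟨C₂, hC₂0, hC₂⟩ := exists_sum_norm_sq_tsum_afeTerm_le hd hF hA1 hA3 hη hηδ'
    (hδ'δ.trans hδ) hF.neg_one_lt_muOdd
  refine ⟨|K₅| * K₆ ^ 2 + C₀ ^ 2 * (C₁ + C₂), by positivity, ?_⟩
  filter_upwards [hC₁, hC₂, eventually_sum_exceptionalChars_le hF hA1 C A K₅ K₆ η
    (hη.trans hηδ) hδ'δ hδ, eventually_ge_atTop 2] with q hC₁ hC₂ hexc hq2 _ hA5 hA6
  set Y := (q : ℝ) ^ ((d : ℝ) / 2) / Real.log q ^ η with hY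
  set X := F.exceptionalChars q (Real.log q ^ (δ' - 1)) with hX
  set G := (primitiveChars q).filter (· ∉ X) with hG
  set G₁ := G.filter fun χ => F.mu χ = F.muEven with hG₁
  set G₂ := G.filter fun χ => F.mu χ = F.muOdd with hG₂
  have hgood : ∀ χ ∈ G, χ.IsPrimitive ∧
      ∀ s : ℂ, 1 - Real.log q ^ (δ' - 1) < s.re → |s.im| < q → F.twistL χ s ≠ 0 := by
    intro χ hχ
    rw [hG, Finset.mem_filter] at hχ
    refine ⟨mem_primitiveChars.1 hχ.1, fun s h1 h2 h3 => hχ.2 ?_⟩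
    exact mem_exceptionalChars.2 ⟨hχ.1, s, h1, h2, h3⟩
  have h₁ := hC₁ G₁ fun χ hχ => by
    have h := Finset.mem_filter.1 hχ
    exact ⟨(hgood χ h.1).1, h.2, (hgood χ h.1).2⟩
  have h₂ := hC₂ G₂ fun χ hχ => by
    have h := Finset.mem_filter.1 hχ
    exact ⟨(hgood χ h.1).1, h.2, (hgood χ h.1).2⟩
  have hcover : primitiveChars q ⊆ X ∪ (G₁ ∪ G₂) := by
    intro χ hχ
    by_cases hx : χ ∈ X
    · exact Finset.mem_union_left _ hx
    · have hχG : χ ∈ G := Finset.mem_filter.2 ⟨hχ, hx⟩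
      refine Finset.mem_union_right _ ?_
      rcases F.mu_eq_or χ with h | h
      · exact Finset.mem_union_left _ (Finset.mem_filter.2 ⟨hχG, h⟩)
      · exact Finset.mem_union_right _ (Finset.mem_filter.2 ⟨hχG, h⟩)
  have hafe : ∀ H ⊆ G, ∑ χ ∈ H, ‖F.twistL χ (1 / 2)‖ ^ 2 ≤
      C₀ ^ 2 * ∑ χ ∈ H, ‖∑' n, F.afeTerm χ n‖ ^ 2 := by
    intro H hH
    rw [Finset.mul_sum]
    refine Finset.sum_le_sum fun χ hχ => ?_
    rw [← mul_pow]
    exact pow_le_pow_left₀ (norm_nonneg _) (hC₀ q hq2 χ (hgood χ (hH hχ)).1) 2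
  have hunion : ∀ S T : Finset (DirichletCharacter ℂ q),
      ∑ χ ∈ S ∪ T, ‖F.twistL χ (1 / 2)‖ ^ 2 ≤
        ∑ χ ∈ S, ‖F.twistL χ (1 / 2)‖ ^ 2 + ∑ χ ∈ T, ‖F.twistL χ (1 / 2)‖ ^ 2 := by
    intro S T
    rw [← Finset.sum_union_inter]
    exact le_add_of_nonneg_right (Finset.sum_nonneg fun _ _ => sq_nonneg _)
  calc _ ≤ ∑ χ ∈ X ∪ (G₁ ∪ G₂), ‖F.twistL χ (1 / 2)‖ ^ 2 :=
        Finset.sum_le_sum_of_subset_of_nonneg hcover fun _ _ _ => sq_nonneg _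
    _ ≤ ∑ χ ∈ X, ‖F.twistL χ (1 / 2)‖ ^ 2 + (∑ χ ∈ G₁, ‖F.twistL χ (1 / 2)‖ ^ 2 +
        ∑ χ ∈ G₂, ‖F.twistL χ (1 / 2)‖ ^ 2) :=
        (hunion _ _).trans (by gcongr; exact hunion _ _)
    _ ≤ |K₅| * K₆ ^ 2 * Y + (C₀ ^ 2 * (C₁ * Y) + C₀ ^ 2 * (C₂ * Y)) := by
        have e₁ := (hafe G₁ (Finset.filter_subset _ _)).trans
          (mul_le_mul_of_nonneg_left h₁ (sq_nonneg C₀))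
        have e₂ := (hafe G₂ (Finset.filter_subset _ _)).trans
          (mul_le_mul_of_nonneg_left h₂ (sq_nonneg C₀))
        linarith [hexc hA5 hA6]
    _ = _ := by ring

/-- Finitely many exceptional indices only affect the constant in an upper bound. -/
theorem exists_forall_le_mul_of_eventually {f g : ℕ → ℝ} (hg : ∀ q, 2 ≤ q → 0 < g q) {P : ℕ → Prop}
    {K : ℝ} (hK : ∀ᶠ q in atTop, P q → f q ≤ K * g q) :
    ∃ K' : ℝ, ∀ q, 2 ≤ q → P q → f q ≤ K' * g q := by
  obtain ⟨q₀, hq₀⟩ := eventually_atTop.1 hK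
  refine ⟨|K| + ∑ q ∈ Finset.range q₀, |f q / g q|, fun q hq hP => ?_⟩
  have hgq := hg q hq
  have hsum : 0 ≤ ∑ q ∈ Finset.range q₀, |f q / g q| := Finset.sum_nonneg fun _ _ => abs_nonneg _
  rcases le_or_gt q₀ q with h | h
  · refine (hq₀ q h hP).trans (mul_le_mul_of_nonneg_right ?_ hgq.le)
    linarith [le_abs_self K]
  · rw [← div_le_iff₀ hgq]
    have h1 : |f q / g q| ≤ ∑ q ∈ Finset.range q₀, |f q / g q| :=
      Finset.single_le_sum (f := fun q => |f q / g q|) (fun _ _ => abs_nonneg _)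
        (Finset.mem_range.2 h)
    linarith [le_abs_self (f q / g q), abs_nonneg K]

end LDatum

end

theorem mainTheorem3 {d : ℕ} (hd : 3 ≤ d) (F : LDatum d) (hF : F.IsStandard)
    (hA1 : F.RamanujanBound) (hA2 : F.ShortAverageBound) (hA3 : F.SieveBound)
    (C A K₅ δ K₆ : ℝ) (hδ0 : 0 < δ) (hδ1 : δ < 1) (η : ℝ) (hη : η < δ) :
    ∃ K : ℝ, ∀ (q : ℕ) [NeZero q], 2 ≤ q →
      F.ZeroDensityBound q C A K₅ → F.SubconvexityBound q δ K₆ →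
      ∑ χ ∈ primitiveChars q, ‖F.twistL χ (1 / 2)‖ ^ 2 ≤
        K * ((q : ℝ) ^ ((d : ℝ) / 2) / Real.log q ^ η) := by
  -- a larger exponent gives a stronger bound for large `q`, so `η` may be taken positive
  obtain ⟨η', h1, h2⟩ := exists_between (max_lt hη hδ0)
  have hηη' : η ≤ η' := ((le_max_left _ _).trans_lt h1).le
  have hη'0 : 0 < η' := (le_max_right _ _).trans_lt h1
  obtain ⟨K, hK0, hK⟩ := LDatum.exists_eventually_sum_norm_sq_le hd hF hA1 hA3 C A K₅ K₆ hη'0 h2 hδ1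
  have hev : ∀ᶠ q : ℕ in atTop, ∀ _ : NeZero q,
      F.ZeroDensityBound q C A K₅ → F.SubconvexityBound q δ K₆ →
      ∑ χ ∈ primitiveChars q, ‖F.twistL χ (1 / 2)‖ ^ 2 ≤
        K * ((q : ℝ) ^ ((d : ℝ) / 2) / Real.log q ^ η) := by
    filter_upwards [hK, tendsto_log_natCast.eventually (eventually_ge_atTop 1)] with q hq hL _ h5 h6
    refine (hq h5 h6).trans (mul_le_mul_of_nonneg_left ?_ hK0)
    have : 0 < Real.log q := by linarith
    gcongr
  have hpos : ∀ q : ℕ, 2 ≤ q → 0 < (q : ℝ) ^ ((d : ℝ) / 2) / Real.log q ^ η := fun q hq => by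
    have h1 : (1 : ℝ) < q := by exact_mod_cast hq
    have := Real.log_pos h1
    positivity
  classical
  obtain ⟨K', hK'⟩ := LDatum.exists_forall_le_mul_of_eventually
    (f := fun q => if h : NeZero q then ∑ χ ∈ primitiveChars q, ‖F.twistL χ (1 / 2)‖ ^ 2 else 0)
    (P := fun q => ∃ _ : NeZero q, F.ZeroDensityBound q C A K₅ ∧ F.SubconvexityBound q δ K₆)
    hpos (K := K) (by
      filter_upwards [hev] with q hq
      rintro ⟨hq0, h5, h6⟩
      rw [dif_pos hq0]
      exact hq hq0 h5 h6)
  refine ⟨K', fun q hq0 hq h5 h6 => ?_⟩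
  have := hK' q hq ⟨hq0, h5, h6⟩
  rwa [dif_pos hq0] at this
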